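/- Let $M$ be a smooth four-dimensional manifold with a smooth metric $h$ of signature $(2,2)$ and an $\mathbf{SO}^{+}$-orientation, so that the projective bundles of (real) unprimed and primed spinors are defined; locally $TM = S\otimes S'$ and $h_{ab}=\epsilon_{AB}\epsilon_{A'B'}$, and $\nabla$ denotes the Levi-Civita connection and the induced spin connections. Let $[\pi^{A'}]$ be a smooth field of real projective primed spinors. A local scaled representative (LSR) is a local smooth nowhere zero primed spinor field $\pi^{A'}$ whose projective class is $[\pi^{A'}]$; put $S_a:=\pi_{B'}\nabla_a\pi^{B'}$. The $\alpha$-distribution of $[\pi^{A'}]$ is $Z_{[\pi]}=\{\eta^A\pi^{A'}\}$. Suppose that, for every LSR, (i) $\pi^{A'}S_{AA'}=0$ (that is, $Z_{[\pi]}$ is integrable), and $[\pi^{A'}]$ is a multiple Weyl principal spinor, $\tilde\Psi_{A'B'C'D'}\pi^{B'}\pi^{C'}\pi^{D'}=0$, where $\tilde\Psi_{A'B'C'D'}$ is the self-dual Weyl spinor (i.e. $(M,h,[\pi^{A'}])$ is a real algebraically special $\alpha$-geometry); (ii) $[\pi^{A'}]$ is a Ricci principal spinor, $\Phi_{ABA'B'}\pi^{A'}\pi^{B'}=0$,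 where $\Phi_{ABA'B'}$ is the Ricci spinor. Let $p\in M$ be a point at which the $\alpha$-distribution is not parallel, i.e. $S_a\neq 0$ at $p$ for some (equivalently, every) LSR near $p$. Then $p$ has an open neighbourhood $\mathcal U$ with conformal oriented Walker coordinates $(U,V,X,Y)$ for which $$\Omega=(MU+NV)^{-1}\quad\text{on }\mathcal U$$ for some real constants $M$ and $N$. Here "conformal oriented Walker coordinates" means: there is a smooth function $\Omega>0$ on $\mathcal U$ and a metric $g$ on $\mathcal U$ with $h=\Omega^2g$ such that $(\mathcal U,g,[\pi^{A'}])$ is a Walker geometry (with respect to $g$, $S_a=0$ for every LSR), $\partial_U,\partial_V$ span $Z_{[\pi]}$, the matrix of $g$ in the coordinates $(U,V,X,Y)$ is $$\begin{pmatrix}0&0&1&0\\0&0&0&1\\1&0&A&C\\0&1&C&B\end{pmatrix}$$ for some functions $A,B,C$ on $\mathcal U$, and the coordinates are oriented: locally there are an LSR $\pi^{A'}$ and an unprimed spin frame $\{\alpha^A,\beta^A\}$ of $g$ with $\beta^A\alpha_A=1$, $\partial_U=\alpha^A\pi^{A'}$ and $\partial_V=\beta^A\pi^{A'}$. -/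

import Mathlib

open scoped Manifold ContDiff Matrix LinearAlgebra.Projectivization

noncomputable section

namespace NeutralSpin

/-- The model space `ℝ⁴`. -/
abbrev E4 : Type := EuclideanSpace ℝ (Fin 4)

/-- Frame indices: a pair `a = (A, A')` of an unprimed and a primed concrete spinor index. -/
abbrev Idx : Type := Fin 2 × Fin 2

/-- The components `ε_{AB} = ε^{AB}` of the skew form in a spin frame (`ε_{01} = 1`); the same matrix
serves for primed indices. -/
def eps : Matrix (Fin 2) (Fin 2) ℝ := !![0, 1; -1, 0]

/-- Components of a neutral metric in a null tetrad, `η_{ab} = ε_{AB} ε_{A'B'}`. This matrix is its own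
inverse, so it also stands for `η^{ab}`. -/
def eta (a b : Idx) : ℝ := eps a.1 b.1 * eps a.2 b.2

section Manifold

variable {M : Type*} [TopologicalSpace M] [ChartedSpace E4 M]

/-- Four tangent vectors `e_{AA'} = o_A o_{A'}` at a point, indexed by pairs of spinor indices. -/
abbrev Tetrad (q : M) : Type := Idx → TangentSpace (𝓡 4) q

/-- The tetrad belonging to the spin frames `o_B L^B_A`, `o_{B'} L'^{B'}_{A'}`. -/
def Tetrad.change {q : M} (e : Tetrad q) (L L' : Matrix (Fin 2) (Fin 2) ℝ) : Tetrad q :=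
  fun a => ∑ B : Fin 2, ∑ B' : Fin 2, (L B a.1 * L' B' a.2) • e (B, B')

/-- The vector `η^A π^{A'}` where `η`, `π` are given by their components in the spin frames of the
tetrad `e`. -/
def Tetrad.vec {q : M} (e : Tetrad q) (η π : Fin 2 → ℝ) : TangentSpace (𝓡 4) q :=
  ∑ A : Fin 2, ∑ A' : Fin 2, (η A * π A') • e (A, A')

variable (M) in
/-- The raw data of a triple `(M, h, [π^{A'}])` (the laws are in `IsSpinGeometryOn`): a metric `h`, the
set of null tetrads that come from spin frames of the spinor structure, and a field of projective primed
spinors, given by its value (in terms of components) in each such null tetrad. -/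
structure SpinData where
  metric : ∀ q : M, TangentSpace (𝓡 4) q →L[ℝ] TangentSpace (𝓡 4) q →L[ℝ] ℝ
  frames : ∀ q : M, Set (Tetrad q)
  proj : ∀ q : M, Tetrad q → ℙ ℝ (Fin 2 → ℝ)

namespace SpinData

variable (G : SpinData M)

/-- The spinor with components `π` in the spin frame of `e` is a (nonzero) representative of the given
projective spinor at `q`. -/
def Represents {q : M} (e : Tetrad q) (π : Fin 2 → ℝ) : Prop :=
  ∃ hπ : π ≠ 0, G.proj q e = Projectivization.mk ℝ π hπ

variable [IsManifold (𝓡 4) ∞ M]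

/-- `h` is a smooth metric of signature `(2,2)` on `U`. -/
def IsNeutralMetricOn (U : Set M) : Prop :=
  ContMDiffOn (𝓡 4) ((𝓡 4).prod 𝓘(ℝ, E4 →L[ℝ] E4 →L[ℝ] ℝ)) ∞
    (fun q => Bundle.TotalSpace.mk' (E4 →L[ℝ] E4 →L[ℝ] ℝ)
      q (G.metric q)) U ∧
  ∀ q ∈ U, (∀ v w, G.metric q v w = G.metric q w v) ∧
    ∃ b : Module.Basis (Fin 4) ℝ (TangentSpace (𝓡 4) q),
      ∀ i j, G.metric q (b i) (b j) = Matrix.diagonal ![(1 : ℝ), 1, -1, -1] i j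

/-- `e` is a smooth null tetrad on the open set `W`, coming from spin frames of the spinor structure. -/
def IsSpinTetradOn (W : Set M) (e : ∀ q : M, Tetrad q) : Prop :=
  IsOpen W ∧
  (∀ a, ContMDiffOn (𝓡 4) (𝓡 4).tangent ∞
    (fun q => (⟨q, e q a⟩ : TangentBundle (𝓡 4) M)) W) ∧
  ∀ q ∈ W, e q ∈ G.frames q

/-- `π` is a local scaled representative (LSR) of the projective spinor field on the open set `W`: a
smooth primed spinor field, given by its components in the spin frames of the smooth tetrad `e`, whose
projective class is the given one at each point. -/
def IsLSROn (W : Set M) (e : ∀ q : M, Tetrad q) (π : M → Fin 2 → ℝ) : Prop :=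
  G.IsSpinTetradOn W e ∧
  ContMDiffOn (𝓡 4) 𝓘(ℝ, Fin 2 → ℝ) ∞ π W ∧
  ∀ q ∈ W, G.Represents (e q) (π q)

/-- `(U, h, [π^{A'}])` is a neutral geometry with an `SO⁺`-orientation (a smooth reduction of the bundle
of null tetrads to an `SL(2,ℝ) × SL(2,ℝ)`-orbit, which is what defines the projective spinor bundles) and
a smooth section `[π^{A'}]` of the bundle of real projective primed spinors. -/
structure IsSpinGeometryOn (U : Set M) : Prop where
  isOpen : IsOpen U
  neutral : G.IsNeutralMetricOn U
  null : ∀ q ∈ U, ∀ e ∈ G.frames q, ∀ a b, G.metric q (e a) (e b) = eta a b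
  orbit : ∀ q ∈ U, ∀ e ∈ G.frames q, ∀ e' : Tetrad q, e' ∈ G.frames q ↔
    ∃ L L' : Matrix (Fin 2) (Fin 2) ℝ, L.det = 1 ∧ L'.det = 1 ∧ e' = e.change L L'
  equivariant : ∀ q ∈ U, ∀ e ∈ G.frames q, ∀ L L' : Matrix (Fin 2) (Fin 2) ℝ,
    L.det = 1 → L'.det = 1 → ∀ π : Fin 2 → ℝ,
      G.Represents (e.change L L') π → G.Represents e (L' *ᵥ π)
  smooth : ∀ q ∈ U, ∃ W ⊆ U, q ∈ W ∧ ∃ e π, G.IsLSROn W e π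

/-! ### Levi-Civita connection, spin connection and curvature in a null tetrad -/

/-- Derivative of the function `f` along the tetrad vector field `e_a`. -/
def D (e : ∀ q : M, Tetrad q) (a : Idx) (f : M → ℝ) (q : M) : ℝ :=
  mfderiv (𝓡 4) 𝓘(ℝ, ℝ) f q (e q a)

/-- `h([e_a, e_b], e_c)`. -/
def bracketCoeff (e : ∀ q : M, Tetrad q) (a b c : Idx) (q : M) : ℝ :=
  G.metric q (VectorField.mlieBracket (𝓡 4) (fun r => e r a) (fun r => e r b) q) (e q c)

/-- `h(∇_{e_a} e_b, e_c)` for the Levi-Civita connection, by Koszul's formula (the functions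
`h(e_a, e_b)` are constant in a null tetrad). -/
def connLower (e : ∀ q : M, Tetrad q) (a b c : Idx) (q : M) : ℝ :=
  (G.bracketCoeff e a b c q - G.bracketCoeff e b c a q + G.bracketCoeff e c a b q) / 2

/-- Connection coefficients: `∇_{e_a} e_b = ∑_c γ_{ab}^c e_c`. -/
def conn (e : ∀ q : M, Tetrad q) (a b c : Idx) (q : M) : ℝ :=
  ∑ d, G.connLower e a b d q * eta d c

/-- Curvature components `R_{abc}^d`: `(∇_a ∇_b - ∇_b ∇_a - ∇_{[e_a,e_b]}) e_c = ∑_d R_{abc}^d e_d`. -/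
def riem (e : ∀ q : M, Tetrad q) (a b c d : Idx) (q : M) : ℝ :=
  D e a (G.conn e b c d) q - D e b (G.conn e a c d) q
    + ∑ f, (G.conn e b c f q * G.conn e a f d q - G.conn e a c f q * G.conn e b f d q
      - (G.conn e a b f q - G.conn e b a f q) * G.conn e f c d q)

/-- `R_{abcd} = h(R(e_a, e_b) e_c, e_d)`. -/
def riemLower (e : ∀ q : M, Tetrad q) (a b c d : Idx) (q : M) : ℝ :=
  ∑ f, G.riem e a b c f q * eta f d

/-- The connection coefficients on primed spinors, `∇_{e_a} o_{B'} = ∑_{C'} Γ_{aB'}^{C'} o_{C'}`: the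
primed trace-free part in `γ_{a BB'}^{CC'} = Γ_{aB}^C δ_{B'}^{C'} + δ_B^C Γ_{aB'}^{C'}`. -/
def spinConn (e : ∀ q : M, Tetrad q) (a : Idx) (B' C' : Fin 2) (q : M) : ℝ :=
  (∑ B : Fin 2, G.conn e a (B, B') (B, C') q) / 2

/-- The component `(∇_{e_a} π)^{C'}` of the covariant derivative of a primed spinor field. -/
def covSpinor (e : ∀ q : M, Tetrad q) (π : M → Fin 2 → ℝ) (a : Idx) (C' : Fin 2) (q : M) : ℝ :=
  D e a (fun r => π r C') q + ∑ B' : Fin 2, G.spinConn e a B' C' q * π q B'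

/-- `S_a = π_{B'} ∇_a π^{B'}`, where `π_{B'} = π^{A'} ε_{A'B'}`. -/
def S (e : ∀ q : M, Tetrad q) (π : M → Fin 2 → ℝ) (a : Idx) (q : M) : ℝ :=
  ∑ A' : Fin 2, ∑ B' : Fin 2, π q A' * eps A' B' * G.covSpinor e π a B' q

/-- `X_{A'B'C'D'} = ¼ ε^{AB} ε^{CD} R_{AA'BB'CC'DD'}`, indexed by `i = (A', B', C', D')`. -/
def curvSpinor (e : ∀ q : M, Tetrad q) (i : Fin 4 → Fin 2) (q : M) : ℝ :=
  (∑ A : Fin 2, ∑ B : Fin 2, ∑ C : Fin 2, ∑ D : Fin 2,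
    eps A B * eps C D * G.riemLower e (A, i 0) (B, i 1) (C, i 2) (D, i 3) q) / 4

/-- The SD Weyl spinor: the totally symmetric part `X_{(A'B'C'D')}`. -/
def weylSpinor (e : ∀ q : M, Tetrad q) (i : Fin 4 → Fin 2) (q : M) : ℝ :=
  (∑ σ : Equiv.Perm (Fin 4), G.curvSpinor e (i ∘ σ) q) / 24

/-- The Ricci spinor `Φ_{ABA'B'} = ¼ ε^{C'D'} ε^{CD} R_{AC'BD'CA'DB'}`. -/
def ricciSpinor (e : ∀ q : M, Tetrad q) (A B A' B' : Fin 2) (q : M) : ℝ :=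
  (∑ C' : Fin 2, ∑ D' : Fin 2, ∑ C : Fin 2, ∑ D : Fin 2,
    eps C' D' * eps C D * G.riemLower e (A, C') (B, D') (C, A') (D, B') q) / 4

/-! ### The geometries -/

/-- `π^{A'} S_{AA'} = 0` on `U` for every LSR: the α-distribution is integrable. -/
def IsIntegrableOn (U : Set M) : Prop :=
  ∀ W ⊆ U, ∀ e π, G.IsLSROn W e π → ∀ q ∈ W, ∀ A : Fin 2,
    ∑ A' : Fin 2, π q A' * G.S e π (A, A') q = 0

/-- `[π^{A'}]` is a Weyl principal spinor of multiplicity at least two on `U`: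
`Ψ_{A'B'C'D'} π^{B'} π^{C'} π^{D'} = 0` for every LSR. -/
def IsMultipleWPSOn (U : Set M) : Prop :=
  ∀ W ⊆ U, ∀ e π, G.IsLSROn W e π → ∀ q ∈ W, ∀ A' : Fin 2,
    ∑ B' : Fin 2, ∑ C' : Fin 2, ∑ D' : Fin 2,
      G.weylSpinor e ![A', B', C', D'] q * π q B' * π q C' * π q D' = 0

/-- `[π^{A'}]` is a Ricci principal spinor on `U`: `Φ_{ABA'B'} π^{A'} π^{B'} = 0` for every LSR. -/
def IsRPSOn (U : Set M) : Prop :=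
  ∀ W ⊆ U, ∀ e π, G.IsLSROn W e π → ∀ q ∈ W, ∀ A B : Fin 2,
    ∑ A' : Fin 2, ∑ B' : Fin 2, G.ricciSpinor e A B A' B' q * π q A' * π q B' = 0

/-- The α-distribution is parallel at the point `q`: `S_a = 0` there, for every LSR near `q`. -/
def IsParallelAt (q : M) : Prop :=
  ∀ W, q ∈ W → ∀ e π, G.IsLSROn W e π → ∀ a, G.S e π a q = 0

/-- `(U, h, [π^{A'}])` is a real algebraically special α-geometry. -/
structure IsASAlphaGeometryOn (U : Set M) : Prop extends G.IsSpinGeometryOn U where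
  integrable : G.IsIntegrableOn U
  multipleWPS : G.IsMultipleWPSOn U

/-- `(U, h, [π^{A'}])` is a Walker geometry: the α-distribution is parallel. -/
structure IsWalkerGeometryOn (U : Set M) : Prop extends G.IsSpinGeometryOn U where
  parallel : ∀ q ∈ U, G.IsParallelAt q

/-- The conformal rescaling of `(M, h, [π^{A'}])` to `(M, χ² h, [π^{A'}])`: spinors and projective
spinors are the same, and the skew forms `ε_{AB}`, `ε_{A'B'}` are both multiplied by `χ`, so the spin
frames are those of `h` multiplied by `χ^{-1/2}`, and the tetrads those of `h` multiplied by `χ⁻¹`. -/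
def rescale (χ : M → ℝ) : SpinData M where
  metric q := (χ q) ^ 2 • G.metric q
  frames q := {e | (fun a => χ q • e a) ∈ G.frames q}
  proj q e := G.proj q (fun a => χ q • e a)

/-- The α-plane `{η^A π^{A'}}` of `[π^{A'}]` at `q`. -/
def alphaPlane (q : M) : Set (TangentSpace (𝓡 4) q) :=
  {v | ∃ e ∈ G.frames q, ∃ π, G.Represents e π ∧ ∃ η, v = e.vec η π}

/-- The coordinate vector field `∂_i` of a chart. -/
def coordVec (φ : OpenPartialHomeomorph M E4) (i : Fin 4) (q : M) : TangentSpace (𝓡 4) q :=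
  (mfderiv (𝓡 4) 𝓘(ℝ, E4) φ q).inverse (EuclideanSpace.single i (1 : ℝ))

/-- The chart `φ = (u, v, x, y)` is a system of Walker coordinates on its domain: a Frobenius chart for the
α-distribution (`∂_u`, `∂_v` span it) in which the metric has the Walker form. -/
def IsWalkerChart (φ : OpenPartialHomeomorph M E4) : Prop :=
  φ ∈ IsManifold.maximalAtlas (𝓡 4) ∞ M ∧
  (∀ q ∈ φ.source, G.alphaPlane q =
    (Submodule.span ℝ {coordVec φ 0 q, coordVec φ 1 q} : Set (TangentSpace (𝓡 4) q))) ∧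
  ∃ a b c : M → ℝ, ∀ q ∈ φ.source, ∀ i j : Fin 4,
    G.metric q (coordVec φ i q) (coordVec φ j q) =
      !![0, 0, 1, 0;
         0, 0, 0, 1;
         1, 0, a q, c q;
         0, 1, c q, b q] i j

/-- The Walker coordinates `(u, v, x, y)` are oriented: near each point there are an LSR `π^{A'}` and an
unprimed spin frame `{α^A, β^A}` with `∂_u = α^A π^{A'}` and `∂_v = β^A π^{A'}`. (In Walker coordinates the
covectors `h(∂_u, ·)` and `h(∂_v, ·)` are `dx` and `dy`, so `dx = α_A π_{A'}`, `dy = β_A π_{A'}` too.) -/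
def IsOrientedWalkerChart (φ : OpenPartialHomeomorph M E4) : Prop :=
  G.IsWalkerChart φ ∧
  ∀ q ∈ φ.source, ∃ W ⊆ φ.source, q ∈ W ∧ ∃ e π, G.IsLSROn W e π ∧
    ∀ r ∈ W, coordVec φ 0 r = (e r).vec ![1, 0] (π r) ∧ coordVec φ 1 r = (e r).vec ![0, 1] (π r)

/-- `φ` is a system of conformal oriented Walker coordinates with conformal factor `Ω` on its domain `U`:
`h = Ω² g` on `U`, with `Ω` smooth and positive, `(U, g, [π^{A'}])` is a Walker geometry and `φ` is a
system of oriented Walker coordinates for it. -/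
def IsConformalOrientedWalkerChart (φ : OpenPartialHomeomorph M E4) (Ω : M → ℝ) : Prop :=
  (∀ q ∈ φ.source, 0 < Ω q) ∧
  ContMDiffOn (𝓡 4) 𝓘(ℝ, ℝ) ∞ Ω φ.source ∧
  (G.rescale fun q => (Ω q)⁻¹).IsWalkerGeometryOn φ.source ∧
  (G.rescale fun q => (Ω q)⁻¹).IsOrientedWalkerChart φ

end SpinData

end Manifold

end NeutralSpin

end

/-!
Why the theorem holds. The α-distribution `Z` is integrable, so by Frobenius it has a two-dimensional
local leaf space. Since `Z` is totally null and of rank two, `h` identifies it with the covectors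
annihilating `Z`; hence there is a spin tetrad with `[π] = (1, 0)` in which the covector fields
`h(e_{A0'}, ·)` are the differentials `dz_A` of two functions constant on the leaves
(`IsIntegrableOn.exists_adapted`). In such an adapted tetrad every bracket `[e_a, e_b]` lies in `Z`. Put
`α = e_{00'}`, `β = e_{10'}` and `[α, β] = P α - N β`. The Ricci condition and the multiple Weyl condition
then reduce to first-order equations for `P` and `N` along the leaves (`IsAdaptedOn.derivative_eqs`):

`α P = - P N / 2`, `β P = - P² / 2`, `α N = - N² / 2`, `β N = - P N / 2`.

They say first that `N`, `P` satisfy the integrability condition for `α u = N`, `β u = P`, so that `u`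
exists by the Poincaré lemma along the leaves (`exists_leafwise_primitive`). Put `f = exp u` and
`w = exp (-u / 2)`; the conformal factor is `Ω = w⁻¹`, so `g = w² h`. The fields `f α`, `f β` commute, and
the equations say secondly that `κ_A = f e_{A0'} w` is constant on the leaves
(`IsAdaptedOn.exists_conformalFactor`). If both `κ_A` vanished at `p`, then `P` and `N` would vanish there
and `Z` would be parallel at `p`, by Koszul's formula (`IsAdaptedOn.isParallelAt`). Thus `κ` is a vector
field on the leaf space with `κ(p) ≠ 0`, and `exists_leafSpace_rectification` straightens it: there are
leaf coordinates `X_0, X_1` with `κ X_0 = 1` and `κ X_1 = 0`. Their gradients `Γ_0, Γ_1` for `g` span `Z`.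
They commute, being combinations of `f α`, `f β` with leafwise constant coefficients, and
`Γ_A w = κ X_A`, so that `Γ_0 w = 1` and `Γ_1 w = 0` (`exists_commuting_gradients`).

Hence `U = w` can serve as the first coordinate along the leaves, and a function `V` with `Γ_0 V = 0`,
`Γ_1 V = 1` as the second. The functions `U, V, X_0, X_1` are Walker coordinates for `g` with
`∂_U = Γ_0`, `∂_V = Γ_1` (`IsAdaptedOn.exists_orientedWalkerChart`), and `Z` is parallel for `g` because
`Γ_0` and `Γ_1` commute. So `Ω = U⁻¹`, that is, `M = 1` and `N = 0`. The orientation may require the signs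
of `V` and `X_1` to be changed together.

Mathlib has neither smooth dependence of flows on initial values nor Frobenius' theorem. The flow of a
compactly supported field is obtained from the inverse function theorem in the Banach space of paths,
where composition with a smooth compactly supported map is a smooth operator (`contDiff_superpose`,
`exists_smooth_flow_of_compactSupport`). It gives the rectification of a vector field and smooth solutions
of `∂ g / ∂ t = f`, and applying these twice gives Frobenius coordinates for a plane field
(`exists_frobenius_coordinates`).
-/

noncomputable section

namespace NeutralSpin

open Filter Topology

/-! ### Inverse functions and superposition operators -/

/-- A map that is smooth near `a` and has invertible derivative at `a` restricts to a local
diffeomorphism; the source can be taken so small that the map is smooth with smooth inverse at each of its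
points, not only at `a`. -/
theorem exists_localInverse {E F : Type} [NormedAddCommGroup E] [NormedSpace ℝ E] [CompleteSpace E]
    [NormedAddCommGroup F] [NormedSpace ℝ F] [CompleteSpace F] {f : E → F} {a : E} (f' : E ≃L[ℝ] F)
    (hf : ∀ᶠ x in 𝓝 a, ContDiffAt ℝ ∞ f x) (hf' : HasFDerivAt f (f' : E →L[ℝ] F) a) :
    ∃ Φ : OpenPartialHomeomorph E F, a ∈ Φ.source ∧ (∀ x, Φ x = f x) ∧
      (∀ x ∈ Φ.source, ContDiffAt ℝ ∞ f x) ∧ (∀ y ∈ Φ.target, ContDiffAt ℝ ∞ Φ.symm y) := by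
  have ha : ContDiffAt ℝ ∞ f a := hf.self_of_nhds
  have hcont : ContinuousAt (fderiv ℝ f) a := (ha.fderiv_right (m := 0) (by simp)).continuousAt
  have hinv : ∀ᶠ x in 𝓝 a, fderiv ℝ f x ∈ Set.range ((↑) : (E ≃L[ℝ] F) → E →L[ℝ] F) := by
    apply hcont
    rw [hf'.fderiv]
    exact ContinuousLinearEquiv.nhds f'
  obtain ⟨s, hs, hso, has⟩ := eventually_nhds_iff.1 (hf.and hinv)
  set Φ₀ := ha.toOpenPartialHomeomorph f hf' (by simp) with hΦ₀
  have hcoe : ∀ x, Φ₀ x = f x := fun x => rfl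
  have hΦa : a ∈ Φ₀.source := ha.mem_toOpenPartialHomeomorph_source hf' (by simp)
  refine ⟨Φ₀.restrOpen s hso, ⟨hΦa, has⟩, fun x => rfl, fun x hx => (hs x hx.2).1, ?_⟩
  intro y hy
  have hy' : y ∈ Φ₀.target := hy.1
  have hys : Φ₀.symm y ∈ s := ((Φ₀.restrOpen s hso).map_target hy).2
  obtain ⟨e, he⟩ := (hs _ hys).2
  have hd : HasFDerivAt Φ₀ (e : E →L[ℝ] F) (Φ₀.symm y) := by
    rw [he]
    exact ((hs _ hys).1.differentiableAt (by simp)).hasFDerivAt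
  exact Φ₀.contDiffAt_symm hy' hd (hs _ hys).1

/-- The superposition (Nemytskii) operator `γ ↦ f ∘ γ` on spaces of continuous functions. -/
def superpose {K E F : Type} [TopologicalSpace K] [TopologicalSpace E] [TopologicalSpace F]
    (f : E → F) (hf : Continuous f) (γ : C(K, E)) : C(K, F) :=
  (⟨f, hf⟩ : C(E, F)).comp γ

@[simp] lemma superpose_apply {K E F : Type} [TopologicalSpace K] [TopologicalSpace E]
    [TopologicalSpace F] (f : E → F) (hf : Continuous f) (γ : C(K, E)) (t : K) :
    superpose f hf γ t = f (γ t) := rfl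

section Superposition

variable {K : Type} [TopologicalSpace K] [CompactSpace K]
  {E F : Type} [NormedAddCommGroup E] [NormedSpace ℝ E] [NormedAddCommGroup F] [NormedSpace ℝ F]

/-- Pointwise application of a continuous family of operators to a continuous family of vectors. -/
def pointwiseApply : C(K, E →L[ℝ] F) →L[ℝ] C(K, E) →L[ℝ] C(K, F) :=
  LinearMap.mkContinuous₂
    (LinearMap.mk₂ ℝ (fun (A : C(K, E →L[ℝ] F)) (h : C(K, E)) =>
        (⟨fun t => A t (h t), by fun_prop⟩ : C(K, F)))
      (fun A B h => by ext t; simp) (fun c A h => by ext t; simp)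
      (fun A h k => by ext t; simp) (fun c A h => by ext t; simp)) 1
    (fun A h => by
      rw [one_mul, ContinuousMap.norm_le _ (by positivity)]
      intro t
      refine ((A t).le_opNorm _).trans ?_
      gcongr
      exacts [A.norm_coe_le_norm t, h.norm_coe_le_norm t])

@[simp] lemma pointwiseApply_apply (A : C(K, E →L[ℝ] F)) (h : C(K, E)) (t : K) :
    pointwiseApply A h t = A t (h t) := rfl

lemma hasFDerivAt_superpose {f : E → F} (hf : ContDiff ℝ ∞ f) (hc : HasCompactSupport f)
    (γ : C(K, E)) :
    HasFDerivAt (superpose f hf.continuous : C(K, E) → C(K, F))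
      (pointwiseApply (superpose (fderiv ℝ f) (hf.continuous_fderiv (by simp)) γ)) γ := by
  obtain ⟨C, hC⟩ := ContDiff.lipschitzWith_of_hasCompactSupport (𝕂 := ℝ) (n := ∞) (hc.fderiv ℝ)
    (hf.fderiv_right (by simp)) (by simp)
  rw [hasFDerivAt_iff_isLittleO_nhds_zero]
  have hbound : ∀ h : C(K, E), ‖superpose f hf.continuous (γ + h) - superpose f hf.continuous γ -
      pointwiseApply (superpose (fderiv ℝ f) (hf.continuous_fderiv (by simp)) γ) h‖
        ≤ C * ‖h‖ * ‖h‖ := by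
    intro h
    rw [ContinuousMap.norm_le _ (by positivity)]
    intro t
    have hh : ‖h t‖ ≤ ‖h‖ := h.norm_coe_le_norm t
    have key := (convex_closedBall (γ t) ‖h‖).norm_image_sub_le_of_norm_hasFDerivWithin_le'
      (f := f) (f' := fderiv ℝ f) (φ := fderiv ℝ f (γ t)) (C := C * ‖h‖) (x := γ t)
      (y := γ t + h t)
      (fun x _ => (hf.differentiable (by simp) x).hasFDerivAt.hasFDerivWithinAt)
      (fun x hx => by
        rw [← dist_eq_norm]
        exact (hC.dist_le_mul x (γ t)).trans
          (mul_le_mul_of_nonneg_left (Metric.mem_closedBall.1 hx) C.2))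
      (Metric.mem_closedBall_self (norm_nonneg _))
      (by simpa [Metric.mem_closedBall, dist_eq_norm] using hh)
    simp only [add_sub_cancel_left] at key
    simpa using key.trans (mul_le_mul_of_nonneg_left hh (by positivity))
  refine Asymptotics.IsBigO.trans_isLittleO (g := fun h : C(K, E) => ‖h‖ * ‖h‖) ?_ ?_
  · refine Asymptotics.IsBigO.of_bound C (Eventually.of_forall fun h => ?_)
    have := hbound h
    rw [Real.norm_of_nonneg (by positivity), ← mul_assoc]
    exact this
  · have : (fun h : C(K, E) => ‖h‖) =o[𝓝 0] (fun _ => (1 : ℝ)) := by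
      rw [Asymptotics.isLittleO_one_iff]
      simpa using (continuous_norm (E := C(K, E))).tendsto 0
    have h2 := this.mul_isBigO (Asymptotics.isBigO_refl (fun h : C(K, E) => ‖h‖) (𝓝 0))
    simp only [one_mul] at h2
    exact Asymptotics.isLittleO_norm_right.1 h2

/-- The superposition operator of a smooth function with compact support is smooth: its derivative is
again built from a superposition operator. -/
lemma contDiff_superpose {f : E → F} (hf : ContDiff ℝ ∞ f) (hc : HasCompactSupport f) :
    ContDiff ℝ ∞ (superpose f hf.continuous : C(K, E) → C(K, F)) := by
  rw [contDiff_infty]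
  intro n
  induction n generalizing F with
  | zero =>
    refine contDiff_zero.2 (continuous_iff_continuousAt.2 fun γ => ?_)
    exact (hasFDerivAt_superpose hf hc γ).continuousAt
  | succ n ih =>
    push_cast
    rw [contDiff_succ_iff_hasFDerivAt]
    have h1 : ContDiff ℝ n (superpose (fderiv ℝ f) (hf.continuous_fderiv (by simp)) :
        C(K, E) → C(K, E →L[ℝ] F)) := ih (hf.fderiv_right (by simp)) (hc.fderiv ℝ)
    have h2 : ContDiff ℝ n (pointwiseApply : C(K, E →L[ℝ] F) → C(K, E) →L[ℝ] C(K, F)) := by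
      fun_prop
    exact ⟨_, h2.comp h1, fun γ => hasFDerivAt_superpose hf hc γ⟩

end Superposition

/-! ### Smooth flows and rectification of a vector field -/

section Flow

variable {E : Type} [NormedAddCommGroup E]

/-- A path on `[-1, 1]` extended to `ℝ` by constants. -/
def extendPath (γ : C(Set.Icc (-1 : ℝ) 1, E)) (r : ℝ) : E :=
  γ (Set.projIcc (-1) 1 (by norm_num) r)

lemma continuous_extendPath (γ : C(Set.Icc (-1 : ℝ) 1, E)) : Continuous (extendPath γ) :=
  γ.continuous.comp continuous_projIcc

lemma extendPath_of_mem (γ : C(Set.Icc (-1 : ℝ) 1, E)) {r : ℝ} (hr : r ∈ Set.Icc (-1 : ℝ) 1) :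
    extendPath γ r = γ ⟨r, hr⟩ := by
  rw [extendPath, Set.projIcc_of_mem _ hr]

variable [NormedSpace ℝ E]

/-- The primitive vanishing at `0` of a path on `[-1, 1]`. -/
def pathPrimitive : C(Set.Icc (-1 : ℝ) 1, E) →L[ℝ] C(Set.Icc (-1 : ℝ) 1, E) :=
  LinearMap.mkContinuous
    { toFun := fun γ => ⟨fun s => ∫ r in (0 : ℝ)..s, extendPath γ r,
        (intervalIntegral.continuous_primitive
          (fun a b => (continuous_extendPath γ).intervalIntegrable a b) 0).comp
            continuous_subtype_val⟩
      map_add' := fun γ δ => by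
        ext s
        exact intervalIntegral.integral_add ((continuous_extendPath γ).intervalIntegrable _ _)
          ((continuous_extendPath δ).intervalIntegrable _ _)
      map_smul' := fun c γ => by
        ext s
        exact intervalIntegral.integral_smul c _ } 1
    (fun γ => by
      rw [one_mul, ContinuousMap.norm_le _ (norm_nonneg _)]
      intro s
      refine (intervalIntegral.norm_integral_le_of_norm_le_const (C := ‖γ‖)
        fun r _ => γ.norm_coe_le_norm _).trans ?_
      have : |(s : ℝ) - 0| ≤ 1 := by
        rw [sub_zero]; exact abs_le.2 s.2
      exact mul_le_of_le_one_right (norm_nonneg _) this)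

lemma pathPrimitive_apply (γ : C(Set.Icc (-1 : ℝ) 1, E)) (s : Set.Icc (-1 : ℝ) 1) :
    pathPrimitive γ s = ∫ r in (0 : ℝ)..s, extendPath γ r := rfl

lemma norm_pathPrimitive_le (γ : C(Set.Icc (-1 : ℝ) 1, E)) : ‖pathPrimitive γ‖ ≤ ‖γ‖ := by
  simpa using (LinearMap.mkContinuous_norm_le _ zero_le_one _ : ‖pathPrimitive (E := E)‖ ≤ 1)
    |> (pathPrimitive (E := E)).le_of_opNorm_le (x := γ)

/-- The integral operator of the differential equation `γ' = f(γ)`. -/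
def odeOperator (f : E → E) (hf : Continuous f) (γ : C(Set.Icc (-1 : ℝ) 1, E)) :
    C(Set.Icc (-1 : ℝ) 1, E) :=
  pathPrimitive (superpose f hf γ)

lemma norm_odeOperator_sub_le {f : E → E} (hf : Continuous f) {C : NNReal} (hC : LipschitzWith C f)
    (γ δ : C(Set.Icc (-1 : ℝ) 1, E)) :
    ‖odeOperator f hf γ - odeOperator f hf δ‖ ≤ C * ‖γ - δ‖ := by
  rw [odeOperator, odeOperator, ← map_sub]
  refine (norm_pathPrimitive_le _).trans ?_
  rw [ContinuousMap.norm_le _ (by positivity)]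
  intro t
  have h1 := hC.dist_le_mul (γ t) (δ t)
  rw [dist_eq_norm, dist_eq_norm] at h1
  exact h1.trans (mul_le_mul_of_nonneg_left ((γ - δ).norm_coe_le_norm t) C.2)

/-- Integral curves with the same initial value and the same (small) speed factor agree. -/
lemma integralPath_unique {f : E → E} (hf : Continuous f) {C : NNReal} (hC : LipschitzWith C f)
    {t : ℝ} (ht : |t| * C < 1) {c γ δ : C(Set.Icc (-1 : ℝ) 1, E)}
    (hγ : γ = c + t • odeOperator f hf γ) (hδ : δ = c + t • odeOperator f hf δ) : γ = δ := by
  have h : γ - δ = t • (odeOperator f hf γ - odeOperator f hf δ) := by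
    conv_lhs => rw [hγ, hδ]
    rw [smul_sub]; abel
  have h2 : ‖γ - δ‖ ≤ (|t| * C) * ‖γ - δ‖ := by
    conv_lhs => rw [h]
    rw [norm_smul, Real.norm_eq_abs, mul_assoc]
    exact mul_le_mul_of_nonneg_left (norm_odeOperator_sub_le hf hC γ δ) (abs_nonneg _)
  have h3 : ‖γ - δ‖ = 0 := by
    by_contra h0
    have : 0 < ‖γ - δ‖ := lt_of_le_of_ne (norm_nonneg _) (Ne.symm h0)
    nlinarith
  exact sub_eq_zero.1 (norm_eq_zero.1 h3)

/-- Restricting an integral curve to `[-s, s]` and rescaling it to `[-1, 1]` changes the speed factor by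
`s`. -/
lemma integralPath_rescale {f : E → E} (hf : Continuous f) {x : E} {T : ℝ}
    {γ : C(Set.Icc (-1 : ℝ) 1, E)}
    (hγ : γ = ContinuousMap.const _ x + T • odeOperator f hf γ) (s : Set.Icc (-1 : ℝ) 1) :
    ∃ δ : C(Set.Icc (-1 : ℝ) 1, E),
      δ = ContinuousMap.const _ x + (T * s) • odeOperator f hf δ ∧
        δ ⟨1, by norm_num⟩ = γ s := by
  have hmem : ∀ r : ℝ, r ∈ Set.Icc (-1 : ℝ) 1 → (s : ℝ) * r ∈ Set.Icc (-1 : ℝ) 1 := by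
    intro r hr
    rw [Set.mem_Icc, ← abs_le] at hr ⊢
    have := abs_le.2 s.2
    rw [abs_mul]
    exact mul_le_one₀ this (abs_nonneg _) hr
  let δ : C(Set.Icc (-1 : ℝ) 1, E) :=
    ⟨fun r => γ ⟨s * r, hmem r r.2⟩, by fun_prop⟩
  refine ⟨δ, ?_, by simp [δ]⟩
  ext r
  have h1 : δ r = x + T • ∫ u in (0 : ℝ)..(s * r), f (extendPath γ u) := by
    change γ ⟨s * r, hmem r r.2⟩ = _
    conv_lhs => rw [hγ]
    rfl
  have h2 : ∫ u in (0 : ℝ)..(s * r), f (extendPath γ u)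
      = (s : ℝ) • ∫ u in (0 : ℝ)..r, f (extendPath δ u) := by
    have := intervalIntegral.smul_integral_comp_mul_left (a := 0) (b := (r : ℝ))
      (fun u => f (extendPath γ u)) (s : ℝ)
    rw [mul_zero] at this
    rw [← this]
    congr 1
    apply intervalIntegral.integral_congr
    intro u hu
    have hu' : u ∈ Set.Icc (-1 : ℝ) 1 := by
      have := Set.uIcc_subset_Icc (show (0 : ℝ) ∈ Set.Icc (-1 : ℝ) 1 by norm_num) r.2
      exact this hu
    change f (extendPath γ (s * u)) = f (extendPath δ u)
    rw [extendPath_of_mem δ hu', extendPath_of_mem γ (hmem u hu')]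
    rfl
  rw [h1, h2, smul_smul]
  rfl

/-- The flow of a compactly supported smooth vector field is defined and smooth near `(x₀, 0)`. The
integral equation `γ - t ∫ f(γ) = x` is solved for the path `γ` by the inverse function theorem; `t` enters
as a parameter, so that the solution is jointly smooth in `(x, t)`. -/
theorem exists_smooth_flow_of_compactSupport [CompleteSpace E] {f : E → E} (hf : ContDiff ℝ ∞ f)
    (hc : HasCompactSupport f) (x₀ : E) :
    ∃ ψ : E × ℝ → E, ∀ᶠ z in 𝓝 (x₀, (0 : ℝ)), ContDiffAt ℝ ∞ ψ z ∧ (z.2 = 0 → ψ z = z.1) ∧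
      HasDerivAt (fun t => ψ (z.1, t)) (f (ψ z)) z.2 := by
  obtain ⟨C, hC⟩ := hf.lipschitzWith_of_hasCompactSupport hc (by simp)
  have hK : ContDiff ℝ ∞ (odeOperator f hf.continuous) :=
    (pathPrimitive (E := E)).contDiff.comp (contDiff_superpose hf hc)
  set cst : E →L[ℝ] C(Set.Icc (-1 : ℝ) 1, E) := ContinuousLinearMap.const ℝ _ with hcst
  let Θ : (E × ℝ) × C(Set.Icc (-1 : ℝ) 1, E) → (E × ℝ) × C(Set.Icc (-1 : ℝ) 1, E) :=
    fun z => (z.1, z.2 - z.1.2 • odeOperator f hf.continuous z.2 - cst z.1.1)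
  have hΘ : ContDiff ℝ ∞ Θ := by
    have h1 : ContDiff ℝ ∞ (fun z : (E × ℝ) × C(Set.Icc (-1 : ℝ) 1, E) =>
      odeOperator f hf.continuous z.2) := hK.comp contDiff_snd
    have h2 : ContDiff ℝ ∞ (fun z : (E × ℝ) × C(Set.Icc (-1 : ℝ) 1, E) => cst z.1.1) :=
      cst.contDiff.comp (contDiff_fst.comp contDiff_fst)
    have h3 : ContDiff ℝ ∞ (fun z : (E × ℝ) × C(Set.Icc (-1 : ℝ) 1, E) => z.1.2) :=
      contDiff_snd.comp contDiff_fst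
    exact contDiff_fst.prodMk ((contDiff_snd.sub (h3.smul h1)).sub h2)
  let a : (E × ℝ) × C(Set.Icc (-1 : ℝ) 1, E) := ((x₀, 0), cst x₀)
  let Lz : E × ℝ →L[ℝ] C(Set.Icc (-1 : ℝ) 1, E) :=
    -((ContinuousLinearMap.snd ℝ E ℝ).smulRight (odeOperator f hf.continuous (cst x₀)))
      - cst.comp (ContinuousLinearMap.fst ℝ E ℝ)
  let Θ' := ContinuousLinearEquiv.skewProd (ContinuousLinearEquiv.refl ℝ (E × ℝ))
    (ContinuousLinearEquiv.refl ℝ C(Set.Icc (-1 : ℝ) 1, E)) Lz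
  have hΘ' : HasFDerivAt Θ (Θ' : _ →L[ℝ] _) a := by
    have h1 : HasFDerivAt (fun z : (E × ℝ) × C(Set.Icc (-1 : ℝ) 1, E) => z.1.2)
      ((ContinuousLinearMap.snd ℝ E ℝ).comp (ContinuousLinearMap.fst ℝ _ _)) a :=
      hasFDerivAt_fst.snd
    have h2 : HasFDerivAt (fun z : (E × ℝ) × C(Set.Icc (-1 : ℝ) 1, E) =>
        odeOperator f hf.continuous z.2)
        ((fderiv ℝ (odeOperator f hf.continuous) (cst x₀)).comp (ContinuousLinearMap.snd ℝ _ _)) a :=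
      HasFDerivAt.comp (g := odeOperator f hf.continuous) (f := Prod.snd) a ((hK.differentiable (by simp) _).hasFDerivAt)
        hasFDerivAt_snd
    have h3 : HasFDerivAt (fun z : (E × ℝ) × C(Set.Icc (-1 : ℝ) 1, E) => cst z.1.1)
        (cst.comp ((ContinuousLinearMap.fst ℝ E ℝ).comp (ContinuousLinearMap.fst ℝ _ _))) a :=
      HasFDerivAt.comp (g := cst) a
        (ContinuousLinearMap.hasFDerivAt (E := E) (F := C(Set.Icc (-1 : ℝ) 1, E)) cst)
        hasFDerivAt_fst.fst
    have h4 := (hasFDerivAt_fst (𝕜 := ℝ) (p := a)).prodMk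
      (((hasFDerivAt_snd (𝕜 := ℝ) (p := a)).sub (h1.smul h2)).sub h3)
    refine h4.congr_fderiv ?_
    ext z <;> simp [Θ', Lz, a]
  obtain ⟨Φ, haΦ, hΦ, -, hsymm⟩ := exists_localInverse Θ' (Eventually.of_forall fun x => hΘ.contDiffAt)
    hΘ'
  let Γ : E × ℝ → C(Set.Icc (-1 : ℝ) 1, E) := fun z => (Φ.symm (z, 0)).2
  have hΘa : Θ a = ((x₀, 0), 0) := by simp [Θ, a]
  have htarget : ((x₀, (0 : ℝ)), (0 : C(Set.Icc (-1 : ℝ) 1, E))) ∈ Φ.target := by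
    rw [← hΘa, ← hΦ]; exact Φ.map_source haΦ
  have hnear : ∀ᶠ z in 𝓝 (x₀, (0 : ℝ)), (z, (0 : C(Set.Icc (-1 : ℝ) 1, E))) ∈ Φ.target :=
    ContinuousAt.preimage_mem_nhds (f := fun z : E × ℝ => (z, (0 : C(Set.Icc (-1 : ℝ) 1, E))))
      (by fun_prop) (Φ.open_target.mem_nhds htarget)
  have hsolve : ∀ z, (z, (0 : C(Set.Icc (-1 : ℝ) 1, E))) ∈ Φ.target →
      Γ z = cst z.1 + z.2 • odeOperator f hf.continuous (Γ z) := by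
    intro z hz
    have h1 := Φ.right_inv hz
    rw [hΦ] at h1
    have h2 : (Φ.symm (z, 0)).1 = z := congrArg Prod.fst h1
    have h3 := congrArg Prod.snd h1
    simp only [Θ] at h3
    rw [h2, sub_sub, sub_eq_zero] at h3
    rw [add_comm]
    exact h3
  have hCpos : (0 : ℝ) < C + 1 := by positivity
  obtain ⟨ε, hε, hball⟩ := Metric.eventually_nhds_iff_ball.1 hnear
  set T : ℝ := min (ε / 2) (1 / (2 * (C + 1))) with hT
  have hT0 : 0 < T := lt_min (by positivity) (by positivity)
  have hTε : T < ε := (min_le_left _ _).trans_lt (by linarith)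
  have hTC : T * C < 1 := by
    have h1 : T ≤ 1 / (2 * (C + 1)) := min_le_right _ _
    have h2 : T * (2 * (C + 1)) ≤ 1 := by
      rwa [le_div_iff₀ (by positivity)] at h1
    nlinarith [C.2]
  have hin : ∀ x ∈ Metric.ball x₀ T, ∀ t : ℝ, |t| ≤ T →
      ((x, t), (0 : C(Set.Icc (-1 : ℝ) 1, E))) ∈ Φ.target := by
    intro x hx t ht
    apply hball
    rw [Metric.mem_ball, Prod.dist_eq, max_lt_iff]
    exact ⟨(Metric.mem_ball.1 hx).trans hTε, by simpa using ht.trans_lt hTε⟩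
  let ψ : E × ℝ → E := fun z => Γ z ⟨1, by norm_num⟩
  have hscale : ∀ x ∈ Metric.ball x₀ T, ∀ s : Set.Icc (-1 : ℝ) 1, ψ (x, T * s) = Γ (x, T) s := by
    intro x hx s
    obtain ⟨δ, hδ, hδ1⟩ := integralPath_rescale hf.continuous
      (hsolve (x, T) (hin x hx T (abs_of_pos hT0).le)) s
    have hs : |T * s| ≤ T := by
      rw [abs_mul, abs_of_pos hT0]
      exact mul_le_of_le_one_right hT0.le (abs_le.2 s.2)
    rw [← hδ1]
    have := integralPath_unique hf.continuous hC (t := T * s)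
      ((mul_le_mul_of_nonneg_right hs C.2).trans_lt hTC) (hsolve (x, T * s) (hin x hx _ hs)) hδ
    simp only [ψ]
    rw [this]
  refine ⟨ψ, ?_⟩
  have hbox : ∀ᶠ z in 𝓝 (x₀, (0 : ℝ)), z.1 ∈ Metric.ball x₀ T ∧ z.2 ∈ Set.Ioo (-T) T :=
    prod_mem_nhds (Metric.ball_mem_nhds _ hT0) (Ioo_mem_nhds (by linarith) hT0)
  filter_upwards [hbox] with z hz
  obtain ⟨hz1, hz2⟩ := hz
  have hzt : (z, (0 : C(Set.Icc (-1 : ℝ) 1, E))) ∈ Φ.target :=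
    hin z.1 hz1 z.2 (abs_le.2 ⟨hz2.1.le, hz2.2.le⟩)
  have hev : ∀ (w : Set.Icc (-1 : ℝ) 1), ContDiff ℝ ∞ (fun γ : C(Set.Icc (-1 : ℝ) 1, E) => γ w) :=
    fun w => ContinuousLinearMap.contDiff (E := C(Set.Icc (-1 : ℝ) 1, E))
      (ContinuousMap.evalCLM ℝ w)
  refine ⟨?_, ?_, ?_⟩
  · have h1 : ContDiffAt ℝ ∞ (fun z : E × ℝ => Φ.symm (z, 0)) z :=
      ContDiffAt.comp z (hsymm _ hzt) (contDiffAt_id.prodMk contDiffAt_const)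
    exact (hev _).contDiffAt.comp z h1.snd
  · intro h0
    have := hsolve z hzt
    rw [h0, zero_smul, add_zero] at this
    simp only [ψ]
    rw [this]; rfl
  · set γ := Γ (z.1, T) with hγ
    have hγs := hsolve (z.1, T) (hin z.1 hz1 T (abs_of_pos hT0).le)
    have hcont : Continuous fun r => f (extendPath γ r) :=
      hf.continuous.comp (continuous_extendPath γ)
    have hloc : ∀ t ∈ Set.Icc (-T) T,
        ψ (z.1, t) = z.1 + T • ∫ r in (0 : ℝ)..(t / T), f (extendPath γ r) ∧
          ψ (z.1, t) = extendPath γ (t / T) := by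
      intro t ht
      have hmem : t / T ∈ Set.Icc (-1 : ℝ) 1 := by
        constructor
        · rw [le_div_iff₀ hT0]; linarith [ht.1]
        · rw [div_le_iff₀ hT0]; linarith [ht.2]
      have h1 := hscale z.1 hz1 ⟨t / T, hmem⟩
      have h2 : T * (t / T) = t := by field_simp
      simp only [h2] at h1
      rw [h1]
      refine ⟨?_, (extendPath_of_mem γ hmem).symm⟩
      conv_lhs => rw [hγs]
      rfl
    have hder : HasDerivAt (fun t => z.1 + T • ∫ r in (0 : ℝ)..(t / T), f (extendPath γ r))
        (f (ψ z)) z.2 := by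
      have h1 := (hcont.integral_hasStrictDerivAt 0 (z.2 / T)).hasDerivAt
      have h2 := h1.scomp z.2 ((hasDerivAt_id z.2).div_const T)
      have h3 := (h2.const_smul T).const_add z.1
      refine h3.congr_deriv ?_
      rw [smul_smul, mul_one_div_cancel hT0.ne', one_smul,
        ← (hloc z.2 ⟨hz2.1.le, hz2.2.le⟩).2]
    refine hder.congr_of_eventuallyEq ?_
    filter_upwards [Ioo_mem_nhds hz2.1 hz2.2] with t ht
    exact (hloc t ⟨ht.1.le, ht.2.le⟩).1

end Flow

/-- A function that is smooth near a point agrees near that point with a compactly supported smooth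
function. -/
lemma exists_compactSupport_eventuallyEq {E F : Type} [NormedAddCommGroup E] [NormedSpace ℝ E]
    [FiniteDimensional ℝ E] [NormedAddCommGroup F] [NormedSpace ℝ F] {f : E → F} {x₀ : E}
    (hf : ∀ᶠ x in 𝓝 x₀, ContDiffAt ℝ ∞ f x) :
    ∃ g : E → F, ContDiff ℝ ∞ g ∧ HasCompactSupport g ∧ g =ᶠ[𝓝 x₀] f := by
  obtain ⟨R, hR, hball⟩ := Metric.eventually_nhds_iff_ball.1 hf
  let χ : ContDiffBump x₀ := ⟨R / 4, R / 2, by positivity, by linarith⟩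
  refine ⟨fun x => χ x • f x, ?_, χ.hasCompactSupport.smul_right, ?_⟩
  · rw [contDiff_iff_contDiffAt]
    intro x
    by_cases hx : x ∈ Metric.ball x₀ R
    · exact χ.contDiff.contDiffAt.smul (hball x hx)
    · have hx' : x ∉ tsupport χ := by
        rw [χ.tsupport_eq]
        intro h
        have h1 : dist x x₀ ≤ R / 2 := Metric.mem_closedBall.1 h
        exact hx (Metric.mem_ball.2 (by linarith))
      have : (fun x => χ x • f x) =ᶠ[𝓝 x] fun _ => 0 := by
        filter_upwards [notMem_tsupport_iff_eventuallyEq.1 hx'] with y hy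
        simp [hy]
      exact contDiffAt_const.congr_of_eventuallyEq this
  · filter_upwards [χ.eventuallyEq_one] with y hy
    simp [hy]

/-- **Rectification of a vector field**: near a point where it does not vanish, a smooth vector field
becomes a constant one in suitable coordinates. -/
theorem exists_rectification {E : Type} [NormedAddCommGroup E] [NormedSpace ℝ E]
    [FiniteDimensional ℝ E] {ν : E → E} {x₀ : E} (hν : ∀ᶠ x in 𝓝 x₀, ContDiffAt ℝ ∞ ν x)
    (h₀ : ν x₀ ≠ 0) {e : E} (he : e ≠ 0) :
    ∃ Ψ : E → E, (∀ᶠ x in 𝓝 x₀, ContDiffAt ℝ ∞ Ψ x ∧ fderiv ℝ Ψ x (ν x) = e) ∧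
      ∃ A : E ≃L[ℝ] E, HasFDerivAt Ψ (A : E →L[ℝ] E) x₀ := by
  have : CompleteSpace E := FiniteDimensional.complete ℝ E
  obtain ⟨f, hf, hfc, hfν⟩ := exists_compactSupport_eventuallyEq hν
  obtain ⟨ψ, hψ⟩ := exists_smooth_flow_of_compactSupport hf hfc x₀
  obtain ⟨ℓ, hℓ⟩ := SeparatingDual.exists_eq_one (R := ℝ) h₀
  set ν₀ := ν x₀ with hν₀
  have hψt : ∀ᶠ z in 𝓝 (x₀, (0 : ℝ)), fderiv ℝ ψ z (0, 1) = f (ψ z) := by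
    filter_upwards [hψ] with z hz
    have h1 : HasDerivAt (fun t : ℝ => (z.1, t)) ((0 : E), (1 : ℝ)) z.2 :=
      (hasDerivAt_const _ _).prodMk (hasDerivAt_id _)
    have h2 := (hz.1.differentiableAt (by simp)).hasFDerivAt.comp_hasDerivAt z.2 h1
    exact h2.unique hz.2.2
  let aff : E → E × ℝ := fun z => (z - ℓ (z - x₀) • ν₀, ℓ (z - x₀))
  let aff' : E →L[ℝ] E × ℝ :=
    (ContinuousLinearMap.id ℝ E - ℓ.smulRight ν₀).prod ℓ
  have haff0 : aff x₀ = (x₀, 0) := by simp [aff]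
  have haffc : ContDiff ℝ ∞ aff := by fun_prop
  have haffd : ∀ z, HasFDerivAt aff aff' z := by
    intro z
    have h1 : HasFDerivAt (fun z => ℓ (z - x₀)) ℓ z := by
      exact (ℓ.hasFDerivAt.comp z ((hasFDerivAt_id z).sub_const x₀)).congr_fderiv (by ext; simp)
    exact ((hasFDerivAt_id z).sub (h1.smul_const ν₀)).prodMk h1
  have hafft : Tendsto aff (𝓝 x₀) (𝓝 (x₀, 0)) := by
    rw [← haff0]; exact haffc.continuous.tendsto x₀
  let χ : E → E := fun z => ψ (aff z)
  have hχ0 : χ x₀ = x₀ := by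
    simp only [χ, haff0]; exact hψ.self_of_nhds.2.1 rfl
  have hχd : ∀ᶠ z in 𝓝 x₀, ContDiffAt ℝ ∞ χ z ∧ fderiv ℝ χ z ν₀ = f (χ z) := by
    filter_upwards [hafft.eventually hψ, hafft.eventually hψt] with z hz hzt
    refine ⟨hz.1.comp z haffc.contDiffAt, ?_⟩
    have h1 := (hz.1.differentiableAt (by simp)).hasFDerivAt.comp z (haffd z)
    rw [show χ = ψ ∘ aff from rfl, h1.fderiv]
    have h2 : aff' ν₀ = (0, 1) := by simp [aff', hℓ]
    rw [ContinuousLinearMap.comp_apply, h2, hzt]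
    rfl
  have hid : HasFDerivAt χ ((ContinuousLinearEquiv.refl ℝ E : E ≃L[ℝ] E) : E →L[ℝ] E) x₀ := by
    have h1 := (hψ.self_of_nhds.1.differentiableAt (by simp)).hasFDerivAt
    have h2 := h1
    rw [← haff0] at h1
    refine (h1.comp x₀ (haffd x₀)).congr_fderiv ?_
    have hx : fderiv ℝ ψ (x₀, 0) ∘L ContinuousLinearMap.inl ℝ E ℝ = ContinuousLinearMap.id ℝ E := by
      have h3 : HasFDerivAt (fun x : E => (x, (0 : ℝ))) (ContinuousLinearMap.inl ℝ E ℝ) x₀ :=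
        (hasFDerivAt_id x₀).prodMk (hasFDerivAt_const 0 x₀)
      have h4 := h2.comp x₀ h3
      refine h4.unique ((hasFDerivAt_id x₀).congr_of_eventuallyEq ?_)
      have h5 : Tendsto (fun x : E => (x, (0 : ℝ))) (𝓝 x₀) (𝓝 (x₀, 0)) :=
        (Continuous.prodMk_left 0).tendsto x₀
      filter_upwards [h5.eventually hψ] with x hx
      exact hx.2.1 rfl
    ext v
    have h3 : aff' v = ContinuousLinearMap.inl ℝ E ℝ (v - ℓ v • ν₀) + ℓ v • ((0 : E), (1 : ℝ)) := by
      simp [aff']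
    have h4 : fderiv ℝ ψ (x₀, 0) (0, 1) = ν₀ := by
      rw [hψt.self_of_nhds, hψ.self_of_nhds.2.1 rfl, hfν.self_of_nhds]
    rw [haff0, ContinuousLinearMap.comp_apply, h3, map_add, map_smul, h4,
      ← ContinuousLinearMap.comp_apply, hx]
    simp
  obtain ⟨Φ, hx₀, hΦ, hΦs, hΦt⟩ := exists_localInverse _ (hχd.mono fun z hz => hz.1) hid
  have hx₀t : x₀ ∈ Φ.target := by
    have := Φ.map_source hx₀
    rwa [hΦ, hχ0] at this
  have hsymm0 : Φ.symm x₀ = x₀ := by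
    have := Φ.left_inv hx₀
    rwa [hΦ, hχ0] at this
  have hsymmt : Tendsto Φ.symm (𝓝 x₀) (𝓝 x₀) := by
    have := (Φ.symm.continuousAt hx₀t)
    rwa [ContinuousAt, hsymm0] at this
  obtain ⟨A, hA⟩ := SeparatingDual.exists_continuousLinearEquiv_apply_eq (R := ℝ) h₀ he
  have hDsymm : ∀ᶠ x in 𝓝 x₀, fderiv ℝ Φ.symm x (ν x) = ν₀ := by
    filter_upwards [hsymmt.eventually hχd, hfν, Φ.open_target.mem_nhds hx₀t] with x hx hfx hxt
    have h1 : HasFDerivAt χ (fderiv ℝ χ (Φ.symm x)) (Φ.symm x) :=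
      (hx.1.differentiableAt (by simp)).hasFDerivAt
    have hχx : χ (Φ.symm x) = x := by rw [← hΦ]; exact Φ.right_inv hxt
    have h2 : HasFDerivAt Φ.symm (fderiv ℝ Φ.symm x) (χ (Φ.symm x)) := by
      rw [hχx]; exact ((hΦt x hxt).differentiableAt (by simp)).hasFDerivAt
    have h3 := h2.comp _ h1
    have h4 : HasFDerivAt (Φ.symm ∘ χ) (ContinuousLinearMap.id ℝ E) (Φ.symm x) := by
      refine (hasFDerivAt_id _).congr_of_eventuallyEq ?_
      filter_upwards [Φ.open_source.mem_nhds (Φ.map_target hxt)] with y hy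
      exact (congrArg Φ.symm (hΦ y).symm).trans (Φ.left_inv hy)
    have h5 := DFunLike.congr_fun (h3.unique h4) ν₀
    rw [ContinuousLinearMap.comp_apply, hx.2, hχx, hfx] at h5
    exact h5
  refine ⟨fun x => A (Φ.symm x), ?_, A, ?_⟩
  · filter_upwards [hDsymm, Φ.open_target.mem_nhds hx₀t] with x hx hxt
    refine ⟨A.contDiff.contDiffAt.comp x (hΦt x hxt), ?_⟩
    have h2 := A.hasFDerivAt.comp x ((hΦt x hxt).differentiableAt (by simp)).hasFDerivAt
    rw [show (fun x => A (Φ.symm x)) = A ∘ Φ.symm from rfl, h2.fderiv,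
      ContinuousLinearMap.comp_apply, hx]
    exact hA
  · have h1 : HasFDerivAt Φ ((ContinuousLinearEquiv.refl ℝ E : E ≃L[ℝ] E) : E →L[ℝ] E)
        (Φ.symm x₀) := by
      rw [hsymm0]
      exact hid.congr_of_eventuallyEq (Eventually.of_forall hΦ)
    have h2 := Φ.hasFDerivAt_symm hx₀t h1
    refine (A.hasFDerivAt.comp x₀ h2).congr_fderiv ?_
    ext; simp

/-- A function of `(t, v)` that is smooth near a point has a smooth primitive with respect to the real
variable `t` there. -/
theorem exists_smooth_primitive {F : Type} [NormedAddCommGroup F] [NormedSpace ℝ F]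
    [FiniteDimensional ℝ F] {P : ℝ × F → ℝ} {z₀ : ℝ × F} (hP : ∀ᶠ z in 𝓝 z₀, ContDiffAt ℝ ∞ P z) :
    ∃ Q : ℝ × F → ℝ, ∀ᶠ z in 𝓝 z₀, ContDiffAt ℝ ∞ Q z ∧ fderiv ℝ Q z (1, 0) = P z := by
  obtain ⟨p, hp, hpc, hpP⟩ := exists_compactSupport_eventuallyEq hP
  -- `Q (t, v) = t ∫₀¹ p (r t, v) dr`, where the inner path depends linearly on `(t, v)`
  let path : ℝ × F →L[ℝ] C(Set.Icc (-1 : ℝ) 1, ℝ × F) :=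
    LinearMap.mkContinuous
      { toFun := fun z => ⟨fun r => ((r : ℝ) * z.1, z.2), by fun_prop⟩
        map_add' := fun z w => by ext r <;> simp [mul_add]
        map_smul' := fun c z => by ext r <;> simp [mul_left_comm] } 1
      (fun z => by
        rw [one_mul, ContinuousMap.norm_le _ (norm_nonneg _)]
        intro r
        rw [Prod.norm_def, Prod.norm_def]
        refine max_le_max ?_ le_rfl
        change ‖(r : ℝ) * z.1‖ ≤ _
        rw [norm_mul]
        exact mul_le_of_le_one_left (norm_nonneg _) (abs_le.2 r.2))
  let one : Set.Icc (-1 : ℝ) 1 := ⟨1, by norm_num⟩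
  let Q : ℝ × F → ℝ := fun z => z.1 * pathPrimitive (superpose p hp.continuous (path z)) one
  have hQ : ∀ z, Q z = ∫ r in (0 : ℝ)..z.1, p (r, z.2) := by
    intro z
    have h1 : pathPrimitive (superpose p hp.continuous (path z)) one
        = ∫ r in (0 : ℝ)..1, p (r * z.1, z.2) := by
      rw [pathPrimitive_apply]
      apply intervalIntegral.integral_congr
      intro r hr
      rw [Set.uIcc_of_le zero_le_one] at hr
      exact extendPath_of_mem _ ⟨by linarith [hr.1], hr.2⟩
    simp only [Q]
    rw [h1]
    have := intervalIntegral.smul_integral_comp_mul_right (a := 0) (b := 1)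
      (fun r => p (r, z.2)) z.1
    rwa [zero_mul, one_mul, smul_eq_mul] at this
  have hev : ContDiff ℝ ∞ (fun γ : C(Set.Icc (-1 : ℝ) 1, ℝ) => pathPrimitive γ one) :=
    ContinuousLinearMap.contDiff (E := C(Set.Icc (-1 : ℝ) 1, ℝ))
      ((ContinuousMap.evalCLM ℝ one).comp pathPrimitive)
  have hpath : ContDiff ℝ ∞ (fun z => path z) := by fun_prop
  have hQs : ContDiff ℝ ∞ Q :=
    contDiff_fst.mul (hev.comp ((contDiff_superpose hp hpc).comp hpath))
  refine ⟨Q, ?_⟩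
  filter_upwards [hpP] with z hz
  refine ⟨hQs.contDiffAt, ?_⟩
  have h1 : HasDerivAt (fun t : ℝ => (t, z.2)) ((1 : ℝ), (0 : F)) z.1 :=
    (hasDerivAt_id _).prodMk (hasDerivAt_const _ _)
  have h2 := (hQs.differentiable (by simp) z).hasFDerivAt.comp_hasDerivAt z.1 h1
  have h3 : HasDerivAt (fun t : ℝ => ∫ r in (0 : ℝ)..t, p (r, z.2)) (p (z.1, z.2)) z.1 :=
    ((hp.continuous.comp (Continuous.prodMk_left z.2)).integral_hasStrictDerivAt 0 z.1).hasDerivAt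
  have h4 : (Q ∘ fun t : ℝ => (t, z.2)) = fun t : ℝ => ∫ r in (0 : ℝ)..t, p (r, z.2) :=
    funext fun t => hQ (t, z.2)
  rw [h4] at h2
  rw [h2.unique h3, ← hz]

/-- A function whose partial derivative in the first variable vanishes near a point does not depend on the
first variable near that point. -/
lemma eventually_eq_of_fderiv_inl_eq_zero {E₁ E₂ F : Type} [NormedAddCommGroup E₁]
    [NormedSpace ℝ E₁] [NormedAddCommGroup E₂] [NormedSpace ℝ E₂] [NormedAddCommGroup F]
    [NormedSpace ℝ F] {f : E₁ × E₂ → F} {z₀ : E₁ × E₂}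
    (hf : ∀ᶠ z in 𝓝 z₀, DifferentiableAt ℝ f z ∧ ∀ u, fderiv ℝ f z (u, 0) = 0) :
    ∀ᶠ z in 𝓝 z₀, f z = f (z₀.1, z.2) := by
  obtain ⟨ε, hε, hball⟩ := Metric.eventually_nhds_iff_ball.1 hf
  filter_upwards [Metric.ball_mem_nhds z₀ hε] with z hz
  rw [← ball_prod_same, Set.mem_prod] at hz
  have hmem : ∀ u ∈ Metric.ball z₀.1 ε, (u, z.2) ∈ Metric.ball z₀ ε := by
    intro u hu
    rw [← ball_prod_same]
    exact ⟨hu, hz.2⟩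
  have hd : ∀ u ∈ Metric.ball z₀.1 ε, HasFDerivAt (fun u => f (u, z.2)) (0 : E₁ →L[ℝ] F) u := by
    intro u hu
    have h1 := (hball _ (hmem u hu)).1.hasFDerivAt
    have h2 := HasFDerivAt.comp (g := f) (f := fun u => (u, z.2)) u h1
      ((hasFDerivAt_id u).prodMk (hasFDerivAt_const z.2 u))
    refine h2.congr_fderiv ?_
    ext v
    exact (hball _ (hmem u hu)).2 v
  exact (convex_ball z₀.1 ε).is_const_of_fderivWithin_eq_zero (𝕜 := ℝ)
    (f := fun u => f (u, z.2)) (fun u hu => (hd u hu).differentiableAt.differentiableWithinAt)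
    (fun u hu => by
      rw [fderivWithin_of_isOpen Metric.isOpen_ball hu]; exact (hd u hu).fderiv)
    hz.1 (Metric.mem_ball_self hε)

/-! ### Calculus of vector fields and functions on a manifold -/

section Calculus

variable {M : Type*} [TopologicalSpace M] [ChartedSpace E4 M]
  {F : Type*} [NormedAddCommGroup F] [NormedSpace ℝ F]

variable (M) in
/-- Vector fields, without regularity. -/
abbrev VField : Type _ := ∀ q : M, TangentSpace (𝓡 4) q

/-- Smoothness of a function at a point. -/
abbrev SmoothFun (f : M → F) (q : M) : Prop := ContMDiffAt (𝓡 4) 𝓘(ℝ, F) ∞ f q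

/-- The derivative of a vector-valued function along a vector field. -/
def dirD (X : VField M) (f : M → F) (q : M) : F := mfderiv (𝓡 4) 𝓘(ℝ, F) f q (X q)

lemma D_eq_dirD (e : ∀ q : M, Tetrad q) (a : Idx) (f : M → ℝ) (q : M) :
    SpinData.D e a f q = dirD (fun r => e r a) f q := rfl

lemma SmoothFun.mdiff {f : M → F} {q : M} (hf : SmoothFun f q) :
    MDifferentiableAt (𝓡 4) 𝓘(ℝ, F) f q := hf.mdifferentiableAt (by simp)

lemma dirD_congr {X : VField M} {f g : M → F} {q : M} (h : f =ᶠ[𝓝 q] g) :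
    dirD X f q = dirD X g q := by
  have h1 : mfderiv (𝓡 4) 𝓘(ℝ, F) f q = mfderiv (𝓡 4) 𝓘(ℝ, F) g q := h.mfderiv_eq
  unfold dirD
  exact DFunLike.congr_fun h1 (X q)

lemma dirD_congr_field {X Y : VField M} {f : M → F} {q : M} (h : X q = Y q) :
    dirD X f q = dirD Y f q := by unfold dirD; rw [h]

lemma dirD_comb (X Y : VField M) (a b : M → ℝ) (f : M → F) (q : M) :
    dirD (fun r => a r • X r + b r • Y r) f q = a q • dirD X f q + b q • dirD Y f q := by
  change mfderiv (𝓡 4) 𝓘(ℝ, F) f q (a q • X q + b q • Y q) = _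
  rw [map_add, map_smul, map_smul]
  rfl

lemma dirD_smul_field (X : VField M) (a : M → ℝ) (f : M → F) (q : M) :
    dirD (fun r => a r • X r) f q = a q • dirD X f q := by
  change mfderiv (𝓡 4) 𝓘(ℝ, F) f q (a q • X q) = _
  rw [map_smul]
  rfl

lemma dirD_eq_zero_of_field {X : VField M} {f : M → F} {q : M} (h : X q = 0) : dirD X f q = 0 := by
  unfold dirD
  rw [h, map_zero]
  rfl

@[simp] lemma dirD_const (X : VField M) (c : F) (q : M) : dirD X (fun _ => c) q = 0 :=
  DFunLike.congr_fun (mvfderiv_const (I := 𝓡 4) c (x := q)) (X q)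

lemma dirD_add {X : VField M} {f g : M → F} {q : M} (hf : SmoothFun f q) (hg : SmoothFun g q) :
    dirD X (fun r => f r + g r) q = dirD X f q + dirD X g q :=
  DFunLike.congr_fun (mvfderiv_add hf.mdiff hg.mdiff) (X q)

lemma dirD_sub {X : VField M} {f g : M → F} {q : M} (hf : SmoothFun f q) (hg : SmoothFun g q) :
    dirD X (fun r => f r - g r) q = dirD X f q - dirD X g q :=
  DFunLike.congr_fun (mvfderiv_sub hf.mdiff hg.mdiff) (X q)

lemma dirD_neg {X : VField M} {f : M → F} {q : M} :
    dirD X (fun r => -f r) q = -dirD X f q :=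
  DFunLike.congr_fun (mvfderiv_neg (g := f) (x := q)) (X q)

lemma dirD_mul {X : VField M} {f g : M → ℝ} {q : M} (hf : SmoothFun f q) (hg : SmoothFun g q) :
    dirD X (fun r => f r * g r) q = f q * dirD X g q + g q * dirD X f q := by
  exact DFunLike.congr_fun (mvfderiv_mul hf.mdiff hg.mdiff) (X q)

lemma dirD_comp {G : Type*} [NormedAddCommGroup G] [NormedSpace ℝ G] {X : VField M} {f : M → F}
    {h : F → G} {q : M} (hh : DifferentiableAt ℝ h (f q)) (hf : SmoothFun f q) :
    dirD X (fun r => h (f r)) q = fderiv ℝ h (f q) (dirD X f q) := by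
  unfold dirD
  have h1 := mfderiv_comp (I := 𝓡 4) (I' := 𝓘(ℝ, F)) (I'' := 𝓘(ℝ, G)) q hh.mdifferentiableAt hf.mdiff
  have h2 := DFunLike.congr_fun h1 (X q)
  rw [mfderiv_eq_fderiv] at h2
  exact h2

lemma dirD_clm {G : Type*} [NormedAddCommGroup G] [NormedSpace ℝ G] {X : VField M} {f : M → F}
    (L : F →L[ℝ] G) {q : M} (hf : SmoothFun f q) :
    dirD X (fun r => L (f r)) q = L (dirD X f q) := by
  rw [dirD_comp L.differentiableAt hf, L.fderiv]

lemma dirD_real_comp {X : VField M} {f : M → ℝ} {h : ℝ → ℝ} {h' : ℝ} {q : M}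
    (hh : HasDerivAt h h' (f q)) (hf : SmoothFun f q) :
    dirD X (fun r => h (f r)) q = h' * dirD X f q := by
  rw [dirD_comp hh.differentiableAt hf, hh.hasFDerivAt.fderiv]
  simp [mul_comm]

lemma smoothFun_comp {G : Type*} [NormedAddCommGroup G] [NormedSpace ℝ G] {f : M → F}
    {h : F → G} {q : M} (hh : ContDiffAt ℝ ∞ h (f q)) (hf : SmoothFun f q) :
    SmoothFun (fun r => h (f r)) q :=
  (hh.contMDiffAt).comp q hf

lemma SmoothFun.prodMk {G : Type*} [NormedAddCommGroup G] [NormedSpace ℝ G] {f : M → F}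
    {g : M → G} {q : M} (hf : SmoothFun f q) (hg : SmoothFun g q) :
    SmoothFun (fun r => (f r, g r)) q :=
  hf.prodMk_space hg

lemma dirD_prodMk {G : Type*} [NormedAddCommGroup G] [NormedSpace ℝ G] {X : VField M} {f : M → F}
    {g : M → G} {q : M} (hf : SmoothFun f q) (hg : SmoothFun g q) :
    dirD X (fun r => (f r, g r)) q = (dirD X f q, dirD X g q) := by
  have h := hf.prodMk hg
  have h1 := dirD_clm (X := X) (ContinuousLinearMap.fst ℝ F G) h
  have h2 := dirD_clm (X := X) (ContinuousLinearMap.snd ℝ F G) h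
  exact Prod.ext h1.symm h2.symm

/-- The Lie bracket of vector fields. -/
abbrev bracket (X Y : VField M) : VField M := VectorField.mlieBracket (𝓡 4) X Y

lemma bracket_swap (X Y : VField M) (q : M) : bracket X Y q = -bracket Y X q :=
  VectorField.mlieBracket_swap_apply

lemma bracket_congr {X X' Y Y' : VField M} {q : M} (hX : X =ᶠ[𝓝 q] X') (hY : Y =ᶠ[𝓝 q] Y') :
    bracket X Y q = bracket X' Y' q :=
  hX.mlieBracket_vectorField_eq hY

lemma bracket_self (X : VField M) (q : M) : bracket X X q = 0 := by
  simp [bracket]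

variable [IsManifold (𝓡 4) ∞ M]

/-- Smoothness of a vector field at a point. -/
abbrev SmoothVec (X : VField M) (q : M) : Prop :=
  ContMDiffAt (𝓡 4) (𝓡 4).tangent ∞ (fun r => (⟨r, X r⟩ : TangentBundle (𝓡 4) M)) q

variable (M) in
lemma isManifold_minSmoothness {k : ℕ∞} : IsManifold (𝓡 4) (minSmoothness ℝ k) M :=
  IsManifold.of_le (n := ∞)
    (by rw [minSmoothness_of_isRCLikeNormedField]; exact WithTop.coe_le_coe.2 le_top)

lemma SmoothVec.mdiff {X : VField M} {q : M} (hX : SmoothVec X q) :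
    MDifferentiableAt (𝓡 4) (𝓡 4).tangent (fun r => (⟨r, X r⟩ : TangentBundle (𝓡 4) M)) q :=
  hX.mdifferentiableAt (by simp)

lemma SmoothVec.add {X Y : VField M} {q : M} (hX : SmoothVec X q) (hY : SmoothVec Y q) :
    SmoothVec (fun r => X r + Y r) q :=
  ContMDiffAt.add_section hX hY

lemma SmoothVec.smul {X : VField M} {f : M → ℝ} {q : M} (hf : SmoothFun f q) (hX : SmoothVec X q) :
    SmoothVec (fun r => f r • X r) q :=
  ContMDiffAt.smul_section hf hX

lemma SmoothVec.comb {X Y : VField M} {a b : M → ℝ} {q : M} (ha : SmoothFun a q)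
    (hb : SmoothFun b q) (hX : SmoothVec X q) (hY : SmoothVec Y q) :
    SmoothVec (fun r => a r • X r + b r • Y r) q :=
  (hX.smul ha).add (hY.smul hb)

lemma SmoothFun.dirD {X : VField M} {f : M → F} {q : M} (hf : SmoothFun f q) (hX : SmoothVec X q) :
    SmoothFun (dirD X f) q := by
  have h1 : ContMDiffAt (𝓡 4) 𝓘(ℝ, E4 →L[ℝ] F) ∞
      (inTangentCoordinates (𝓡 4) 𝓘(ℝ, F) id f (mfderiv (𝓡 4) 𝓘(ℝ, F) f) q) q :=
    ContMDiffAt.mfderiv_const hf (by simp)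
  have h2 := ContMDiffAt.clm_apply_of_inCoordinates (b₁ := id) (b₂ := f) (E₁ := TangentSpace (𝓡 4))
    (E₂ := TangentSpace 𝓘(ℝ, F)) (F₁ := E4) (F₂ := F)
    (ϕ := fun m => mfderiv (𝓡 4) 𝓘(ℝ, F) f m) (v := X) h1 hX hf
  exact (contMDiff_snd_tangentBundle_modelSpace F 𝓘(ℝ, F)).contMDiffAt.comp q h2

lemma SmoothVec.bracket {X Y : VField M} {q : M} (hX : SmoothVec X q) (hY : SmoothVec Y q) :
    SmoothVec (bracket X Y) q :=
  have : IsManifold (𝓡 4) (minSmoothness ℝ 2) M := isManifold_minSmoothness M (k := 2)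
  have : IsManifold (𝓡 4) (∞ + 1) M := inferInstanceAs (IsManifold (𝓡 4) ∞ M)
  ContMDiffAt.mlieBracket_vectorField (m := ⊤) (n := ⊤) hX hY (by simp)

lemma bracket_smul_right {X Y : VField M} {f : M → ℝ} {q : M} (hf : SmoothFun f q)
    (hY : SmoothVec Y q) :
    bracket X (fun r => f r • Y r) q = dirD X f q • Y q + f q • bracket X Y q :=
  VectorField.mlieBracket_smul_right hf.mdiff hY.mdiff

lemma bracket_smul_left {X Y : VField M} {f : M → ℝ} {q : M} (hf : SmoothFun f q)
    (hX : SmoothVec X q) :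
    bracket (fun r => f r • X r) Y q = -dirD Y f q • X q + f q • bracket X Y q :=
  VectorField.mlieBracket_smul_left hf.mdiff hX.mdiff

lemma bracket_add_right {X Y Z : VField M} {q : M} (hY : SmoothVec Y q) (hZ : SmoothVec Z q) :
    bracket X (fun r => Y r + Z r) q = bracket X Y q + bracket X Z q :=
  VectorField.mlieBracket_add_right hY.mdiff hZ.mdiff

lemma bracket_add_left {X Y Z : VField M} {q : M} (hY : SmoothVec Y q) (hZ : SmoothVec Z q) :
    bracket (fun r => Y r + Z r) X q = bracket Y X q + bracket Z X q :=
  VectorField.mlieBracket_add_left hY.mdiff hZ.mdiff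

/-- The Lie bracket acts on functions as the commutator. The operator `f ↦ [X, Y] f` is recovered from
the Jacobi identity applied to `X`, `Y` and `f Z`, for a field `Z` that does not vanish at the point. -/
theorem dirD_bracket {X Y : VField M} {f : M → ℝ} {q : M} (hX : SmoothVec X q) (hY : SmoothVec Y q)
    (hf : SmoothFun f q) :
    dirD (bracket X Y) f q = dirD X (dirD Y f) q - dirD Y (dirD X f) q := by
  have key : ∀ Z : VField M, SmoothVec Z q → Z q ≠ 0 →
      dirD (bracket X Y) f q = dirD X (dirD Y f) q - dirD Y (dirD X f) q := by
    intro Z hZ hZ0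
    have : IsManifold (𝓡 4) (minSmoothness ℝ 3) M :=
      isManifold_minSmoothness M (k := 3)
    have h2 : minSmoothness ℝ 2 ≤ (∞ : WithTop ℕ∞) := by
      rw [minSmoothness_of_isRCLikeNormedField]; exact WithTop.coe_le_coe.2 le_top
    have hfZ : SmoothVec (fun r => f r • Z r) q := hZ.smul hf
    have J1 := VectorField.leibniz_identity_mlieBracket_apply (I := 𝓡 4) (hX.of_le h2) (hY.of_le h2)
      (hfZ.of_le h2)
    have J2 := VectorField.leibniz_identity_mlieBracket_apply (I := 𝓡 4) (hX.of_le h2) (hY.of_le h2)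
      (hZ.of_le h2)
    have hev : ∀ W : VField M, (bracket W fun r => f r • Z r) =ᶠ[𝓝 q]
        fun r => dirD W f r • Z r + f r • bracket W Z r := by
      intro W
      have e1 := (contMDiffAt_iff_contMDiffAt_nhds (n := 1) (by simp)).1 (hf.of_le (by simp))
      have e2 := (contMDiffAt_iff_contMDiffAt_nhds (n := 1) (by simp)).1 (hZ.of_le (by simp))
      filter_upwards [e1, e2] with r h1 h2
      exact VectorField.mlieBracket_smul_right (h1.mdifferentiableAt (by simp))
        (h2.mdifferentiableAt (by simp))
    have hexp : ∀ V W : VField M, SmoothVec V q → SmoothVec W q →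
        bracket V (bracket W fun r => f r • Z r) q =
          (dirD V (dirD W f) q • Z q + dirD W f q • bracket V Z q) +
          (dirD V f q • bracket W Z q + f q • bracket V (bracket W Z) q) := by
      intro V W hV hW
      rw [bracket_congr (EventuallyEq.refl _ V) (hev W),
        bracket_add_right (hZ.smul (hf.dirD hW)) ((hW.bracket hZ).smul hf),
        bracket_smul_right (hf.dirD hW) hZ, bracket_smul_right hf (hW.bracket hZ)]
    have e1 := hexp X Y hX hY
    have e2 := hexp Y X hY hX
    have e3 := bracket_smul_right (X := bracket X Y) hf hZ
    change bracket X (bracket Y _) q = bracket (bracket X Y) _ q + bracket Y (bracket X _) q at J1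
    change bracket X (bracket Y Z) q = bracket (bracket X Y) Z q + bracket Y (bracket X Z) q at J2
    rw [e1, e2, e3, J2] at J1
    have h3 : (dirD (bracket X Y) f q - (dirD X (dirD Y f) q - dirD Y (dirD X f) q)) • Z q = 0 := by
      rw [sub_smul, sub_smul, sub_eq_zero]
      have := sub_eq_zero.2 J1
      rw [← sub_eq_zero, ← neg_eq_zero, ← this, smul_add]
      abel
    exact sub_eq_zero.1 ((smul_eq_zero.1 h3).resolve_right hZ0)
  by_cases h1 : X q = 0
  · by_cases h2 : Y q = 0
    · have h3 : bracket X Y q = 0 := by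
        have := VectorField.mlieBracketWithin_eq_zero_of_eq_zero (I := 𝓡 4) (s := Set.univ) h1 h2
        rwa [VectorField.mlieBracketWithin_univ] at this
      rw [dirD_eq_zero_of_field h3, dirD_eq_zero_of_field h1, dirD_eq_zero_of_field h2, sub_zero]
    · exact key Y hY h2
  · exact key X hX h1

end Calculus

/-! ### Local coordinates and the Frobenius theorem for planes -/

section Coordinates

variable {M : Type*} [TopologicalSpace M] [ChartedSpace E4 M]

/-- The components of `y` are local coordinates near `p`: they are smooth near `p`, with independent
differentials at `p`. -/
def IsCoordAt {E : Type} [NormedAddCommGroup E] [NormedSpace ℝ E] (y : M → E) (p : M) : Prop :=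
  (∀ᶠ q in 𝓝 p, SmoothFun y q) ∧ ∀ X : VField M, dirD X y p = 0 → X p = 0

variable {E : Type} [NormedAddCommGroup E] [NormedSpace ℝ E] {y : M → E} {p : M}

lemma IsCoordAt.comp {E' : Type} [NormedAddCommGroup E'] [NormedSpace ℝ E'] (hy : IsCoordAt y p)
    {Ψ : E → E'} (hΨ : ∀ᶠ z in 𝓝 (y p), ContDiffAt ℝ ∞ Ψ z) {A : E ≃L[ℝ] E'}
    (hA : HasFDerivAt Ψ (A : E →L[ℝ] E') (y p)) : IsCoordAt (fun q => Ψ (y q)) p := by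
  have hcont : ContinuousAt y p := hy.1.self_of_nhds.continuousAt
  refine ⟨?_, fun X hX => hy.2 X ?_⟩
  · filter_upwards [hy.1, hcont.eventually hΨ] with q h1 h2
    exact smoothFun_comp h2 h1
  · rw [dirD_comp hA.differentiableAt hy.1.self_of_nhds, hA.fderiv] at hX
    exact A.map_eq_zero_iff.1 hX

lemma IsCoordAt.clm {E' : Type} [NormedAddCommGroup E'] [NormedSpace ℝ E'] (hy : IsCoordAt y p)
    (A : E ≃L[ℝ] E') : IsCoordAt (fun q => A (y q)) p :=
  hy.comp (Eventually.of_forall fun _ => A.contDiff.contDiffAt) A.hasFDerivAt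

variable [IsManifold (𝓡 4) ∞ M]

lemma isCoordAt_chartAt (p : M) : IsCoordAt (chartAt E4 p : M → E4) p := by
  refine ⟨?_, fun X hX => ?_⟩
  · filter_upwards [(chartAt E4 p).open_source.mem_nhds (mem_chart_source E4 p)] with q hq
    exact contMDiffAt_of_mem_maximalAtlas (I := 𝓡 4)
      (StructureGroupoid.chart_mem_maximalAtlas _ p) hq
  · have h := isInvertible_mfderiv_extChartAt (I := 𝓡 4) (mem_extChartAt_source (I := 𝓡 4) p)
    obtain ⟨e, he⟩ := h
    have h1 : mfderiv (𝓡 4) 𝓘(ℝ, E4) (extChartAt (𝓡 4) p) p (X p) = 0 := hX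
    rw [← he] at h1
    exact e.map_eq_zero_iff.1 h1

/-- Local coordinates are the components of a local diffeomorphism. -/
theorem IsCoordAt.exists_openPartialHomeomorph [FiniteDimensional ℝ E]
    (hE : Module.finrank ℝ E = 4) (hy : IsCoordAt y p) :
    ∃ φ : OpenPartialHomeomorph M E, p ∈ φ.source ∧ (∀ q ∈ φ.source, φ q = y q) ∧
      (∀ q ∈ φ.source, SmoothFun y q) ∧
      ∀ z ∈ φ.target, ContMDiffAt 𝓘(ℝ, E) (𝓡 4) ∞ φ.symm z := by
  have : CompleteSpace E := FiniteDimensional.complete ℝ E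
  set c := chartAt E4 p with hc
  have hcM : c ∈ IsManifold.maximalAtlas (𝓡 4) ∞ M := StructureGroupoid.chart_mem_maximalAtlas _ p
  have hpc : p ∈ c.source := mem_chart_source E4 p
  obtain ⟨s, hs, hso, hps⟩ := eventually_nhds_iff.1 hy.1
  let f : E4 → E := fun z => y (c.symm z)
  have hf : ∀ z ∈ c.target, c.symm z ∈ s → ContDiffAt ℝ ∞ f z := by
    intro z hz hzs
    have h1 := contMDiffAt_symm_of_mem_maximalAtlas hcM hz
    exact ((hs _ hzs).comp z h1).contDiffAt
  have hf0 : ∀ᶠ z in 𝓝 (c p), ContDiffAt ℝ ∞ f z := by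
    have h1 : Tendsto c.symm (𝓝 (c p)) (𝓝 p) := by
      have := c.symm.continuousAt (c.map_source hpc)
      rwa [ContinuousAt, c.left_inv hpc] at this
    filter_upwards [c.open_target.mem_nhds (c.map_source hpc), h1 (hso.mem_nhds hps)] with z h2 h3
    exact hf z h2 h3
  have hfy : (fun q => f (c q)) =ᶠ[𝓝 p] y := by
    filter_upwards [c.open_source.mem_nhds hpc] with q hq
    simp only [f, c.left_inv hq]
  have hinj : Function.Injective (fderiv ℝ f (c p)) := by
    rw [injective_iff_map_eq_zero]
    intro w hw
    obtain ⟨e, he⟩ := isInvertible_mfderiv_extChartAt (I := 𝓡 4) (mem_extChartAt_source (I := 𝓡 4) p)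
    classical
    let X : VField M := Function.update 0 p (e.symm w)
    have hXp : X p = e.symm w := by simp [X]
    have h1 : dirD X c p = w := by
      change mfderiv (𝓡 4) 𝓘(ℝ, E4) (extChartAt (𝓡 4) p) p (X p) = w
      rw [← he, hXp]
      exact e.apply_symm_apply w
    have h2 : dirD X y p = 0 := by
      rw [← dirD_congr hfy, dirD_comp (hf0.self_of_nhds.differentiableAt (by simp))
        (isCoordAt_chartAt p).1.self_of_nhds, h1, hw]
    have h3 := hy.2 X h2
    rw [hXp] at h3
    exact e.symm.map_eq_zero_iff.1 h3
  let e : E4 ≃ₗ[ℝ] E := LinearEquiv.ofInjectiveOfFinrankEq (fderiv ℝ f (c p)).toLinearMap hinj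
    (by rw [hE]; simp)
  have he : HasFDerivAt f (e.toContinuousLinearEquiv : E4 →L[ℝ] E) (c p) := by
    refine (hf0.self_of_nhds.differentiableAt (by simp)).hasFDerivAt.congr_fderiv ?_
    ext v
    rfl
  obtain ⟨Φ, h1, h2, h3, h4⟩ := exists_localInverse _ hf0 he
  have hso' : IsOpen (c.source ∩ s) := c.open_source.inter hso
  refine ⟨(c.restrOpen s hso).trans Φ, ?_, ?_, ?_, ?_⟩
  · simp [hpc, hps, h1]
  · intro q hq
    have hq' : q ∈ c.source := by simp at hq; tauto
    simp [h2, f, c.left_inv hq']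
  · intro q hq
    exact hs q (by simp at hq; tauto)
  · intro z hz
    have hz1 : z ∈ Φ.target := hz.1
    have hz2 : Φ.symm z ∈ c.target := by
      have := hz.2
      simp at this
      tauto
    exact (contMDiffAt_symm_of_mem_maximalAtlas hcM hz2).comp z (h4 z hz1).contMDiffAt

lemma IsCoordAt.map_nhds [FiniteDimensional ℝ E] (hE : Module.finrank ℝ E = 4)
    (hy : IsCoordAt y p) : map y (𝓝 p) = 𝓝 (y p) := by
  obtain ⟨φ, hp, hφ, -, -⟩ := hy.exists_openPartialHomeomorph hE
  rw [← hφ p hp, ← φ.map_nhds_eq hp]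
  refine map_congr ?_
  filter_upwards [φ.open_source.mem_nhds hp] with q hq
  exact (hφ q hq).symm

/-- Smooth functions are smooth functions of local coordinates. -/
lemma IsCoordAt.exists_factor [FiniteDimensional ℝ E] (hE : Module.finrank ℝ E = 4)
    (hy : IsCoordAt y p) {F : Type} [NormedAddCommGroup F] [NormedSpace ℝ F] {f : M → F}
    (hf : ∀ᶠ q in 𝓝 p, SmoothFun f q) :
    ∃ g : E → F, (∀ᶠ z in 𝓝 (y p), ContDiffAt ℝ ∞ g z) ∧ ∀ᶠ q in 𝓝 p, f q = g (y q) := by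
  obtain ⟨φ, hp, hφ, hφs, hφt⟩ := hy.exists_openPartialHomeomorph hE
  refine ⟨fun z => f (φ.symm z), ?_, ?_⟩
  · rw [← hφ p hp]
    have h1 : Tendsto φ.symm (𝓝 (φ p)) (𝓝 p) := by
      have := φ.symm.continuousAt (φ.map_source hp)
      rwa [ContinuousAt, φ.left_inv hp] at this
    filter_upwards [φ.open_target.mem_nhds (φ.map_source hp), h1.eventually hf] with z h2 h3
    exact (h3.comp z (hφt z h2)).contDiffAt
  · filter_upwards [φ.open_source.mem_nhds hp] with q hq
    rw [← hφ q hq, φ.left_inv hq]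

/-- If the fields `X` with `dy(X) ∈ E₁ × 0` annihilate a function, then this function depends only on the
second group of coordinates. -/
lemma IsCoordAt.exists_factor_snd {E₁ E₂ : Type} [NormedAddCommGroup E₁] [NormedSpace ℝ E₁]
    [NormedAddCommGroup E₂] [NormedSpace ℝ E₂] [FiniteDimensional ℝ E₁] [FiniteDimensional ℝ E₂]
    (hE : Module.finrank ℝ (E₁ × E₂) = 4) {y : M → E₁ × E₂} (hy : IsCoordAt y p)
    {F : Type} [NormedAddCommGroup F] [NormedSpace ℝ F] {f : M → F}
    (hf : ∀ᶠ q in 𝓝 p, SmoothFun f q)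
    (h0 : ∀ᶠ q in 𝓝 p, ∀ u : E₁, ∃ X : VField M, dirD X y q = (u, 0) ∧ dirD X f q = 0) :
    ∃ g : E₂ → F, (∀ᶠ z in 𝓝 (y p).2, ContDiffAt ℝ ∞ g z) ∧ ∀ᶠ q in 𝓝 p, f q = g (y q).2 := by
  obtain ⟨g, hg, hfg⟩ := hy.exists_factor hE hf
  have hcont : Tendsto y (𝓝 p) (𝓝 (y p)) := hy.1.self_of_nhds.continuousAt
  have h1 : ∀ᶠ z in 𝓝 (y p), DifferentiableAt ℝ g z ∧ ∀ u, fderiv ℝ g z (u, 0) = 0 := by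
    rw [← hy.map_nhds hE, eventually_map]
    filter_upwards [hcont.eventually hg, h0, hfg.eventually_nhds, hy.1] with q h2 h3 h4 h5
    refine ⟨h2.differentiableAt (by simp), fun u => ?_⟩
    obtain ⟨X, hX1, hX2⟩ := h3 u
    have h6 := dirD_comp (X := X) (h2.differentiableAt (by simp)) h5
    rw [hX1, ← dirD_congr h4, hX2] at h6
    exact h6.symm
  have h2 := eventually_eq_of_fderiv_inl_eq_zero h1
  have hc2 : Tendsto (fun w : E₂ => ((y p).1, w)) (𝓝 (y p).2) (𝓝 (y p)) :=
    (Continuous.prodMk_right (y p).1).tendsto _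
  refine ⟨fun w => g ((y p).1, w), ?_, ?_⟩
  · filter_upwards [hc2.eventually hg] with w hw
    exact ContDiffAt.comp w hw (contDiffAt_const.prodMk contDiffAt_id)
  · filter_upwards [hfg, hcont.eventually h2] with q h3 h4
    rw [h3, h4]

end Coordinates

section Frobenius

variable {M : Type*} [TopologicalSpace M] [ChartedSpace E4 M]
  {F : Type*} [NormedAddCommGroup F] [NormedSpace ℝ F]

lemma dirD_smul {X : VField M} {f : M → ℝ} {g : M → F} {q : M} (hf : SmoothFun f q)
    (hg : SmoothFun g q) :
    dirD X (fun r => f r • g r) q = f q • dirD X g q + dirD X f q • g q :=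
  DFunLike.congr_fun (mvfderiv_smul hf.mdiff hg.mdiff) (X q)

variable [IsManifold (𝓡 4) ∞ M]

/-- `dirD_bracket` for vector-valued functions. -/
lemma dirD_bracket_vec {X Y : VField M} {f : M → F} {q : M} (hX : SmoothVec X q)
    (hY : SmoothVec Y q) (hf : ∀ᶠ r in 𝓝 q, SmoothFun f r) :
    dirD (bracket X Y) f q = dirD X (dirD Y f) q - dirD Y (dirD X f) q := by
  have hfq := hf.self_of_nhds
  refine (SeparatingDual.eq_iff_forall_dual_eq (R := ℝ)).2 fun ℓ => ?_
  have h1 : ∀ Z : VField M, (fun r => ℓ (dirD Z f r)) =ᶠ[𝓝 q] dirD Z fun r => ℓ (f r) := by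
    intro Z
    filter_upwards [hf] with r hr
    exact (dirD_clm ℓ hr).symm
  rw [map_sub, ← dirD_clm ℓ hfq, ← dirD_clm ℓ (hfq.dirD hY), ← dirD_clm ℓ (hfq.dirD hX),
    dirD_congr (h1 Y), dirD_congr (h1 X)]
  exact dirD_bracket hX hY (smoothFun_comp ℓ.contDiff.contDiffAt hfq)

lemma finrank_prod_four : Module.finrank ℝ (ℝ × ℝ × ℝ × ℝ) = 4 := by
  simp [Module.finrank_prod]

variable {α β : VField M} {p : M}

/-- **Frobenius theorem** for planes: there are local coordinates in which the involutive plane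
distribution spanned by `α` and `β` is spanned by the first two coordinate fields, the first of which is
`α`. -/
theorem exists_frobenius_coordinates (hα : ∀ᶠ q in 𝓝 p, SmoothVec α q)
    (hβ : ∀ᶠ q in 𝓝 p, SmoothVec β q) (hind : LinearIndependent ℝ ![α p, β p])
    (hinv : ∀ᶠ q in 𝓝 p, ∃ c d : ℝ, bracket α β q = c • α q + d • β q) :
    ∃ y : M → ℝ × ℝ × ℝ × ℝ, IsCoordAt y p ∧ ∀ᶠ q in 𝓝 p, dirD α y q = (1, 0, 0, 0) ∧
      ∃ b c : ℝ, c ≠ 0 ∧ dirD β y q = (b, c, 0, 0) := by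
  -- first coordinates `z = (t, w)`, in which `α` is the first coordinate field
  obtain ⟨z, hz, hαz⟩ : ∃ z : M → ℝ × ℝ × ℝ × ℝ, IsCoordAt z p ∧
      ∀ᶠ q in 𝓝 p, dirD α z q = (1, 0, 0, 0) := by
    let L : E4 ≃L[ℝ] ℝ × ℝ × ℝ × ℝ := ContinuousLinearEquiv.ofFinrankEq (by simp [Module.finrank_prod])
    have hy := (isCoordAt_chartAt p).clm L
    set y : M → ℝ × ℝ × ℝ × ℝ := fun q => L (chartAt E4 p q)
    have hαy : ∀ᶠ q in 𝓝 p, SmoothFun (dirD α y) q := by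
      filter_upwards [hy.1, hα] with q h1 h2 using h1.dirD h2
    obtain ⟨ν, hν, hνy⟩ := hy.exists_factor finrank_prod_four hαy
    have hν0 : ν (y p) ≠ 0 := by
      rw [← hνy.self_of_nhds]
      intro h
      exact hind.ne_zero 0 (hy.2 α h)
    obtain ⟨Ψ, hΨ, A, hA⟩ := exists_rectification hν hν0
      (e := ((1, 0, 0, 0) : ℝ × ℝ × ℝ × ℝ)) (by simp)
    refine ⟨fun q => Ψ (y q), hy.comp (hΨ.mono fun _ h => h.1) hA, ?_⟩
    have hcont : Tendsto y (𝓝 p) (𝓝 (y p)) := hy.1.self_of_nhds.continuousAt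
    filter_upwards [hcont.eventually hΨ, hy.1, hνy] with q h1 h2 h3
    rw [dirD_comp (h1.1.differentiableAt (by simp)) h2, h3, h1.2]
  have ht : ∀ᶠ q in 𝓝 p, SmoothFun (fun q => (z q).1) q :=
    hz.1.mono fun q h => smoothFun_comp contDiff_fst.contDiffAt h
  have hw : ∀ᶠ q in 𝓝 p, SmoothFun (fun q => (z q).2) q :=
    hz.1.mono fun q h => smoothFun_comp contDiff_snd.contDiffAt h
  have hzt : ∀ X : VField M, ∀ᶠ q in 𝓝 p, dirD X z q = (dirD X (fun q => (z q).1) q,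
      dirD X (fun q => (z q).2) q) := by
    intro X
    filter_upwards [ht, hw] with q h1 h2
    exact dirD_prodMk h1 h2
  have hαt : ∀ᶠ q in 𝓝 p, dirD α (fun q => (z q).1) q = 1 := by
    filter_upwards [hzt α, hαz] with q h1 h2
    exact congrArg Prod.fst (h1.symm.trans h2)
  have hαw : ∀ᶠ q in 𝓝 p, dirD α (fun q => (z q).2) q = 0 := by
    filter_upwards [hzt α, hαz] with q h1 h2
    exact congrArg Prod.snd (h1.symm.trans h2)
  set b : M → ℝ × ℝ × ℝ := dirD β (fun q => (z q).2) with hb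
  have hbs : ∀ᶠ q in 𝓝 p, SmoothFun b q := by
    filter_upwards [hw, hβ] with q h1 h2 using h1.dirD h2
  have hb0 : b p ≠ 0 := by
    intro h
    have h1 := hzt β |>.self_of_nhds
    have h2 := hz.2 (fun q => (1 : ℝ) • β q + (-dirD β (fun q => (z q).1) q) • α q) (by
      rw [dirD_comb, h1, hαz.self_of_nhds, ← hb, h]
      ext <;> simp)
    have h3 := LinearIndependent.pair_iff.1 hind _ 1 (by rw [add_comm]; exact h2)
    exact one_ne_zero h3.2
  -- along `α` the vector `b` only changes by a factor
  have hαb : ∀ᶠ q in 𝓝 p, ∃ d : ℝ, dirD α b q = d • b q := by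
    filter_upwards [hα, hβ, hw.eventually_nhds, hinv, hαw.eventually_nhds] with q h1 h2 h3 h4 h5
    obtain ⟨c, d, hcd⟩ := h4
    refine ⟨d, ?_⟩
    have h6 := dirD_bracket_vec h1 h2 h3
    have h7 : dirD β (dirD α fun q => (z q).2) q = 0 := by
      rw [dirD_congr (g := fun _ => 0) h5, dirD_const]
    have h8 : dirD (bracket α β) (fun q => (z q).2) q
        = c • dirD α (fun q => (z q).2) q + d • b q := by
      rw [← dirD_comb α β (fun _ => c) (fun _ => d)]
      exact dirD_congr_field hcd
    rw [h7, h8, h5.self_of_nhds, smul_zero, zero_add, sub_zero] at h6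
    exact h6.symm
  obtain ⟨ℓ, hℓ⟩ := SeparatingDual.exists_eq_one (R := ℝ) hb0
  have hℓb : ∀ᶠ q in 𝓝 p, ℓ (b q) ≠ 0 := by
    have h1 : ContinuousAt (fun q => ℓ (b q)) p :=
      ℓ.continuous.continuousAt.comp hbs.self_of_nhds.continuousAt
    exact h1.eventually_ne (by rw [hℓ]; exact one_ne_zero)
  have hκs : ∀ᶠ q in 𝓝 p, SmoothFun (fun q => (ℓ (b q))⁻¹) q := by
    filter_upwards [hbs, hℓb] with q h1 h2
    exact smoothFun_comp (h := fun v => (ℓ v)⁻¹) (ℓ.contDiff.contDiffAt.inv h2) h1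
  obtain ⟨B, hB, hBb⟩ := hz.exists_factor_snd finrank_prod_four (f := fun q => (ℓ (b q))⁻¹ • b q) (by
      filter_upwards [hκs, hbs] with q h1 h2
      exact ContMDiffAt.smul h1 h2) (by
    filter_upwards [hαz, hαb, hbs, hκs, hℓb] with q h1 h2 h3 h4 h5 u
    obtain ⟨d, hd⟩ := h2
    refine ⟨fun q => u • α q, ?_, ?_⟩
    · rw [dirD_smul_field (a := fun _ => u), h1]
      ext <;> simp
    · have h6 : dirD α (fun q => (ℓ (b q))⁻¹) q = -(ℓ (b q) ^ 2)⁻¹ * (d * ℓ (b q)) := by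
        have hℓs : SmoothFun (fun q => ℓ (b q)) q := smoothFun_comp ℓ.contDiff.contDiffAt h3
        rw [dirD_real_comp (f := fun q => ℓ (b q)) (hasDerivAt_inv h5) hℓs,
          dirD_clm ℓ h3, hd, map_smul, smul_eq_mul]
      rw [dirD_smul_field (a := fun _ => u), dirD_smul h4 h3, h6, hd, smul_smul, ← add_smul]
      have h7 : (ℓ (b q))⁻¹ * d + -(ℓ (b q) ^ 2)⁻¹ * (d * ℓ (b q)) = 0 := by
        field_simp
        ring
      rw [h7, zero_smul, smul_zero])
  have hB0 : B (z p).2 ≠ 0 := by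
    rw [← hBb.self_of_nhds, hℓ]
    simpa using hb0
  -- rectify the second field in the three remaining coordinates
  obtain ⟨Ψ, hΨ, A, hA⟩ := exists_rectification hB hB0 (e := ((1, 0, 0) : ℝ × ℝ × ℝ)) (by simp)
  have hcont : Tendsto (fun q => (z q).2) (𝓝 p) (𝓝 (z p).2) := hw.self_of_nhds.continuousAt
  refine ⟨fun q => ((z q).1, Ψ (z q).2), ?_, ?_⟩
  · refine hz.comp (Ψ := fun v : ℝ × ℝ × ℝ × ℝ => (v.1, Ψ v.2))
      (A := (ContinuousLinearEquiv.refl ℝ ℝ).prodCongr A) ?_ ?_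
    · have h1 : Tendsto (fun v : ℝ × ℝ × ℝ × ℝ => v.2) (𝓝 (z p)) (𝓝 (z p).2) :=
        continuous_snd.tendsto _
      filter_upwards [h1.eventually hΨ] with v hv
      exact contDiffAt_fst.prodMk (hv.1.comp v contDiffAt_snd)
    · have h1 := hasFDerivAt_fst (𝕜 := ℝ) (p := z p)
      have h2 := HasFDerivAt.comp (g := Ψ) (z p) hA (hasFDerivAt_snd (𝕜 := ℝ) (p := z p))
      exact (h1.prodMk h2).congr_fderiv (by ext <;> simp)
  · filter_upwards [hcont.eventually hΨ, ht, hw, hαt, hαw, hBb, hℓb] with q h1 h2 h3 h4 h5 h6 h7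
    have h8 : ∀ X : VField M, dirD X (fun q => ((z q).1, Ψ (z q).2)) q =
        (dirD X (fun q => (z q).1) q, fderiv ℝ Ψ (z q).2 (dirD X (fun q => (z q).2) q)) := by
      intro X
      rw [dirD_prodMk h2 (smoothFun_comp h1.1 h3),
        dirD_comp (f := fun q => (z q).2) (h1.1.differentiableAt (by simp)) h3]
    refine ⟨by rw [h8, h4, h5, map_zero]; rfl, dirD β (fun q => (z q).1) q, ℓ (b q), h7, ?_⟩
    have h9 : b q = ℓ (b q) • B (z q).2 := by
      rw [← h6, smul_smul, mul_inv_cancel₀ h7, one_smul]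
    have h10 := congrArg (fderiv ℝ Ψ (z q).2) h9
    rw [map_smul, h1.2] at h10
    rw [h8, ← hb, h10]
    ext <;> simp

/-- **Poincaré lemma along the leaves** of the distribution spanned by `α` and `β`: the system `α F = f`,
`β F = g` is solvable if it satisfies its integrability condition. -/
theorem exists_leafwise_primitive (hα : ∀ᶠ q in 𝓝 p, SmoothVec α q)
    (hβ : ∀ᶠ q in 𝓝 p, SmoothVec β q) (hind : LinearIndependent ℝ ![α p, β p]) {f g : M → ℝ}
    (hf : ∀ᶠ q in 𝓝 p, SmoothFun f q) (hg : ∀ᶠ q in 𝓝 p, SmoothFun g q)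
    (hinv : ∀ᶠ q in 𝓝 p, ∃ c d : ℝ, bracket α β q = c • α q + d • β q ∧
      dirD α g q - dirD β f q = c * f q + d * g q) :
    ∃ u : M → ℝ, ∀ᶠ q in 𝓝 p, SmoothFun u q ∧ dirD α u q = f q ∧ dirD β u q = g q := by
  obtain ⟨y, hy, hαβ⟩ := exists_frobenius_coordinates hα hβ hind
    (hinv.mono fun q ⟨c, d, h, _⟩ => ⟨c, d, h⟩)
  have hcont : Tendsto y (𝓝 p) (𝓝 (y p)) := hy.1.self_of_nhds.continuousAt
  -- a function `u₁` with `α u₁ = f`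
  obtain ⟨f', hf', hff'⟩ := hy.exists_factor finrank_prod_four hf
  obtain ⟨U, hU⟩ := exists_smooth_primitive hf'
  set u₁ : M → ℝ := fun q => U (y q) with hu₁
  have hu₁s : ∀ᶠ q in 𝓝 p, SmoothFun u₁ q := by
    filter_upwards [hcont.eventually hU, hy.1] with q h1 h2 using smoothFun_comp h1.1 h2
  have hαu₁ : ∀ᶠ q in 𝓝 p, dirD α u₁ q = f q := by
    filter_upwards [hcont.eventually hU, hy.1, hαβ, hff'] with q h1 h2 h3 h4
    rw [hu₁, dirD_comp (h1.1.differentiableAt (by simp)) h2, h3.1, h4]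
    exact h1.2
  -- the remaining right-hand side is constant along `α` up to the factor `β y`
  set s : M → ℝ := fun q => (y q).2.1 with hs
  have hss : ∀ᶠ q in 𝓝 p, SmoothFun s q :=
    hy.1.mono fun q h => smoothFun_comp (h := fun v : ℝ × ℝ × ℝ × ℝ => v.2.1)
      (contDiff_fst.comp contDiff_snd).contDiffAt h
  let π₂ : ℝ × ℝ × ℝ × ℝ →L[ℝ] ℝ :=
    (ContinuousLinearMap.fst ℝ ℝ (ℝ × ℝ)).comp (ContinuousLinearMap.snd ℝ ℝ (ℝ × ℝ × ℝ))
  have hds : ∀ X : VField M, ∀ᶠ q in 𝓝 p, dirD X s q = (dirD X y q).2.1 := by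
    intro X
    filter_upwards [hy.1] with q h1
    exact dirD_clm π₂ h1
  have hαs : ∀ᶠ q in 𝓝 p, dirD α s q = 0 := by
    filter_upwards [hds α, hαβ] with q h1 h2
    rw [h1, h2.1]
  have hβs : ∀ᶠ q in 𝓝 p, dirD β s q ≠ 0 := by
    filter_upwards [hds β, hαβ] with q h1 h2
    obtain ⟨-, b, c, hc, hbc⟩ := h2
    rw [h1, hbc]
    exact hc
  have hbs : ∀ᶠ q in 𝓝 p, SmoothFun (dirD β s) q := by
    filter_upwards [hss, hβ] with q h1 h2 using h1.dirD h2
  have hβu : ∀ᶠ q in 𝓝 p, SmoothFun (dirD β u₁) q := by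
    filter_upwards [hu₁s, hβ] with q h1 h2 using h1.dirD h2
  set R : M → ℝ := fun q => (dirD β s q)⁻¹ * (g q - dirD β u₁ q) with hR
  have hinvs : ∀ᶠ q in 𝓝 p, SmoothFun (fun q => (dirD β s q)⁻¹) q := by
    filter_upwards [hbs, hβs] with q h1 h2
    exact smoothFun_comp (h := fun v : ℝ => v⁻¹) (contDiffAt_inv ℝ h2) h1
  have hRs : ∀ᶠ q in 𝓝 p, SmoothFun R q := by
    filter_upwards [hinvs, hg, hβu] with q h1 h2 h3
    exact ContMDiffAt.mul h1 (ContMDiffAt.sub h2 h3)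
  have hαR : ∀ᶠ q in 𝓝 p, dirD α R q = 0 := by
    filter_upwards [hα, hβ, hinv, hg, hβu, hinvs, hbs, hβs, hss, hu₁s, hαu₁.eventually_nhds,
      hαs.eventually_nhds] with q h1 h2 h3 h4 h5 h6 h7 h8 h9 h10 h11 h12
    obtain ⟨c, d, hcd, hfg⟩ := h3
    have hbr : ∀ u : M → ℝ, dirD (bracket α β) u q = c * dirD α u q + d * dirD β u q := by
      intro u
      have := dirD_comb α β (fun _ => c) (fun _ => d) u q
      rw [smul_eq_mul, smul_eq_mul] at this
      rw [← this]
      exact dirD_congr_field hcd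
    have e1 : dirD α (dirD β s) q = d * dirD β s q := by
      have := dirD_bracket h1 h2 h9
      rw [hbr, dirD_congr (f := dirD α s) (g := fun _ => 0) h12, dirD_const, h12.self_of_nhds] at this
      linarith
    have e2 : dirD α (dirD β u₁) q = dirD β f q + c * f q + d * dirD β u₁ q := by
      have := dirD_bracket h1 h2 h10
      rw [hbr, dirD_congr (f := dirD α u₁) (g := f) h11, h11.self_of_nhds] at this
      linarith
    have e3 : dirD α (fun q => (dirD β s q)⁻¹) q = -(dirD β s q ^ 2)⁻¹ * (d * dirD β s q) := by
      rw [dirD_real_comp (hasDerivAt_inv h8) h7, e1]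
    rw [hR, dirD_mul h6 (ContMDiffAt.sub h4 h5), dirD_sub h4 h5, e2, e3]
    field_simp
    linear_combination hfg
  obtain ⟨r, hr, hrR⟩ := hy.exists_factor_snd finrank_prod_four hRs (by
    filter_upwards [hαβ, hαR] with q h1 h2 u
    refine ⟨fun q => u • α q, ?_, ?_⟩
    · rw [dirD_smul_field (a := fun _ => u), h1.1]
      ext <;> simp
    · rw [dirD_smul_field (a := fun _ => u), h2, smul_zero])
  obtain ⟨V, hV⟩ := exists_smooth_primitive hr
  have hcont2 : Tendsto (fun q => (y q).2) (𝓝 p) (𝓝 (y p).2) :=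
    (continuous_snd.tendsto _).comp hcont
  refine ⟨fun q => u₁ q + V (y q).2, ?_⟩
  filter_upwards [hu₁s, hαu₁, hcont2.eventually hV, hy.1, hαβ, hrR, hβs, hds β]
    with q h1 h2 h3 h4 h5 h6 h7 h8
  have hy2 : SmoothFun (fun q => (y q).2) q := smoothFun_comp contDiff_snd.contDiffAt h4
  have hVs : SmoothFun (fun q => V (y q).2) q := smoothFun_comp h3.1 hy2
  have hdV : ∀ X : VField M, dirD X (fun q => V (y q).2) q = fderiv ℝ V (y q).2 (dirD X y q).2 := by
    intro X
    rw [dirD_comp (f := fun q => (y q).2) (h3.1.differentiableAt (by simp)) hy2]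
    congr 1
    exact dirD_clm (ContinuousLinearMap.snd ℝ ℝ (ℝ × ℝ × ℝ)) h4
  obtain ⟨hα1, b, c, hc, hβ1⟩ := h5
  refine ⟨ContMDiffAt.add h1 hVs, ?_, ?_⟩
  · rw [dirD_add h1 hVs, hdV, hα1, h2]
    have : ((0, 0, 0) : ℝ × ℝ × ℝ) = 0 := rfl
    rw [this, map_zero, add_zero]
  · rw [dirD_add h1 hVs, hdV, hβ1]
    have e1 : ((c, 0, 0) : ℝ × ℝ × ℝ) = c • ((1, 0) : ℝ × ℝ × ℝ) := by
      ext <;> simp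
    have e2 : dirD β s q = c := by rw [h8, hβ1]
    rw [show ((b, c, 0, 0) : ℝ × ℝ × ℝ × ℝ).2 = (c, 0, 0) from rfl, e1, map_smul, h3.2, ← h6, hR]
    simp only [smul_eq_mul, e2]
    field_simp
    ring

/-- A vector field on the leaf space of the distribution spanned by `α` and `β` that is not zero at the
leaf of `p` is a coordinate field in suitable coordinates `ξ` of the leaf space. The field is given by its
components `ν` in the coordinates `(y q).2.2` of the leaf space, as functions constant on the leaves. -/
theorem exists_leafSpace_rectification {y : M → ℝ × ℝ × ℝ × ℝ} (hy : IsCoordAt y p)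
    (hαβ : ∀ᶠ q in 𝓝 p, dirD α y q = (1, 0, 0, 0) ∧
      ∃ b c : ℝ, c ≠ 0 ∧ dirD β y q = (b, c, 0, 0)) {ν : M → ℝ × ℝ}
    (hν : ∀ᶠ q in 𝓝 p, SmoothFun ν q) (hαν : ∀ᶠ q in 𝓝 p, dirD α ν q = 0)
    (hβν : ∀ᶠ q in 𝓝 p, dirD β ν q = 0) (hν0 : ν p ≠ 0) :
    ∃ ξ : ℝ × ℝ → ℝ × ℝ, (∀ᶠ q in 𝓝 p, ContDiffAt ℝ ∞ ξ (y q).2.2 ∧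
        fderiv ℝ ξ (y q).2.2 (ν q) = (1, 0)) ∧
      ∃ A : (ℝ × ℝ) ≃L[ℝ] ℝ × ℝ, HasFDerivAt ξ (A : ℝ × ℝ →L[ℝ] ℝ × ℝ) (y p).2.2 := by
  let L : (ℝ × ℝ × ℝ × ℝ) ≃L[ℝ] (ℝ × ℝ) × ℝ × ℝ := (ContinuousLinearEquiv.prodAssoc ℝ ℝ ℝ (ℝ × ℝ)).symm
  have hL : ∀ v, L v = ((v.1, v.2.1), v.2.2) := fun v => rfl
  have hdim : Module.finrank ℝ ((ℝ × ℝ) × ℝ × ℝ) = 4 := by simp [Module.finrank_prod]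
  obtain ⟨N, hN, hNν⟩ := (hy.clm L).exists_factor_snd hdim hν (by
    filter_upwards [hαβ, hαν, hβν, hy.1] with q h1 h2 h3 h4 u
    obtain ⟨hα1, b, c, hc, hβ1⟩ := h1
    refine ⟨fun q => (u.1 - u.2 / c * b) • α q + (u.2 / c) • β q, ?_, ?_⟩
    · have h5 := dirD_clm (X := fun q => (u.1 - u.2 / c * b) • α q + (u.2 / c) • β q)
        (L : (ℝ × ℝ × ℝ × ℝ) →L[ℝ] (ℝ × ℝ) × ℝ × ℝ) h4
      refine h5.trans ?_
      rw [dirD_comb α β (fun _ => u.1 - u.2 / c * b) (fun _ => u.2 / c), hα1, hβ1]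
      simp [hL, hc]
    · rw [dirD_comb α β (fun _ => u.1 - u.2 / c * b) (fun _ => u.2 / c), h2, h3, smul_zero,
        smul_zero, add_zero])
  have hN0 : N (L (y p)).2 ≠ 0 := by rwa [← hNν.self_of_nhds]
  obtain ⟨ξ, hξ, A, hA⟩ := exists_rectification hN hN0 (e := ((1, 0) : ℝ × ℝ)) (by simp)
  refine ⟨ξ, ?_, A, hA⟩
  have hcont : Tendsto (fun q => (y q).2.2) (𝓝 p) (𝓝 (y p).2.2) :=
    ((continuous_snd.comp continuous_snd).tendsto _).comp hy.1.self_of_nhds.continuousAt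
  filter_upwards [hcont.eventually hξ, hNν] with q h1 h2
  refine ⟨h1.1, ?_⟩
  rw [h2]
  exact h1.2

end Frobenius

/-! ### Null tetrads -/

section Tetrads

variable {M : Type*} [TopologicalSpace M] [ChartedSpace E4 M]

@[simp] lemma eps_zero_zero : eps 0 0 = 0 := rfl
@[simp] lemma eps_zero_one : eps 0 1 = 1 := rfl
@[simp] lemma eps_one_zero : eps 1 0 = -1 := rfl
@[simp] lemma eps_one_one : eps 1 1 = 0 := rfl

lemma Tetrad.change_one {q : M} (e : Tetrad q) : e.change 1 1 = e := by
  funext a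
  obtain ⟨A, A'⟩ := a
  simp only [Tetrad.change, Matrix.one_apply, Fin.sum_univ_two]
  revert A A'
  rw [Fin.forall_fin_two, Fin.forall_fin_two, Fin.forall_fin_two]
  simp

lemma Tetrad.change_change {q : M} (e : Tetrad q) (L L' K K' : Matrix (Fin 2) (Fin 2) ℝ) :
    (e.change L L').change K K' = e.change (L * K) (L' * K') := by
  funext a
  simp only [Tetrad.change, Fin.sum_univ_two, Matrix.mul_apply, smul_add, smul_smul]
  module

lemma Tetrad.vec_change {q : M} (e : Tetrad q) (L L' : Matrix (Fin 2) (Fin 2) ℝ) (η π : Fin 2 → ℝ) :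
    (e.change L L').vec η π = e.vec (L *ᵥ η) (L' *ᵥ π) := by
  simp only [Tetrad.vec, Tetrad.change, Fin.sum_univ_two, Matrix.mulVec, dotProduct, smul_add,
    smul_smul]
  module

lemma Tetrad.vec_eq {q : M} (e : Tetrad q) (η π : Fin 2 → ℝ) :
    e.vec η π = (η 0 * π 0) • e (0, 0) + (η 0 * π 1) • e (0, 1) + (η 1 * π 0) • e (1, 0)
      + (η 1 * π 1) • e (1, 1) := by
  simp only [Tetrad.vec, Fin.sum_univ_two]
  module

namespace SpinData

variable (G : SpinData M)

/-- Expansion of a tangent vector in a null tetrad. -/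
lemma tetrad_expand {q : M} {e : Tetrad q} (he : ∀ a b, G.metric q (e a) (e b) = eta a b)
    (v : TangentSpace (𝓡 4) q) :
    v = G.metric q v (e (1, 1)) • e (0, 0) + (-G.metric q v (e (0, 1))) • e (1, 0)
      + (-G.metric q v (e (1, 0))) • e (0, 1) + G.metric q v (e (0, 0)) • e (1, 1) := by
  have hval : ∀ (c : Idx → ℝ) (b : Idx), G.metric q (∑ a, c a • e a) (e b) = ∑ a, c a * eta a b := by
    intro c b
    rw [map_sum, sum_apply]
    refine Finset.sum_congr rfl fun a _ => ?_
    rw [map_smul, smul_apply, he]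
    rfl
  have hli : LinearIndependent ℝ e := by
    rw [Fintype.linearIndependent_iff]
    intro c hc
    have h1 : ∀ b, ∑ a, c a * eta a b = 0 := by
      intro b
      rw [← hval, hc, map_zero]
      rfl
    have h00 := h1 (0, 0)
    have h01 := h1 (0, 1)
    have h10 := h1 (1, 0)
    have h11 := h1 (1, 1)
    simp [Fintype.sum_prod_type, eta] at h00 h01 h10 h11
    rintro ⟨A, A'⟩
    fin_cases A <;> fin_cases A' <;> assumption
  have hcard : Fintype.card Idx = Module.finrank ℝ (TangentSpace (𝓡 4) q) := by
    change Fintype.card Idx = Module.finrank ℝ E4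
    simp [Idx]
  have : FiniteDimensional ℝ (TangentSpace (𝓡 4) q) := inferInstanceAs (FiniteDimensional ℝ E4)
  obtain ⟨c, hc⟩ : ∃ c : Idx → ℝ, ∑ a, c a • e a = v := by
    have := hli.span_eq_top_of_card_eq_finrank' hcard
    exact (Submodule.mem_span_range_iff_exists_fun ℝ).1 (this ▸ Submodule.mem_top)
  have h00 := hval c (0, 0)
  have h01 := hval c (0, 1)
  have h10 := hval c (1, 0)
  have h11 := hval c (1, 1)
  rw [hc] at h00 h01 h10 h11
  simp [Fintype.sum_prod_type, eta] at h00 h01 h10 h11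
  rw [h00, h01, h10, h11, ← hc]
  simp only [Fintype.sum_prod_type, Fin.sum_univ_two]
  module

/-- Nondegeneracy of `h`, tested on a null tetrad. -/
lemma metric_ext {q : M} {e : Tetrad q} (he : ∀ a b, G.metric q (e a) (e b) = eta a b)
    {v w : TangentSpace (𝓡 4) q} (h : ∀ a, G.metric q v (e a) = G.metric q w (e a)) : v = w := by
  rw [G.tetrad_expand he v, G.tetrad_expand he w, h, h, h, h]

lemma represents_smul {q : M} {e : Tetrad q} {π : Fin 2 → ℝ} {c : ℝ} (hc : c ≠ 0) :
    G.Represents e (c • π) ↔ G.Represents e π := by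
  have hmk : ∀ (h : π ≠ 0) (h' : c • π ≠ 0),
      Projectivization.mk ℝ (c • π) h' = Projectivization.mk ℝ π h := by
    intro h h'
    rw [Projectivization.mk_eq_mk_iff']
    exact ⟨c, rfl⟩
  constructor
  · rintro ⟨h, h'⟩
    have h0 : π ≠ 0 := fun h0 => h (by rw [h0, smul_zero])
    exact ⟨h0, by rw [h', hmk h0]⟩
  · rintro ⟨h, h'⟩
    have h0 : c • π ≠ 0 := smul_ne_zero hc h
    exact ⟨h0, by rw [h', hmk h h0]⟩

lemma represents_unique {q : M} {e : Tetrad q} {π π' : Fin 2 → ℝ} (h : G.Represents e π)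
    (h' : G.Represents e π') : ∃ c : ℝ, c ≠ 0 ∧ π = c • π' := by
  obtain ⟨h0, h1⟩ := h
  obtain ⟨h0', h1'⟩ := h'
  rw [h1, Projectivization.mk_eq_mk_iff'] at h1'
  obtain ⟨c, hc⟩ := h1'
  exact ⟨c, fun h => h0 (by rw [← hc, h, zero_smul]), hc.symm⟩

variable [IsManifold (𝓡 4) ∞ M] {G} {U W : Set M}

lemma IsSpinGeometryOn.symm (hG : G.IsSpinGeometryOn U) {q : M} (hq : q ∈ U)
    (v w : TangentSpace (𝓡 4) q) : G.metric q v w = G.metric q w v :=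
  (hG.neutral.2 q hq).1 v w

lemma IsSpinGeometryOn.smooth_metric (hG : G.IsSpinGeometryOn U) {q : M} (hq : q ∈ U) {X Y : VField M}
    (hX : SmoothVec X q) (hY : SmoothVec Y q) : SmoothFun (fun r => G.metric r (X r) (Y r)) q := by
  have h1 := (hG.neutral.1 q hq).contMDiffAt (hG.isOpen.mem_nhds hq)
  have h2 := ContMDiffAt.clm_bundle_apply₂ (b := fun r : M => r) (F₁ := E4) (F₂ := E4) (F₃ := ℝ)
    (E₁ := TangentSpace (𝓡 4)) (E₂ := TangentSpace (𝓡 4)) (E₃ := Bundle.Trivial M ℝ) h1 hX hY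
  exact (Bundle.contMDiffAt_totalSpace.1 h2).2

lemma IsLSROn.isOpen {e : ∀ q : M, Tetrad q} {π : M → Fin 2 → ℝ} (h : G.IsLSROn W e π) : IsOpen W :=
  h.1.1

lemma IsLSROn.smoothVec {e : ∀ q : M, Tetrad q} {π : M → Fin 2 → ℝ} (h : G.IsLSROn W e π) {q : M}
    (hq : q ∈ W) (a : Idx) : SmoothVec (fun r => e r a) q :=
  (h.1.2.1 a q hq).contMDiffAt (h.isOpen.mem_nhds hq)

lemma IsLSROn.smoothFun {e : ∀ q : M, Tetrad q} {π : M → Fin 2 → ℝ} (h : G.IsLSROn W e π) {q : M}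
    (hq : q ∈ W) (A : Fin 2) : SmoothFun (fun r => π r A) q :=
  smoothFun_comp (h := fun v : Fin 2 → ℝ => v A) (contDiff_apply ℝ ℝ A).contDiffAt
    ((h.2.1 q hq).contMDiffAt (h.isOpen.mem_nhds hq))

lemma IsLSROn.mem_frames {e : ∀ q : M, Tetrad q} {π : M → Fin 2 → ℝ} (h : G.IsLSROn W e π) {q : M}
    (hq : q ∈ W) : e q ∈ G.frames q := h.1.2.2 q hq

lemma IsLSROn.mono {e : ∀ q : M, Tetrad q} {π : M → Fin 2 → ℝ} (h : G.IsLSROn W e π) {W' : Set M}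
    (hW' : IsOpen W') (hsub : W' ⊆ W) : G.IsLSROn W' e π :=
  ⟨⟨hW', fun a => (h.1.2.1 a).mono hsub, fun q hq => h.1.2.2 q (hsub hq)⟩, h.2.1.mono hsub,
    fun q hq => h.2.2 q (hsub hq)⟩

/-- A spin tetrad may be replaced by the one belonging to other spin frames; the components of the
projective spinor change accordingly. -/
lemma IsLSROn.change (hG : G.IsSpinGeometryOn U) {e : ∀ q : M, Tetrad q} {π π' : M → Fin 2 → ℝ}
    (h : G.IsLSROn W e π) (hWU : W ⊆ U) {W' : Set M} (hW' : IsOpen W') (hsub : W' ⊆ W)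
    {L L' : M → Matrix (Fin 2) (Fin 2) ℝ} (hL : ∀ q ∈ W', ∀ A B, SmoothFun (fun r => L r A B) q)
    (hL' : ∀ q ∈ W', ∀ A B, SmoothFun (fun r => L' r A B) q) (hdet : ∀ q ∈ W', (L q).det = 1)
    (hdet' : ∀ q ∈ W', (L' q).det = 1) (hπ' : ∀ q ∈ W', SmoothFun π' q)
    (hπ : ∀ q ∈ W', ∃ c : ℝ, c ≠ 0 ∧ π q = c • (L' q *ᵥ π' q)) :
    G.IsLSROn W' (fun q => (e q).change (L q) (L' q)) π' := by
  refine ⟨⟨hW', ?_, ?_⟩, ?_, ?_⟩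
  · intro a q hq
    have h1 : ∀ B B', SmoothVec (fun r => (L r B a.1 * L' r B' a.2) • e r (B, B')) q :=
      fun B B' => SmoothVec.smul (ContMDiffAt.mul (hL q hq B a.1) (hL' q hq B' a.2))
        (h.smoothVec (hsub hq) (B, B'))
    have h2 := ((h1 0 0).add (h1 0 1)).add ((h1 1 0).add (h1 1 1))
    refine ContMDiffAt.contMDiffWithinAt ?_
    simpa only [Tetrad.change, Fin.sum_univ_two] using h2
  · intro q hq
    exact (hG.orbit q (hWU (hsub hq)) _ (h.mem_frames (hsub hq)) _).2
      ⟨L q, L' q, hdet q hq, hdet' q hq, rfl⟩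
  · exact fun q hq => (hπ' q hq).contMDiffWithinAt
  · intro q hq
    have hu : IsUnit (L q).det := by rw [hdet q hq]; exact isUnit_one
    have hu' : IsUnit (L' q).det := by rw [hdet' q hq]; exact isUnit_one
    have hback : ((e q).change (L q) (L' q)).change (L q)⁻¹ (L' q)⁻¹ = e q := by
      rw [Tetrad.change_change, Matrix.mul_nonsing_inv _ hu, Matrix.mul_nonsing_inv _ hu',
        Tetrad.change_one]
    have hmem : (e q).change (L q) (L' q) ∈ G.frames q :=
      (hG.orbit q (hWU (hsub hq)) _ (h.mem_frames (hsub hq)) _).2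
        ⟨L q, L' q, hdet q hq, hdet' q hq, rfl⟩
    obtain ⟨c, hc, hcπ⟩ := hπ q hq
    have h1 : G.Represents (e q) (L' q *ᵥ π' q) := by
      rw [← G.represents_smul hc, ← hcπ]
      exact h.2.2 q (hsub hq)
    rw [← hback] at h1
    have h2 := hG.equivariant q (hWU (hsub hq)) _ hmem (L q)⁻¹ (L' q)⁻¹
      (by rw [Matrix.det_nonsing_inv, hdet q hq, Ring.inverse_one])
      (by rw [Matrix.det_nonsing_inv, hdet' q hq, Ring.inverse_one]) _ h1
    rwa [Matrix.mulVec_mulVec, Matrix.nonsing_inv_mul _ hu', Matrix.one_mulVec] at h2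

/-- There is a spin tetrad near each point in whose primed spin frame the projective spinor field has the
representative `(1, 0)`. -/
lemma IsLSROn.exists_normalized (hG : G.IsSpinGeometryOn U) {e : ∀ q : M, Tetrad q}
    {π : M → Fin 2 → ℝ} (h : G.IsLSROn W e π) (hWU : W ⊆ U) :
    ∃ e', G.IsLSROn W e' fun _ => ![1, 0] := by
  -- complete `π` to a primed spin frame by the Euclidean rotation of `π / |π|²`
  have hr : ∀ q ∈ W, π q 0 ^ 2 + π q 1 ^ 2 ≠ 0 := by
    intro q hq h0
    obtain ⟨h1, -⟩ := h.2.2 q hq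
    apply h1
    have h2 : π q 0 = 0 := by nlinarith [sq_nonneg (π q 0), sq_nonneg (π q 1)]
    have h3 : π q 1 = 0 := by nlinarith [sq_nonneg (π q 0), sq_nonneg (π q 1)]
    funext A
    fin_cases A <;> assumption
  have hs : ∀ q ∈ W, SmoothFun (fun r => (π r 0 ^ 2 + π r 1 ^ 2)⁻¹) q := by
    intro q hq
    refine smoothFun_comp (f := fun r => (π r 0, π r 1))
      (h := fun v : ℝ × ℝ => (v.1 ^ 2 + v.2 ^ 2)⁻¹) ?_
      ((h.smoothFun hq 0).prodMk (h.smoothFun hq 1))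
    exact ContDiffAt.inv (by fun_prop) (hr q hq)
  refine ⟨_, h.change hG hWU h.isOpen le_rfl (L := fun _ => 1)
    (L' := fun q => !![π q 0, -(π q 1 * (π q 0 ^ 2 + π q 1 ^ 2)⁻¹);
      π q 1, π q 0 * (π q 0 ^ 2 + π q 1 ^ 2)⁻¹]) (fun q hq A B => contMDiffAt_const) ?_ ?_ ?_
      (fun q hq => contMDiffAt_const) ?_⟩
  · intro q hq A B
    have h0 := h.smoothFun hq 0
    have h1 := h.smoothFun hq 1
    have h2 := hs q hq
    fin_cases A <;> fin_cases B
    · exact h0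
    · exact ContMDiffAt.neg (ContMDiffAt.mul h1 h2)
    · exact h1
    · exact ContMDiffAt.mul h0 h2
  · intro q hq; simp
  · intro q hq
    rw [Matrix.det_fin_two_of]
    have := hr q hq
    field_simp
    ring
  · intro q hq
    refine ⟨1, one_ne_zero, ?_⟩
    funext A
    fin_cases A <;> simp

end SpinData

end Tetrads

/-! ### The forms `S_a` and adapted null tetrads -/

namespace SpinData

variable {M : Type*} [TopologicalSpace M] [ChartedSpace E4 M]
variable {G : SpinData M} {U W : Set M}

section BracketCoeff

lemma bracketCoeff_swap (e : ∀ q : M, Tetrad q) (a b c : Idx) (q : M) :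
    G.bracketCoeff e b a c q = -G.bracketCoeff e a b c q := by
  unfold bracketCoeff
  rw [VectorField.mlieBracket_swap_apply, map_neg]
  rfl

@[simp] lemma bracketCoeff_self (e : ∀ q : M, Tetrad q) (a c : Idx) (q : M) :
    G.bracketCoeff e a a c q = 0 := by
  have := bracketCoeff_swap (G := G) e a a c q
  linarith

/-- The components of `S_a` when the first primed spinor of the frame represents `[π]`. -/
lemma S_normalized (e : ∀ q : M, Tetrad q) (a : Idx) (q : M) :
    G.S e (fun _ => ![1, 0]) a q =
      (G.bracketCoeff e a (1, 0) (0, 0) q + G.bracketCoeff e (0, 0) (1, 0) a q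
        - G.bracketCoeff e a (0, 0) (1, 0) q) / 2 := by
  have h1 := bracketCoeff_swap (G := G) e (0, 0) (1, 0) a q
  have h2 := bracketCoeff_swap (G := G) e a (0, 0) (1, 0) q
  have h3 := bracketCoeff_swap (G := G) e a (1, 0) (0, 0) q
  simp [S, covSpinor, spinConn, conn, connLower, Fin.sum_univ_two, Fintype.sum_prod_type, eta,
    D_eq_dirD, h1, h2, h3]
  ring

end BracketCoeff

variable [IsManifold (𝓡 4) ∞ M]

/-- On an integrable α-distribution, the bracket of its two tetrad fields. -/
lemma IsLSROn.bracket_eq (hG : G.IsSpinGeometryOn U) (hint : G.IsIntegrableOn U)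
    {e : ∀ q : M, Tetrad q} (h : G.IsLSROn W e fun _ => ![1, 0]) (hWU : W ⊆ U) {q : M} (hq : q ∈ W) :
    bracket (fun r => e r (0, 0)) (fun r => e r (1, 0)) q =
      G.bracketCoeff e (0, 0) (1, 0) (1, 1) q • e q (0, 0)
        + (-G.bracketCoeff e (0, 0) (1, 0) (0, 1) q) • e q (1, 0) := by
  have h0 := hint W hWU e _ h q hq 0
  have h1 := hint W hWU e _ h q hq 1
  have hs := bracketCoeff_swap (G := G) e (0, 0) (1, 0) (1, 0) q
  simp [Fin.sum_univ_two, S_normalized, hs] at h0 h1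
  have e0 : G.metric q (bracket (fun r => e r (0, 0)) (fun r => e r (1, 0)) q) (e q (0, 0)) = 0 := h0
  have e1 : G.metric q (bracket (fun r => e r (0, 0)) (fun r => e r (1, 0)) q) (e q (1, 0)) = 0 := by
    change G.bracketCoeff e (0, 0) (1, 0) (1, 0) q = 0
    linarith
  have := G.tetrad_expand (hG.null q (hWU hq) _ (h.mem_frames hq))
    (bracket (fun r => e r (0, 0)) (fun r => e r (1, 0)) q)
  rw [e0, e1, neg_zero, zero_smul, zero_smul, add_zero, add_zero] at this
  exact this

/-- An adapted tetrad: one whose primed spin frame has the projective spinor field as its first member,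
and for which the covector fields `h(e_{A0'}, ·)` are the differentials of functions `z_A`. -/
structure IsAdaptedOn (G : SpinData M) (W : Set M) (e : ∀ q : M, Tetrad q) (z : Fin 2 → M → ℝ) :
    Prop where
  lsr : G.IsLSROn W e fun _ => ![1, 0]
  smooth : ∀ q ∈ W, ∀ A, SmoothFun (z A) q
  metric_eq : ∀ q ∈ W, ∀ A, ∀ X : VField M, G.metric q (e q (A, 0)) (X q) = dirD X (z A) q

/-- Functions with independent differentials that are constant along the α-distribution give rise to an
adapted tetrad, up to the sign of the second function. The sign is forced: the tetrads of the spinor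
structure form a single orbit of `SL(2,ℝ) × SL(2,ℝ)`, so the orientation of the pair `h(e_{A0'}, ·)` is
determined. -/
theorem exists_adapted (hG : G.IsSpinGeometryOn U) {e : ∀ q : M, Tetrad q}
    (h : G.IsLSROn W e fun _ => ![1, 0]) (hWU : W ⊆ U) {p : M} (hp : p ∈ W) {x y : M → ℝ}
    (hx : ∀ᶠ q in 𝓝 p, SmoothFun x q ∧ ∀ A : Fin 2, dirD (fun r => e r (A, 0)) x q = 0)
    (hy : ∀ᶠ q in 𝓝 p, SmoothFun y q ∧ ∀ A : Fin 2, dirD (fun r => e r (A, 0)) y q = 0)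
    (hsurj : ∀ c d : ℝ, ∃ X : VField M, dirD X x p = c ∧ dirD X y p = d) :
    ∃ σ : ℝ, (σ = 1 ∨ σ = -1) ∧ ∃ W' ⊆ W, p ∈ W' ∧ ∃ e',
      G.IsAdaptedOn W' e' ![x, fun q => σ * y q] := by
  have hW : ∀ᶠ q in 𝓝 p, q ∈ W := h.isOpen.mem_nhds hp
  -- a function constant along the distribution is determined by its derivatives along the other fields
  have hexp : ∀ u : M → ℝ, ∀ q ∈ W, (∀ A : Fin 2, dirD (fun r => e r (A, 0)) u q = 0) →
      ∀ X : VField M, dirD X u q = G.metric q (X q) (e q (0, 0)) * dirD (fun r => e r (1, 1)) u q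
        - G.metric q (X q) (e q (1, 0)) * dirD (fun r => e r (0, 1)) u q := by
    intro u q hq hu X
    have h1 := G.tetrad_expand (hG.null q (hWU hq) _ (h.mem_frames hq)) (X q)
    have h00 : mfderiv (𝓡 4) 𝓘(ℝ, ℝ) u q (e q (0, 0)) = 0 := hu 0
    have h10 : mfderiv (𝓡 4) 𝓘(ℝ, ℝ) u q (e q (1, 0)) = 0 := hu 1
    have h2 : dirD X u q = mfderiv (𝓡 4) 𝓘(ℝ, ℝ) u q (X q) := rfl
    rw [h2]
    conv_lhs => rw [h1]
    rw [map_add, map_add, map_add, map_smul, map_smul, map_smul, map_smul, h00, h10, smul_zero,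
      smul_zero, zero_add, zero_add]
    change -(G.metric q (X q) (e q (1, 0))) * dirD (fun r => e r (0, 1)) u q
      + G.metric q (X q) (e q (0, 0)) * dirD (fun r => e r (1, 1)) u q = _
    ring
  -- the determinant of `(x, y)` with respect to the two transversal tetrad fields
  set J : M → ℝ := fun q => dirD (fun r => e r (0, 1)) x q * dirD (fun r => e r (1, 1)) y q
    - dirD (fun r => e r (1, 1)) x q * dirD (fun r => e r (0, 1)) y q with hJ
  have hdet : ∀ {a b c d x₀ x₁ y₀ y₁ : ℝ}, a * x₁ - b * x₀ = 1 → a * y₁ - b * y₀ = 0 →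
      c * x₁ - d * x₀ = 0 → c * y₁ - d * y₀ = 1 → x₀ * y₁ - x₁ * y₀ ≠ 0 := by
    intro a b c d x₀ x₁ y₀ y₁ h1 h2 h3 h4 h0
    have : (1 : ℝ) = 0 := by
      linear_combination -(c * y₁ - d * y₀) * h1 - h4 + (c * x₁ - d * x₀) * h2
        + (a * d - b * c) * h0
    exact one_ne_zero this
  have hJ0 : J p ≠ 0 := by
    intro h0
    obtain ⟨X, hX1, hX2⟩ := hsurj 1 0
    obtain ⟨Y, hY1, hY2⟩ := hsurj 0 1
    rw [hexp x p hp hx.self_of_nhds.2] at hX1 hY1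
    rw [hexp y p hp hy.self_of_nhds.2] at hX2 hY2
    exact hdet hX1 hX2 hY1 hY2 h0
  obtain ⟨σ, hσ, hσJ⟩ : ∃ σ : ℝ, (σ = 1 ∨ σ = -1) ∧ 0 < σ * J p := by
    rcases lt_or_gt_of_ne hJ0 with h0 | h0
    · exact ⟨-1, Or.inr rfl, by linarith⟩
    · exact ⟨1, Or.inl rfl, by linarith⟩
  have hxs : ∀ᶠ q in 𝓝 p, ∀ a, SmoothFun (dirD (fun r => e r a) x) q := by
    filter_upwards [hW, hx] with q h1 h2 a using h2.1.dirD (h.smoothVec h1 a)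
  have hys : ∀ᶠ q in 𝓝 p, ∀ a, SmoothFun (dirD (fun r => e r a) y) q := by
    filter_upwards [hW, hy] with q h1 h2 a using h2.1.dirD (h.smoothVec h1 a)
  have hJs : ∀ᶠ q in 𝓝 p, SmoothFun J q := by
    filter_upwards [hxs, hys] with q h1 h2
    exact ((h1 _).mul (h2 _)).sub ((h1 _).mul (h2 _))
  have hJpos : ∀ᶠ q in 𝓝 p, 0 < σ * J q :=
    (continuousAt_const.mul hJs.self_of_nhds.continuousAt).eventually (lt_mem_nhds hσJ)
  obtain ⟨W', hW', hW'o, hpW'⟩ := eventually_nhds_iff.1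
    (hW.and (hx.and (hy.and (hxs.and (hys.and (hJs.and hJpos))))))
  set κ : M → ℝ := fun q => √(σ * J q) with hκ
  have hκ0 : ∀ q ∈ W', 0 < κ q := fun q hq => Real.sqrt_pos.2 (hW' q hq).2.2.2.2.2.2
  have hκ2 : ∀ q ∈ W', κ q * κ q = σ * J q :=
    fun q hq => Real.mul_self_sqrt (hW' q hq).2.2.2.2.2.2.le
  have hκs : ∀ q ∈ W', SmoothFun κ q := fun q hq =>
    smoothFun_comp (f := J) (h := fun t => √(σ * t))
      ((contDiffAt_const.mul contDiffAt_id).sqrt (hW' q hq).2.2.2.2.2.2.ne') (hW' q hq).2.2.2.2.2.1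
  have hκi : ∀ q ∈ W', SmoothFun (fun r => (κ r)⁻¹) q := fun q hq =>
    smoothFun_comp (f := κ) (h := fun t => t⁻¹) (contDiffAt_inv ℝ (hκ0 q hq).ne') (hκs q hq)
  have hsub : W' ⊆ W := fun q hq => (hW' q hq).1
  -- `π` is rescaled by `κ = √(σ J)`; the unprimed frame is the matrix of the differentials, which has
  -- determinant `σ J`, divided by `κ`
  refine ⟨σ, hσ, W', hsub, hpW', fun q => (e q).change
    !![(κ q)⁻¹ * dirD (fun r => e r (1, 1)) x q, (κ q)⁻¹ * (σ * dirD (fun r => e r (1, 1)) y q);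
      -((κ q)⁻¹ * dirD (fun r => e r (0, 1)) x q), -((κ q)⁻¹ * (σ * dirD (fun r => e r (0, 1)) y q))]
    !![κ q, 0; 0, (κ q)⁻¹], ⟨?_, ?_, ?_⟩⟩
  · refine h.change hG hWU hW'o hsub ?_ ?_ ?_ ?_ (fun q _ => contMDiffAt_const) ?_
    · intro q hq A B
      obtain ⟨-, -, -, h1, h2, -, -⟩ := hW' q hq
      have h3 := hκi q hq
      fin_cases A <;> fin_cases B
      · exact h3.mul (h1 _)
      · exact h3.mul (contMDiffAt_const.mul (h2 _))
      · exact (h3.mul (h1 _)).neg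
      · exact (h3.mul (contMDiffAt_const.mul (h2 _))).neg
    · intro q hq A B
      fin_cases A <;> fin_cases B
      · exact hκs q hq
      · exact contMDiffAt_const
      · exact contMDiffAt_const
      · exact hκi q hq
    · intro q hq
      rw [Matrix.det_fin_two_of]
      have h1 := (hκ0 q hq).ne'
      have h2 := hκ2 q hq
      simp only [hJ] at h2
      field_simp
      linear_combination -h2
    · intro q hq
      rw [Matrix.det_fin_two_of, mul_inv_cancel₀ (hκ0 q hq).ne']
      ring
    · intro q hq
      refine ⟨(κ q)⁻¹, inv_ne_zero (hκ0 q hq).ne', ?_⟩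
      funext A
      fin_cases A <;> simp [(hκ0 q hq).ne']
  · intro q hq A
    obtain ⟨-, h1, h2, -⟩ := hW' q hq
    fin_cases A
    · exact h1.1
    · exact contMDiffAt_const.mul h2.1
  · intro q hq A X
    obtain ⟨-, h1, h2, -⟩ := hW' q hq
    have hk := (hκ0 q hq).ne'
    have hs := fun a => hG.symm (hWU (hsub hq)) (e q a) (X q)
    have e1 := hexp x q (hsub hq) h1.2 X
    have e2 := hexp y q (hsub hq) h2.2 X
    have e3 : dirD X (fun q => σ * y q) q = σ * dirD X y q := by
      rw [dirD_mul contMDiffAt_const h2.1, dirD_const]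
      ring
    fin_cases A
    · simp [Tetrad.change, Fin.sum_univ_two, hs, e1]
      field_simp
      ring
    · simp [Tetrad.change, Fin.sum_univ_two, hs, e2, e3]
      field_simp
      ring

/-- In an adapted tetrad all brackets lie in the α-distribution, because the derivatives of `z_A` along
the tetrad fields are constant. -/
lemma IsAdaptedOn.bracketCoeff_eq_zero (hG : G.IsSpinGeometryOn U) {e : ∀ q : M, Tetrad q}
    {z : Fin 2 → M → ℝ} (h : G.IsAdaptedOn W e z) (hWU : W ⊆ U) {q : M} (hq : q ∈ W) (a b : Idx)
    (C : Fin 2) : G.bracketCoeff e a b (C, 0) q = 0 := by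
  have hconst : ∀ b : Idx, dirD (fun r => e r b) (z C) =ᶠ[𝓝 q] fun _ => eta (C, 0) b := by
    intro b
    filter_upwards [h.lsr.isOpen.mem_nhds hq] with r hr
    rw [← h.metric_eq r hr C]
    exact hG.null r (hWU hr) _ (h.lsr.mem_frames hr) _ _
  unfold bracketCoeff
  rw [hG.symm (hWU hq)]
  refine (h.metric_eq q hq C (bracket (fun r => e r a) fun r => e r b)).trans ?_
  rw [dirD_bracket (h.lsr.smoothVec hq a) (h.lsr.smoothVec hq b) (h.smooth q hq C),
    dirD_congr (hconst b), dirD_congr (hconst a), dirD_const, dirD_const, sub_zero]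

/-- The α-plane is spanned by the tetrad vectors `e_{00'}` and `e_{10'}` when the first member of the
primed spin frame represents the projective spinor. -/
lemma IsSpinGeometryOn.vec_eq_comb (hG : G.IsSpinGeometryOn U) {q : M} (hq : q ∈ U) {e e' : Tetrad q}
    (he : e ∈ G.frames q) (he' : e' ∈ G.frames q) {π : Fin 2 → ℝ} (hπ : G.Represents e π)
    (hπ' : G.Represents e' ![1, 0]) (η : Fin 2 → ℝ) :
    ∃ a b : ℝ, e.vec η π = a • e' (0, 0) + b • e' (1, 0) := by
  obtain ⟨L, L', hL, hL', rfl⟩ := (hG.orbit q hq e he e').1 he'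
  have h1 := hG.equivariant q hq e he L L' hL hL' _ hπ'
  obtain ⟨c, -, rfl⟩ := G.represents_unique hπ h1
  have hu : IsUnit L.det := by rw [hL]; exact isUnit_one
  have h2 : e.vec η (c • (L' *ᵥ ![1, 0])) = (e.change L L').vec (L⁻¹ *ᵥ η) (c • ![1, 0]) := by
    rw [Tetrad.vec_change, Matrix.mulVec_mulVec, Matrix.mul_nonsing_inv _ hu, Matrix.one_mulVec,
      Matrix.mulVec_smul]
  refine ⟨(L⁻¹ *ᵥ η) 0 * c, (L⁻¹ *ᵥ η) 1 * c, ?_⟩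
  rw [h2, Tetrad.vec_eq]
  simp

lemma IsSpinGeometryOn.alphaPlane_eq (hG : G.IsSpinGeometryOn U) {q : M} (hq : q ∈ U) {e : Tetrad q}
    (he : e ∈ G.frames q) (hπ : G.Represents e ![1, 0]) :
    G.alphaPlane q = (Submodule.span ℝ {e (0, 0), e (1, 0)} : Set (TangentSpace (𝓡 4) q)) := by
  ext v
  rw [SetLike.mem_coe, Submodule.mem_span_pair]
  constructor
  · rintro ⟨e', he', π, hπ', η, rfl⟩
    obtain ⟨a, b, hab⟩ := hG.vec_eq_comb hq he' he hπ' hπ η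
    exact ⟨a, b, hab.symm⟩
  · rintro ⟨a, b, rfl⟩
    refine ⟨e, he, _, hπ, ![a, b], ?_⟩
    rw [Tetrad.vec_eq]
    simp

end SpinData

/-! ### Curvature in an adapted null tetrad -/

namespace SpinData

section Conn

variable {M : Type*} [TopologicalSpace M] [ChartedSpace E4 M] (G : SpinData M)

lemma conn_zero_zero (e : ∀ q : M, Tetrad q) (a b : Idx) :
    G.conn e a b (0, 0) = G.connLower e a b (1, 1) := by
  funext q
  simp [conn, Fintype.sum_prod_type, eta]

lemma conn_zero_one (e : ∀ q : M, Tetrad q) (a b : Idx) :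
    G.conn e a b (0, 1) = fun q => -G.connLower e a b (1, 0) q := by
  funext q
  simp [conn, Fintype.sum_prod_type, eta]

lemma conn_one_zero (e : ∀ q : M, Tetrad q) (a b : Idx) :
    G.conn e a b (1, 0) = fun q => -G.connLower e a b (0, 1) q := by
  funext q
  simp [conn, Fintype.sum_prod_type, eta]

lemma conn_one_one (e : ∀ q : M, Tetrad q) (a b : Idx) :
    G.conn e a b (1, 1) = G.connLower e a b (0, 0) := by
  funext q
  simp [conn, Fintype.sum_prod_type, eta]

end Conn

variable {M : Type*} [TopologicalSpace M] [ChartedSpace E4 M] [IsManifold (𝓡 4) ∞ M]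
variable {G : SpinData M} {U W : Set M}

lemma IsLSROn.smooth_bracketCoeff (hG : G.IsSpinGeometryOn U) {e : ∀ q : M, Tetrad q}
    {π : M → Fin 2 → ℝ} (h : G.IsLSROn W e π) (hWU : W ⊆ U) {q : M} (hq : q ∈ W) (a b c : Idx) :
    SmoothFun (G.bracketCoeff e a b c) q :=
  hG.smooth_metric (hWU hq) ((h.smoothVec hq a).bracket (h.smoothVec hq b)) (h.smoothVec hq c)

lemma IsLSROn.D_connLower (hG : G.IsSpinGeometryOn U) {e : ∀ q : M, Tetrad q}
    {π : M → Fin 2 → ℝ} (h : G.IsLSROn W e π) (hWU : W ⊆ U) {q : M} (hq : q ∈ W) (a b c d : Idx) :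
    D e a (G.connLower e b c d) q = (D e a (G.bracketCoeff e b c d) q
      - D e a (G.bracketCoeff e c d b) q + D e a (G.bracketCoeff e d b c) q) / 2 := by
  have hs := h.smooth_bracketCoeff hG hWU hq
  have h1 : G.connLower e b c d = fun r => (1 / 2 : ℝ) *
      ((G.bracketCoeff e b c d r - G.bracketCoeff e c d b r) + G.bracketCoeff e d b c r) := by
    funext r
    unfold connLower
    ring
  simp only [D_eq_dirD]
  rw [h1, dirD_mul (f := fun _ => (1 / 2 : ℝ))
    (g := fun r => (G.bracketCoeff e b c d r - G.bracketCoeff e c d b r) + G.bracketCoeff e d b c r)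
    contMDiffAt_const (((hs b c d).sub (hs c d b)).add (hs d b c)), dirD_const,
    dirD_add (f := fun r => G.bracketCoeff e b c d r - G.bracketCoeff e c d b r)
      ((hs b c d).sub (hs c d b)) (hs d b c), dirD_sub (hs b c d) (hs c d b)]
  ring

/-- The equations that the curvature conditions impose on the coefficients of
`[e_{00'}, e_{10'}] = P e_{00'} - N e_{10'}` in an adapted tetrad. -/
theorem IsAdaptedOn.derivative_eqs (hG : G.IsSpinGeometryOn U) (hW : G.IsMultipleWPSOn U)
    (hR : G.IsRPSOn U) {e : ∀ q : M, Tetrad q} {z : Fin 2 → M → ℝ} (h : G.IsAdaptedOn W e z)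
    (hWU : W ⊆ U) {q : M} (hq : q ∈ W) {P N : M → ℝ} (hP : P = G.bracketCoeff e (0, 0) (1, 0) (1, 1))
    (hN : N = G.bracketCoeff e (0, 0) (1, 0) (0, 1)) :
    D e (0, 0) P q = -(P q * N q) / 2 ∧ D e (1, 0) P q = -(P q * P q) / 2 ∧
      D e (0, 0) N q = -(N q * N q) / 2 ∧ D e (1, 0) N q = -(P q * N q) / 2 := by
  have hB0 := fun a b C => h.bracketCoeff_eq_zero hG hWU hq a b C
  have hDB0 : ∀ a b c C, D e a (G.bracketCoeff e b c (C, 0)) q = 0 := by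
    intro a b c C
    rw [D_eq_dirD, dirD_congr (g := fun _ => (0 : ℝ)), dirD_const]
    filter_upwards [h.lsr.isOpen.mem_nhds hq] with r hr
    exact h.bracketCoeff_eq_zero hG hWU hr b c C
  have hBs := fun a b c => bracketCoeff_swap (G := G) e a b c q
  have hDBs : ∀ a b c d, D e a (G.bracketCoeff e c b d) q = -D e a (G.bracketCoeff e b c d) q := by
    intro a b c d
    have : G.bracketCoeff e c b d = fun r => -G.bracketCoeff e b c d r :=
      funext fun r => bracketCoeff_swap e b c d r
    rw [this]
    simp only [D_eq_dirD]
    exact dirD_neg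
  have hDBd : ∀ a b d, D e a (G.bracketCoeff e b b d) q = 0 := by
    intro a b d
    have := hDBs a b b d
    linarith
  have hDneg : ∀ (a : Idx) (f : M → ℝ), D e a (fun r => -f r) q = -D e a f q :=
    fun a f => dirD_neg (X := fun r => e r a)
  have hDc := h.lsr.D_connLower hG hWU hq
  have b2 := hBs (0, 0) (1, 0)
  have hWq := hW W hWU e _ h.lsr q hq 1
  -- contraction with three factors `π` leaves the components with a single index equal to `1`; these
  -- coincide already before the symmetrisation of the curvature spinor
  have hX : ∀ k : Fin 4, G.curvSpinor e (Pi.single k 1) q =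
      -(D e (0, 0) P q - D e (1, 0) N q) / 4 := by
    intro k
    subst hP hN
    fin_cases k <;>
    · simp [curvSpinor, riemLower, riem, Fintype.sum_prod_type, Fin.sum_univ_two, eta,
        conn_zero_zero, conn_zero_one, conn_one_zero, conn_one_one, hDneg, hDc, hDB0, hDBd]
      simp [connLower, hB0, hDBs _ (0, 0) (1, 0), b2]
      ring
  have hX0 : D e (0, 0) P q - D e (1, 0) N q = 0 := by
    have hperm : ∀ σ : Equiv.Perm (Fin 4),
        G.curvSpinor e (![1, 0, 0, 0] ∘ σ) q = -(D e (0, 0) P q - D e (1, 0) N q) / 4 := by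
      intro σ
      rw [← hX (σ.symm 0)]
      congr 1
      funext i
      have h1 : (![1, 0, 0, 0] : Fin 4 → Fin 2) = Pi.single 0 1 := by decide
      rw [h1, Function.comp_apply, Pi.single_apply, Pi.single_apply]
      simp only [Equiv.eq_symm_apply]
    simp [Fin.sum_univ_two, weylSpinor, hperm, Fintype.card_perm, Nat.factorial] at hWq
    linarith
  -- the Ricci condition is the vanishing of `Φ_{AB0'0'}`
  have hΦ : ∀ A B : Fin 2, G.ricciSpinor e A B 0 0 q = 0 := by
    intro A B
    simpa [Fin.sum_univ_two] using hR W hWU e _ h.lsr q hq A B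
  have hR00 := hΦ 0 0
  have hR01 := hΦ 0 1
  have hR11 := hΦ 1 1
  simp [ricciSpinor, riemLower, riem, Fintype.sum_prod_type, Fin.sum_univ_two, eta,
        conn_zero_zero, conn_zero_one, conn_one_zero, conn_one_one, hDneg, hDc, hDB0, hDBd]
    at hR00 hR01 hR11
  simp [connLower, hB0, hDBs _ (0, 0) (1, 0), b2] at hR00 hR01 hR11
  subst hP hN
  refine ⟨?_, ?_, ?_, ?_⟩ <;> linarith

end SpinData

/-! ### Parallel α-distributions -/

variable {M : Type*} [TopologicalSpace M] [ChartedSpace E4 M]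

namespace SpinData

variable (G : SpinData M)

/-- Koszul's expression for `2 h(∇_X Y, Z)`, for fields with `h(Y, Z) = 0`. -/
def koszul (X Y Z : VField M) (q : M) : ℝ :=
  dirD Y (fun r => G.metric r (X r) (Z r)) q - dirD Z (fun r => G.metric r (X r) (Y r)) q
    + G.metric q (bracket X Y q) (Z q) - G.metric q (bracket Y Z q) (X q)
    - G.metric q (bracket X Z q) (Y q)

lemma koszul_congr {X Y Z Y' Z' : VField M} {q : M} (hY : Y =ᶠ[𝓝 q] Y') (hZ : Z =ᶠ[𝓝 q] Z') :
    G.koszul X Y Z q = G.koszul X Y' Z' q := by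
  have h1 : (fun r => G.metric r (X r) (Z r)) =ᶠ[𝓝 q] fun r => G.metric r (X r) (Z' r) := by
    filter_upwards [hZ] with r hr
    rw [hr]
  have h2 : (fun r => G.metric r (X r) (Y r)) =ᶠ[𝓝 q] fun r => G.metric r (X r) (Y' r) := by
    filter_upwards [hY] with r hr
    rw [hr]
  unfold koszul
  rw [dirD_congr h1, dirD_congr h2, dirD_congr_field hY.eq_of_nhds, dirD_congr_field hZ.eq_of_nhds,
    bracket_congr (EventuallyEq.refl _ X) hY, bracket_congr (EventuallyEq.refl _ X) hZ,
    bracket_congr hY hZ, hY.eq_of_nhds, hZ.eq_of_nhds]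

end SpinData

variable [IsManifold (𝓡 4) ∞ M]

lemma bracket_comb_right {X Y Z : VField M} {f g : M → ℝ} {q : M} (hf : SmoothFun f q)
    (hg : SmoothFun g q) (hY : SmoothVec Y q) (hZ : SmoothVec Z q) :
    bracket X (fun r => f r • Y r + g r • Z r) q =
      (dirD X f q • Y q + f q • bracket X Y q) + (dirD X g q • Z q + g q • bracket X Z q) := by
  rw [bracket_add_right (hY.smul hf) (hZ.smul hg), bracket_smul_right hf hY, bracket_smul_right hg hZ]

lemma bracket_comb_left {X Y Z : VField M} {f g : M → ℝ} {q : M} (hf : SmoothFun f q)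
    (hg : SmoothFun g q) (hY : SmoothVec Y q) (hZ : SmoothVec Z q) :
    bracket (fun r => f r • Y r + g r • Z r) X q =
      (-dirD X f q • Y q + f q • bracket Y X q) + (-dirD X g q • Z q + g q • bracket Z X q) := by
  rw [bracket_add_left (hY.smul hf) (hZ.smul hg), bracket_smul_left hf hY, bracket_smul_left hg hZ]

namespace SpinData

variable {G : SpinData M} {U W : Set M}

/-- `2 S_a = 2 h(∇_a (o_1 π), o_0 π)`, by Koszul's formula. -/
lemma IsLSROn.two_mul_S (hG : G.IsSpinGeometryOn U) {e : ∀ q : M, Tetrad q}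
    {π : M → Fin 2 → ℝ} (h : G.IsLSROn W e π) (hWU : W ⊆ U) {q : M} (hq : q ∈ W) (a : Idx) :
    2 * G.S e π a q = G.koszul (fun r => e r a) (fun r => π r 0 • e r (1, 0) + π r 1 • e r (1, 1))
      (fun r => π r 0 • e r (0, 0) + π r 1 • e r (0, 1)) q := by
  have hs := h.smoothVec hq
  have hπ := h.smoothFun hq
  have hn := hG.null q (hWU hq) _ (h.mem_frames hq)
  have hm : ∀ A : Fin 2, (fun r => G.metric r (e r a) (π r 0 • e r (A, 0) + π r 1 • e r (A, 1)))
      =ᶠ[𝓝 q] fun r => π r 0 * eta a (A, 0) + π r 1 * eta a (A, 1) := by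
    intro A
    filter_upwards [h.isOpen.mem_nhds hq] with r hr
    rw [map_add, map_smul, map_smul, hG.null r (hWU hr) _ (h.mem_frames hr),
      hG.null r (hWU hr) _ (h.mem_frames hr)]
    rfl
  have hd : ∀ (X : VField M) (A : Fin 2),
      dirD X (fun r => π r 0 * eta a (A, 0) + π r 1 * eta a (A, 1)) q =
        dirD X (fun r => π r 0) q * eta a (A, 0) + dirD X (fun r => π r 1) q * eta a (A, 1) := by
    intro X A
    rw [dirD_add (f := fun r => π r 0 * eta a (A, 0)) (g := fun r => π r 1 * eta a (A, 1))
      ((hπ 0).mul contMDiffAt_const) ((hπ 1).mul contMDiffAt_const),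
      dirD_mul (hπ 0) contMDiffAt_const, dirD_mul (hπ 1) contMDiffAt_const, dirD_const, dirD_const]
    ring
  have hBs := fun a b c => bracketCoeff_swap (G := G) e a b c q
  have b1 := hBs (0, 0) (0, 1)
  have b2 := hBs (0, 0) (1, 0)
  have b3 := hBs (0, 0) (1, 1)
  have b4 := hBs (0, 1) (1, 0)
  have b5 := hBs (0, 1) (1, 1)
  have b6 := hBs (1, 0) (1, 1)
  have hBm : ∀ a b c, G.metric q (bracket (fun r => e r a) (fun r => e r b) q) (e q c) =
      G.bracketCoeff e a b c q := fun _ _ _ => rfl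
  unfold koszul
  rw [dirD_congr (hm 0), dirD_congr (hm 1), hd, hd, dirD_comb, dirD_comb, dirD_comb, dirD_comb,
    bracket_comb_right (hπ 0) (hπ 1) (hs _) (hs _), bracket_comb_right (hπ 0) (hπ 1) (hs _) (hs _),
    bracket_comb_right (hπ 0) (hπ 1) (hs _) (hs _), bracket_comb_left (hπ 0) (hπ 1) (hs _) (hs _),
    bracket_comb_left (hπ 0) (hπ 1) (hs _) (hs _), dirD_comb, dirD_comb]
  obtain ⟨A, A'⟩ := a
  revert A A'
  simp only [Fin.forall_fin_two]
  refine ⟨⟨?_, ?_⟩, ?_, ?_⟩ <;> intro _ _ <;>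
  · simp [S, covSpinor, spinConn, conn, connLower, Fin.sum_univ_two, Fintype.sum_prod_type, hn, hBm,
      D_eq_dirD, b1, b2, b3, b4, b5, b6]
    simp [eta]
    ring

/-- Koszul's expression for two fields in the α-distribution, in terms of an adapted tetrad: only the
bracket of the two α-vector fields contributes. -/
lemma IsAdaptedOn.koszul_eq (hG : G.IsSpinGeometryOn U) {e : ∀ q : M, Tetrad q}
    {z : Fin 2 → M → ℝ} (h : G.IsAdaptedOn W e z) (hWU : W ⊆ U) {q : M} (hq : q ∈ W) {X : VField M}
    (hX : SmoothVec X q) {a b c d : M → ℝ} (ha : SmoothFun a q) (hb : SmoothFun b q)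
    (hc : SmoothFun c q) (hd : SmoothFun d q) :
    G.koszul X (fun r => a r • e r (0, 0) + b r • e r (1, 0))
      (fun r => c r • e r (0, 0) + d r • e r (1, 0)) q = (b q * c q - a q * d q) *
        G.metric q (bracket (fun r => e r (0, 0)) (fun r => e r (1, 0)) q) (X q) := by
  have hs := h.lsr.smoothVec hq
  have hn : ∀ A B : Fin 2, G.metric q (e q (A, 0)) (e q (B, 0)) = 0 := by
    intro A B
    rw [hG.null q (hWU hq) _ (h.lsr.mem_frames hq)]
    simp [eta]
  have hzs : ∀ A, SmoothFun (dirD X (z A)) q := fun A => (h.smooth q hq A).dirD hX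
  have hm : ∀ f g : M → ℝ, (fun r => G.metric r (X r) (f r • e r (0, 0) + g r • e r (1, 0)))
      =ᶠ[𝓝 q] fun r => f r * dirD X (z 0) r + g r * dirD X (z 1) r := by
    intro f g
    filter_upwards [h.lsr.isOpen.mem_nhds hq] with r hr
    rw [map_add, map_smul, map_smul, hG.symm (hWU hr), hG.symm (hWU hr) (X r), h.metric_eq r hr,
      h.metric_eq r hr]
    rfl
  have hD : ∀ (Y : VField M) {f g : M → ℝ}, SmoothFun f q → SmoothFun g q →
      dirD Y (fun r => f r * dirD X (z 0) r + g r * dirD X (z 1) r) q =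
        (f q * dirD Y (dirD X (z 0)) q + dirD X (z 0) q * dirD Y f q)
          + (g q * dirD Y (dirD X (z 1)) q + dirD X (z 1) q * dirD Y g q) := by
    intro Y f g hf hg
    rw [dirD_add (f := fun r => f r * dirD X (z 0) r) (g := fun r => g r * dirD X (z 1) r)
      (hf.mul (hzs 0)) (hg.mul (hzs 1)), dirD_mul hf (hzs 0), dirD_mul hg (hzs 1)]
  have hbr : ∀ A B : Fin 2, G.metric q (bracket X (fun r => e r (A, 0)) q) (e q (B, 0)) =
      -dirD (fun r => e r (A, 0)) (dirD X (z B)) q := by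
    intro A B
    have hconst : dirD (fun r => e r (A, 0)) (z B) =ᶠ[𝓝 q] fun _ => 0 := by
      filter_upwards [h.lsr.isOpen.mem_nhds hq] with r hr
      rw [← h.metric_eq r hr, hG.null r (hWU hr) _ (h.lsr.mem_frames hr)]
      simp [eta]
    rw [hG.symm (hWU hq), h.metric_eq q hq, dirD_bracket hX (hs _) (h.smooth q hq B),
      dirD_congr hconst, dirD_const, zero_sub]
  have hXe : ∀ A : Fin 2, G.metric q (e q (A, 0)) (X q) = dirD X (z A) q :=
    fun A => h.metric_eq q hq A X
  have hsw := bracket_swap (fun r => e r (1, 0)) (fun r => e r (0, 0)) q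
  unfold koszul
  rw [dirD_congr (hm a b), dirD_congr (hm c d), hD _ ha hb, hD _ hc hd,
    bracket_comb_right ha hb (hs _) (hs _), bracket_comb_right hc hd (hs _) (hs _),
    bracket_comb_right hc hd (hs _) (hs _), bracket_comb_left ha hb (hs _) (hs _),
    bracket_comb_left ha hb (hs _) (hs _), hsw]
  simp [dirD_comb, hn, hbr, hXe, bracket_self]
  ring

/-- The α-distribution is parallel where the two α-vector fields of an adapted tetrad commute. -/
theorem IsAdaptedOn.isParallelAt (hG : G.IsSpinGeometryOn U) {e : ∀ q : M, Tetrad q}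
    {z : Fin 2 → M → ℝ} (h : G.IsAdaptedOn W e z) (hWU : W ⊆ U) {q : M} (hq : q ∈ W)
    (h0 : bracket (fun r => e r (0, 0)) (fun r => e r (1, 0)) q = 0) : G.IsParallelAt q := by
  intro V hV e' π hl a
  have hl' := hl.mono (hl.isOpen.inter h.lsr.isOpen) Set.inter_subset_left
  set V' := V ∩ W
  have hq' : q ∈ V' := ⟨hV, hq⟩
  have hVU : V' ⊆ U := fun r hr => hWU hr.2
  set Y : Fin 2 → VField M := fun A r => π r 0 • e' r (A, 0) + π r 1 • e' r (A, 1) with hY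
  have hYs : ∀ A, SmoothVec (Y A) q := fun A =>
    SmoothVec.comb (hl.smoothFun hV 0) (hl.smoothFun hV 1) (hl.smoothVec hV _) (hl.smoothVec hV _)
  have hYe : ∀ A, Y A =ᶠ[𝓝 q] fun r => G.metric r (Y A r) (e r (1, 1)) • e r (0, 0)
      + (-G.metric r (Y A r) (e r (0, 1))) • e r (1, 0) := by
    intro A
    filter_upwards [hl'.isOpen.mem_nhds hq'] with r hr
    have hn := hG.null r (hVU hr) _ (h.lsr.mem_frames hr.2)
    obtain ⟨c, d, hcd⟩ := hG.vec_eq_comb (hVU hr) (hl'.mem_frames hr) (h.lsr.mem_frames hr.2)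
      (hl'.2.2 r hr) (h.lsr.2.2 r hr.2) (Pi.single A 1)
    have h1 : Y A r = c • e r (0, 0) + d • e r (1, 0) := by
      rw [← hcd, Tetrad.vec_eq]
      revert A
      simp [hY, Fin.forall_fin_two]
    rw [h1]
    simp [hn, eta]
    rfl
  have hc : ∀ A, SmoothFun (fun r => G.metric r (Y A r) (e r (1, 1))) q :=
    fun A => hG.smooth_metric (hWU hq) (hYs A) (h.lsr.smoothVec hq _)
  have hd : ∀ A, SmoothFun (fun r => -G.metric r (Y A r) (e r (0, 1))) q :=
    fun A => (hG.smooth_metric (hWU hq) (hYs A) (h.lsr.smoothVec hq _)).neg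
  have h2 := hl'.two_mul_S hG hVU hq' a
  rw [G.koszul_congr (hYe 1) (hYe 0), h.koszul_eq hG hWU hq (hl.smoothVec hV a) (hc 1) (hd 1) (hc 0)
    (hd 0), h0, map_zero] at h2
  simpa using h2

end SpinData

/-! ### Conformal rescaling -/

variable {M : Type*} [TopologicalSpace M] [ChartedSpace E4 M]

lemma Tetrad.change_smul {q : M} (e : Tetrad q) (c : ℝ) (L L' : Matrix (Fin 2) (Fin 2) ℝ) :
    (fun a => c • e.change L L' a) = Tetrad.change (fun a => c • e a : Tetrad q) L L' := by
  funext a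
  simp only [Tetrad.change, Fin.sum_univ_two]
  module

namespace SpinData

variable [IsManifold (𝓡 4) ∞ M] {G : SpinData M} {U W : Set M}

/-- The conformally rescaled tetrad carries the same primed spinor components. -/
lemma IsLSROn.rescale {e : ∀ q : M, Tetrad q} {π : M → Fin 2 → ℝ} (h : G.IsLSROn W e π) {χ : M → ℝ}
    (hχ : ∀ q ∈ W, SmoothFun χ q) (hχ0 : ∀ q ∈ W, 0 < χ q) :
    (G.rescale χ).IsLSROn W (fun q a => (χ q)⁻¹ • e q a) π := by
  have hback : ∀ q ∈ W, (fun a => χ q • (χ q)⁻¹ • e q a) = e q := by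
    intro q hq
    funext a
    rw [smul_smul, mul_inv_cancel₀ (hχ0 q hq).ne', one_smul]
  refine ⟨⟨h.isOpen, fun a q hq => ?_, fun q hq => ?_⟩, h.2.1, fun q hq => ?_⟩
  · have h1 : SmoothFun (fun r => (χ r)⁻¹) q :=
      smoothFun_comp (f := χ) (h := fun t => t⁻¹) (contDiffAt_inv ℝ (hχ0 q hq).ne') (hχ q hq)
    exact ((h.smoothVec hq a).smul h1).contMDiffWithinAt
  · change (fun a => χ q • (χ q)⁻¹ • e q a) ∈ G.frames q
    rw [hback q hq]
    exact h.mem_frames hq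
  · obtain ⟨h1, h2⟩ := h.2.2 q hq
    refine ⟨h1, ?_⟩
    change G.proj q (fun a => χ q • (χ q)⁻¹ • e q a) = _
    rw [hback q hq, h2]

lemma IsSpinGeometryOn.rescale (hG : G.IsSpinGeometryOn U) {U' : Set M} (hU' : IsOpen U')
    (hsub : U' ⊆ U) {χ : M → ℝ} (hχ : ∀ q ∈ U', SmoothFun χ q) (hχ0 : ∀ q ∈ U', 0 < χ q) :
    (G.rescale χ).IsSpinGeometryOn U' where
  isOpen := hU'
  neutral := by
    refine ⟨fun q hq => ?_, fun q hq => ⟨fun v w => ?_, ?_⟩⟩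
    · have h1 := (hG.neutral.1 q (hsub hq)).contMDiffAt (hG.isOpen.mem_nhds (hsub hq))
      exact (ContMDiffAt.smul_section ((hχ q hq).pow 2) h1).contMDiffWithinAt
    · change χ q ^ 2 * G.metric q v w = χ q ^ 2 * G.metric q w v
      rw [hG.symm (hsub hq)]
    · obtain ⟨b, hb⟩ := (hG.neutral.2 q (hsub hq)).2
      refine ⟨b.unitsSMul fun _ => (Units.mk0 (χ q) (hχ0 q hq).ne')⁻¹, fun i j => ?_⟩
      rw [← hb i j, Module.Basis.unitsSMul_apply, Module.Basis.unitsSMul_apply]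
      have h0 := (hχ0 q hq).ne'
      change χ q ^ 2 * G.metric q ((χ q)⁻¹ • b i) ((χ q)⁻¹ • b j) = _
      rw [map_smul, map_smul]
      change χ q ^ 2 * ((χ q)⁻¹ * ((χ q)⁻¹ * G.metric q (b i) (b j))) = _
      field_simp
  null := by
    intro q hq e he a b
    rw [← hG.null q (hsub hq) _ he a b, map_smul, map_smul]
    change χ q ^ 2 * G.metric q (e a) (e b) = χ q * (χ q * G.metric q (e a) (e b))
    ring
  orbit := by
    intro q hq e he e'
    refine (hG.orbit q (hsub hq) _ he _).trans ?_
    refine exists_congr fun L => exists_congr fun L' => and_congr_right fun _ =>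
      and_congr_right fun _ => ?_
    rw [← Tetrad.change_smul]
    constructor
    · intro h
      funext a
      exact smul_right_injective _ (hχ0 q hq).ne' (congrFun h a)
    · rintro rfl
      rfl
  equivariant := by
    intro q hq e he L L' hL hL' π hπ
    refine hG.equivariant q (hsub hq) _ he L L' hL hL' π ?_
    obtain ⟨h1, h2⟩ := hπ
    refine ⟨h1, ?_⟩
    rw [← Tetrad.change_smul]
    exact h2
  smooth := by
    intro q hq
    obtain ⟨W, hWU, hqW, e, π, h⟩ := hG.smooth q (hsub hq)
    have h1 := h.mono (h.isOpen.inter hU') Set.inter_subset_left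
    exact ⟨W ∩ U', Set.inter_subset_right, ⟨hqW, hq⟩, _, π,
      h1.rescale (fun r hr => hχ r hr.2) fun r hr => hχ0 r hr.2⟩

end SpinData

/-! ### Walker charts -/

variable {M : Type*} [TopologicalSpace M] [ChartedSpace E4 M]

lemma smoothFun_euclidean {u : Fin 4 → M → ℝ} {q : M} (hu : ∀ i, SmoothFun (u i) q) :
    SmoothFun (fun r => (WithLp.toLp 2 fun i => u i r : E4)) q :=
  smoothFun_comp (h := fun v : Fin 4 → ℝ => (WithLp.toLp 2 v : E4))
    (EuclideanSpace.equiv (Fin 4) ℝ).symm.contDiff.contDiffAt (contMDiffAt_pi_space.2 hu)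

lemma dirD_euclidean {u : Fin 4 → M → ℝ} {q : M} (hu : ∀ i, SmoothFun (u i) q) (X : VField M)
    (i : Fin 4) : dirD X (fun r => (WithLp.toLp 2 fun i => u i r : E4)) q i = dirD X (u i) q :=
  (dirD_clm (X := X) (EuclideanSpace.proj i : E4 →L[ℝ] ℝ)
    (smoothFun_euclidean hu)).symm

/-- The coordinate fields of a chart are characterised by the derivatives of the coordinates. -/
lemma mfderiv_coordVec {φ : OpenPartialHomeomorph M E4}
    (hφ : φ ∈ IsManifold.maximalAtlas (𝓡 4) ∞ M) {q : M} (hq : q ∈ φ.source) :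
    (∀ i, mfderiv (𝓡 4) 𝓘(ℝ, E4) φ q (SpinData.coordVec φ i q) = EuclideanSpace.single i (1 : ℝ)) ∧
      ∀ (v : TangentSpace (𝓡 4) q) (i : Fin 4),
        mfderiv (𝓡 4) 𝓘(ℝ, E4) φ q v = EuclideanSpace.single i (1 : ℝ) →
          SpinData.coordVec φ i q = v := by
  have hd : φ.MDifferentiable (𝓡 4) 𝓘(ℝ, E4) :=
    ⟨(contMDiffOn_of_mem_maximalAtlas hφ).mdifferentiableOn (by simp),
      (contMDiffOn_symm_of_mem_maximalAtlas hφ).mdifferentiableOn (by simp)⟩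
  let A : TangentSpace (𝓡 4) q ≃L[ℝ] E4 := hd.mfderiv hq
  have hA : mfderiv (𝓡 4) 𝓘(ℝ, E4) φ q = (A : TangentSpace (𝓡 4) q →L[ℝ] E4) := rfl
  have hc : ∀ i, SpinData.coordVec φ i q = A.symm (EuclideanSpace.single i (1 : ℝ)) := by
    intro i
    exact DFunLike.congr_fun (ContinuousLinearMap.inverse_equiv A) (EuclideanSpace.single i (1 : ℝ))
  refine ⟨fun i => ?_, fun v i hv => ?_⟩
  · rw [hc, hA]
    exact A.apply_symm_apply _
  · rw [hc, ← hv]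
    exact A.symm_apply_apply v

variable [IsManifold (𝓡 4) ∞ M]

/-- Local coordinates in `ℝ⁴` are given by a chart of the maximal atlas, whose domain may be taken
inside a given neighbourhood. -/
lemma IsCoordAt.exists_chart {y : M → E4} {p : M} (hy : IsCoordAt y p) {s : Set M} (hs : s ∈ 𝓝 p) :
    ∃ φ ∈ IsManifold.maximalAtlas (𝓡 4) ∞ M, p ∈ φ.source ∧ φ.source ⊆ s ∧
      ∀ q ∈ φ.source, φ q = y q := by
  obtain ⟨φ, hp, hφ, hφs, hφt⟩ := hy.exists_openPartialHomeomorph (by simp)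
  refine ⟨φ.restr s, OpenPartialHomeomorph.mem_maximalAtlas_of_contMDiffOn _ ?_ ?_, ?_, ?_, ?_⟩
  · intro q hq
    have hq' : q ∈ φ.source := φ.restr_source s ▸ hq |>.1
    refine ContMDiffAt.contMDiffWithinAt ((hφs q hq').congr_of_eventuallyEq ?_)
    filter_upwards [φ.open_source.mem_nhds hq'] with r hr
    exact hφ r hr
  · intro w hw
    have hw' : w ∈ φ.target := by
      have := hw
      simp only [OpenPartialHomeomorph.restr, mfld_simps] at this
      exact this.1
    exact (hφt w hw').contMDiffWithinAt
  · rw [φ.restr_source s]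
    exact ⟨hp, mem_interior_iff_mem_nhds.2 hs⟩
  · rw [φ.restr_source s]
    exact fun q hq => interior_subset hq.2
  · intro q hq
    rw [φ.restr_source s] at hq
    exact hφ q hq.1

namespace SpinData

variable {G : SpinData M} {U W : Set M}

/-- An adapted tetrad for functions `z_0, z_1`, together with leaf coordinates `u_0, u_1` dual to its
α-vector fields, gives oriented Walker coordinates `(u_0, u_1, z_0, z_1)`. -/
theorem IsAdaptedOn.exists_orientedWalkerChart (hG : G.IsSpinGeometryOn U) {e : ∀ q : M, Tetrad q}
    {z : Fin 2 → M → ℝ} (h : G.IsAdaptedOn W e z) (hWU : W ⊆ U) {p : M} (hp : p ∈ W)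
    {u : Fin 2 → M → ℝ} (hu : ∀ᶠ q in 𝓝 p, ∀ A, SmoothFun (u A) q ∧
      ∀ B : Fin 2, dirD (fun r => e r (B, 0)) (u A) q = if A = B then 1 else 0)
    {s : Set M} (hs : s ∈ 𝓝 p) :
    ∃ φ : OpenPartialHomeomorph M E4, p ∈ φ.source ∧ φ.source ⊆ s ∧
      (∀ q ∈ φ.source, φ q 0 = u 0 q ∧ φ q 1 = u 1 q) ∧ G.IsOrientedWalkerChart φ := by
  set y : Fin 4 → M → ℝ := ![u 0, u 1, z 0, z 1] with hy
  have hys : ∀ q ∈ W, (∀ A, SmoothFun (u A) q) → ∀ i, SmoothFun (y i) q := by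
    intro q hq h1 i
    fin_cases i
    · exact h1 0
    · exact h1 1
    · exact h.smooth q hq 0
    · exact h.smooth q hq 1
  have hnull : ∀ q ∈ W, ∀ a b, G.metric q (e q a) (e q b) = eta a b :=
    fun q hq => hG.null q (hWU hq) _ (h.lsr.mem_frames hq)
  have hze : ∀ q ∈ W, ∀ A B : Fin 2, dirD (fun r => e r (B, 0)) (z A) q = 0 := by
    intro q hq A B
    rw [← h.metric_eq q hq, hnull q hq]
    simp [eta]
  have hcoord : IsCoordAt (fun r => (WithLp.toLp 2 fun i => y i r : E4)) p := by
    refine ⟨?_, fun X hX => ?_⟩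
    · filter_upwards [hu, h.lsr.isOpen.mem_nhds hp] with q h1 h2
      exact smoothFun_euclidean (hys q h2 fun A => (h1 A).1)
    · have hu' := hu.self_of_nhds
      have hd : ∀ i, dirD X (y i) p = 0 := by
        intro i
        rw [← dirD_euclidean (hys p hp fun A => (hu' A).1), hX]
        rfl
      have h2 : G.metric p (X p) (e p (0, 0)) = 0 := by
        rw [hG.symm (hWU hp), h.metric_eq p hp]
        exact hd 2
      have h3 : G.metric p (X p) (e p (1, 0)) = 0 := by
        rw [hG.symm (hWU hp), h.metric_eq p hp]
        exact hd 3
      have hX1 := G.tetrad_expand (hnull p hp) (X p)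
      rw [h2, h3, neg_zero, zero_smul, zero_smul, add_zero, add_zero] at hX1
      have hX2 : ∀ A, dirD X (u A) p = G.metric p (X p) (e p (1, 1)) * (if A = 0 then 1 else 0)
          + -G.metric p (X p) (e p (0, 1)) * (if A = 1 then 1 else 0) := by
        intro A
        rw [← (hu' A).2, ← (hu' A).2]
        have := dirD_comb (fun r => e r (0, 0)) (fun r => e r (1, 0))
          (fun r => G.metric r (X r) (e r (1, 1))) (fun r => -G.metric r (X r) (e r (0, 1))) (u A) p
        rw [dirD_congr_field (Y := X) hX1.symm] at this
        exact this
      have h4 := (hX2 0).symm.trans (hd 0)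
      have h5 := (hX2 1).symm.trans (hd 1)
      simp at h4 h5
      rw [hX1, h4, h5]
      simp
  obtain ⟨φ, hφ, hpφ, hsub, hφy⟩ := hcoord.exists_chart
    (inter_mem (inter_mem hs (h.lsr.isOpen.mem_nhds hp)) hu)
  have hW : φ.source ⊆ W := fun q hq => (hsub hq).1.2
  have hu' : ∀ q ∈ φ.source, ∀ A, SmoothFun (u A) q ∧
      ∀ B : Fin 2, dirD (fun r => e r (B, 0)) (u A) q = if A = B then 1 else 0 :=
    fun q hq => (hsub hq).2
  have hφd : ∀ q ∈ φ.source, ∀ (X : VField M) (i : Fin 4),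
      dirD X (φ : M → E4) q i = dirD X (y i) q := by
    intro q hq X i
    rw [← dirD_euclidean (hys q (hW hq) fun A => (hu' q hq A).1)]
    refine congrArg (fun v : E4 => v i) (dirD_congr (X := X) ?_)
    filter_upwards [φ.open_source.mem_nhds hq] with r hr
    exact hφy r hr
  have hcv : ∀ q ∈ φ.source, coordVec φ 0 q = e q (0, 0) ∧ coordVec φ 1 q = e q (1, 0) := by
    intro q hq
    have h0 := fun A => (hu' q hq A).2
    have hz0 := hze q (hW hq)
    constructor
    · refine (mfderiv_coordVec hφ hq).2 _ 0 ?_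
      refine PiLp.ext fun i => ?_
      refine (hφd q hq (fun r => e r (0, 0)) i).trans ?_
      fin_cases i <;> simp [hy, h0, hz0]
    · refine (mfderiv_coordVec hφ hq).2 _ 1 ?_
      refine PiLp.ext fun i => ?_
      refine (hφd q hq (fun r => e r (1, 0)) i).trans ?_
      fin_cases i <;> simp [hy, h0, hz0]
  refine ⟨φ, hpφ, fun q hq => (hsub hq).1.1, fun q hq => by rw [hφy q hq]; exact ⟨rfl, rfl⟩,
    ⟨hφ, fun q hq => ?_, fun q => G.metric q (coordVec φ 2 q) (coordVec φ 2 q),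
      fun q => G.metric q (coordVec φ 3 q) (coordVec φ 3 q),
      fun q => G.metric q (coordVec φ 2 q) (coordVec φ 3 q), fun q hq i j => ?_⟩,
    fun q hq => ⟨φ.source, le_rfl, hq, e, _, h.lsr.mono φ.open_source hW, fun r hr => ?_⟩⟩
  · rw [(hcv q hq).1, (hcv q hq).2]
    exact hG.alphaPlane_eq (hWU (hW hq)) (h.lsr.mem_frames (hW hq)) (h.lsr.2.2 q (hW hq))
  · have hsymm := hG.symm (hWU (hW hq))
    have h1 : ∀ j, G.metric q (coordVec φ 0 q) (coordVec φ j q) =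
        (EuclideanSpace.single j (1 : ℝ) : E4) 2 := by
      intro j
      rw [(hcv q hq).1, h.metric_eq q (hW hq) 0 (coordVec φ j), ← (mfderiv_coordVec hφ hq).1 j]
      exact (hφd q hq (coordVec φ j) 2).symm
    have h2 : ∀ j, G.metric q (coordVec φ 1 q) (coordVec φ j q) =
        (EuclideanSpace.single j (1 : ℝ) : E4) 3 := by
      intro j
      rw [(hcv q hq).2, h.metric_eq q (hW hq) 1 (coordVec φ j), ← (mfderiv_coordVec hφ hq).1 j]
      exact (hφd q hq (coordVec φ j) 3).symm
    have h1' := fun j => (hsymm (coordVec φ j q) _).trans (h1 j)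
    have h2' := fun j => (hsymm (coordVec φ j q) _).trans (h2 j)
    have h3 := hsymm (coordVec φ 3 q) (coordVec φ 2 q)
    fin_cases i <;> fin_cases j <;> simp [h1, h2, h1', h2', h3]
  · rw [(hcv r hr).1, (hcv r hr).2, Tetrad.vec_eq, Tetrad.vec_eq]
    simp

end SpinData

/-! ### The conformal factor -/

variable {M : Type*} [TopologicalSpace M] [ChartedSpace E4 M]

/-- The differential of local coordinates is surjective. -/
lemma IsCoordAt.exists_dirD_eq {E : Type} [NormedAddCommGroup E] [NormedSpace ℝ E]
    [FiniteDimensional ℝ E] (hE : Module.finrank ℝ E = 4) {y : M → E} {p : M} (hy : IsCoordAt y p)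
    (v : E) : ∃ X : VField M, dirD X y p = v := by
  let L : E4 →ₗ[ℝ] E := (mfderiv (𝓡 4) 𝓘(ℝ, E) y p).toLinearMap
  have hinj : Function.Injective L := by
    rw [injective_iff_map_eq_zero]
    exact fun w hw => hy.2 (fun _ => w) hw
  have hsurj : Function.Surjective L :=
    (LinearMap.injective_iff_surjective_of_finrank_eq_finrank (by simp [hE])).1 hinj
  obtain ⟨w, hw⟩ := hsurj v
  exact ⟨fun _ => w, hw⟩

namespace SpinData

lemma linearIndependent_pair {G : SpinData M} {q : M} {e : Tetrad q}
    (he : ∀ a b, G.metric q (e a) (e b) = eta a b) :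
    LinearIndependent ℝ ![e (0, 0), e (1, 0)] := by
  rw [LinearIndependent.pair_iff]
  intro s t hst
  have h1 : ∀ b, G.metric q (s • e (0, 0) + t • e (1, 0)) (e b) = 0 := by
    intro b
    rw [hst, map_zero]
    rfl
  have h2 := h1 (1, 1)
  have h3 := h1 (0, 1)
  simp [he, eta] at h2 h3
  exact ⟨h2, h3⟩

variable [IsManifold (𝓡 4) ∞ M] {G : SpinData M} {U W : Set M}

/-- An integrable α-distribution has adapted tetrads; their functions `z_A` are, up to sign, the last
two of a system of Frobenius coordinates. -/
theorem IsIntegrableOn.exists_adapted (hG : G.IsSpinGeometryOn U) (hint : G.IsIntegrableOn U) {p : M}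
    (hp : p ∈ U) : ∃ (y : M → ℝ × ℝ × ℝ × ℝ) (σ : ℝ) (W : Set M) (e : ∀ q : M, Tetrad q),
      IsCoordAt y p ∧ (σ = 1 ∨ σ = -1) ∧ W ⊆ U ∧ p ∈ W ∧
      G.IsAdaptedOn W e ![fun q => (y q).2.2.1, fun q => σ * (y q).2.2.2] ∧
      ∃ α β : VField M, (∀ᶠ q in 𝓝 p, dirD α y q = (1, 0, 0, 0) ∧
          ∃ b c : ℝ, c ≠ 0 ∧ dirD β y q = (b, c, 0, 0)) ∧
        ∀ q ∈ W, (∃ a b : ℝ, α q = a • e q (0, 0) + b • e q (1, 0)) ∧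
          ∃ a b : ℝ, β q = a • e q (0, 0) + b • e q (1, 0) := by
  obtain ⟨W₀, hW₀U, hpW₀, e₀, π₀, h₀⟩ := hG.smooth p hp
  obtain ⟨e, h⟩ := h₀.exists_normalized hG hW₀U
  have hW : ∀ᶠ q in 𝓝 p, q ∈ W₀ := h.isOpen.mem_nhds hpW₀
  obtain ⟨y, hy, hαβ⟩ := exists_frobenius_coordinates (α := fun q => e q (0, 0))
    (β := fun q => e q (1, 0)) (hW.mono fun q hq => h.smoothVec hq _)
    (hW.mono fun q hq => h.smoothVec hq _)
    (linearIndependent_pair (hG.null p hp _ (h.mem_frames hpW₀)))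
    (hW.mono fun q hq => ⟨_, _, h.bracket_eq hG hint hW₀U hq⟩)
  let ℓ₁ : ℝ × ℝ × ℝ × ℝ →L[ℝ] ℝ := (ContinuousLinearMap.fst ℝ ℝ ℝ).comp
    ((ContinuousLinearMap.snd ℝ ℝ (ℝ × ℝ)).comp (ContinuousLinearMap.snd ℝ ℝ (ℝ × ℝ × ℝ)))
  let ℓ₂ : ℝ × ℝ × ℝ × ℝ →L[ℝ] ℝ := (ContinuousLinearMap.snd ℝ ℝ ℝ).comp
    ((ContinuousLinearMap.snd ℝ ℝ (ℝ × ℝ)).comp (ContinuousLinearMap.snd ℝ ℝ (ℝ × ℝ × ℝ)))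
  have hleaf : ∀ ℓ : ℝ × ℝ × ℝ × ℝ →L[ℝ] ℝ, (∀ b c : ℝ, ℓ (b, c, 0, 0) = 0) →
      ∀ᶠ q in 𝓝 p, SmoothFun (fun r => ℓ (y r)) q ∧
        ∀ A : Fin 2, dirD (fun r => e r (A, 0)) (fun r => ℓ (y r)) q = 0 := by
    intro ℓ hℓ
    filter_upwards [hy.1, hαβ] with q h1 ⟨h2, b, c, _, h3⟩
    refine ⟨smoothFun_comp ℓ.contDiff.contDiffAt h1, ?_⟩
    rw [Fin.forall_fin_two, dirD_clm ℓ h1, dirD_clm ℓ h1, h2, h3]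
    exact ⟨hℓ 1 0, hℓ b c⟩
  obtain ⟨σ, hσ, W, hWW₀, hpW, e', h'⟩ := NeutralSpin.SpinData.exists_adapted hG h hW₀U hpW₀
    (hleaf ℓ₁ fun _ _ => rfl) (hleaf ℓ₂ fun _ _ => rfl) (by
      intro c d
      obtain ⟨X, hX⟩ := hy.exists_dirD_eq finrank_prod_four (0, 0, c, d)
      refine ⟨X, ?_, ?_⟩ <;> rw [dirD_clm _ hy.1.self_of_nhds, hX] <;> rfl)
  have hcomb : ∀ q ∈ W, ∀ A : Fin 2, ∃ a b : ℝ, e q (A, 0) = a • e' q (0, 0) + b • e' q (1, 0) := by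
    intro q hq A
    obtain ⟨a, b, hab⟩ := hG.vec_eq_comb (hW₀U (hWW₀ hq)) (h.mem_frames (hWW₀ hq))
      (h'.lsr.mem_frames hq) (h.2.2 q (hWW₀ hq)) (h'.lsr.2.2 q hq) (Pi.single A 1)
    refine ⟨a, b, ?_⟩
    rw [← hab, Tetrad.vec_eq]
    revert A
    simp [Fin.forall_fin_two]
  exact ⟨y, σ, W, e', hy, hσ, hWW₀.trans hW₀U, hpW, h', _, _, hαβ,
    fun q hq => ⟨hcomb q hq 0, hcomb q hq 1⟩⟩

/-- The inverse conformal factor `w` near a point. With `f = w⁻²`, the α-vector fields `f e_{00'}` and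
`f e_{10'}` commute, and the derivatives of `w` along them are constant on the leaves. -/
theorem IsAdaptedOn.exists_conformalFactor (hG : G.IsSpinGeometryOn U) (hint : G.IsIntegrableOn U)
    (hW : G.IsMultipleWPSOn U) (hR : G.IsRPSOn U) {e : ∀ q : M, Tetrad q} {z : Fin 2 → M → ℝ}
    (h : G.IsAdaptedOn W e z) (hWU : W ⊆ U) {p : M} (hp : p ∈ W) :
    ∃ w f : M → ℝ, (∀ᶠ q in 𝓝 p, (SmoothFun w q ∧ SmoothFun f q) ∧ (0 < w q ∧ 0 < f q) ∧
        w q ^ 2 * f q = 1 ∧ bracket (fun r => f r • e r (0, 0)) (fun r => f r • e r (1, 0)) q = 0 ∧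
        ∀ A B : Fin 2, dirD (fun r => e r (B, 0))
          (fun r => f r * dirD (fun r => e r (A, 0)) w r) q = 0) ∧
      ((∀ A : Fin 2, f p * dirD (fun r => e r (A, 0)) w p = 0) →
        bracket (fun r => e r (0, 0)) (fun r => e r (1, 0)) p = 0) := by
  have hWn : ∀ᶠ q in 𝓝 p, q ∈ W := h.lsr.isOpen.mem_nhds hp
  set P := G.bracketCoeff e (0, 0) (1, 0) (1, 1) with hP
  set N := G.bracketCoeff e (0, 0) (1, 0) (0, 1) with hN
  have hPs : ∀ q ∈ W, SmoothFun P q := fun q hq => h.lsr.smooth_bracketCoeff hG hWU hq _ _ _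
  have hNs : ∀ q ∈ W, SmoothFun N q := fun q hq => h.lsr.smooth_bracketCoeff hG hWU hq _ _ _
  have hbr : ∀ q ∈ W, bracket (fun r => e r (0, 0)) (fun r => e r (1, 0)) q =
      P q • e q (0, 0) + (-N q) • e q (1, 0) := fun q hq => h.lsr.bracket_eq hG hint hWU hq
  have heq : ∀ q ∈ W, dirD (fun r => e r (0, 0)) P q = -(P q * N q) / 2 ∧
      dirD (fun r => e r (1, 0)) P q = -(P q * P q) / 2 ∧
      dirD (fun r => e r (0, 0)) N q = -(N q * N q) / 2 ∧
      dirD (fun r => e r (1, 0)) N q = -(P q * N q) / 2 :=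
    fun q hq => h.derivative_eqs hG hW hR hWU hq hP hN
  obtain ⟨u, hu⟩ := exists_leafwise_primitive (α := fun r => e r (0, 0)) (β := fun r => e r (1, 0))
    (hWn.mono fun q hq => h.lsr.smoothVec hq _) (hWn.mono fun q hq => h.lsr.smoothVec hq _)
    (linearIndependent_pair (hG.null p (hWU hp) _ (h.lsr.mem_frames hp)))
    (hWn.mono hNs) (hWn.mono hPs) (hWn.mono fun q hq => ⟨P q, -N q, hbr q hq, by
      rw [(heq q hq).1, (heq q hq).2.2.2]
      ring⟩)
  -- `f = exp u` and `w = exp (-u / 2)`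
  have hexp : ∀ (c : ℝ) (q : M), SmoothFun u q → SmoothFun (fun r => Real.exp (c * u r)) q ∧
      ∀ X : VField M, dirD X (fun r => Real.exp (c * u r)) q
        = Real.exp (c * u q) * c * dirD X u q := by
    intro c q hq
    refine ⟨smoothFun_comp (f := u) (h := fun t => Real.exp (c * t)) (by fun_prop) hq, fun X => ?_⟩
    exact dirD_real_comp (h := fun t => Real.exp (c * t))
      (by simpa using ((hasDerivAt_id (u q)).const_mul c).exp) hq
  have hprod : ∀ q, Real.exp (1 * u q) * Real.exp (-1 / 2 * u q) = Real.exp (1 / 2 * u q) := by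
    intro q
    rw [← Real.exp_add]
    ring_nf
  -- the derivatives of `w` along `f e_{A0'}`
  have hκ : ∀ q, SmoothFun u q ∧ dirD (fun r => e r (0, 0)) u q = N q ∧
      dirD (fun r => e r (1, 0)) u q = P q → ∀ A : Fin 2,
      Real.exp (1 * u q) * dirD (fun r => e r (A, 0)) (fun r => Real.exp (-1 / 2 * u r)) q =
        -1 / 2 * (![N, P] A q * Real.exp (1 / 2 * u q)) := by
    intro q h1
    rw [Fin.forall_fin_two, (hexp _ q h1.1).2, (hexp _ q h1.1).2, h1.2.1, h1.2.2, ← hprod]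
    constructor
    · change _ = -1 / 2 * (N q * _)
      ring
    · change _ = -1 / 2 * (P q * _)
      ring
  refine ⟨fun q => Real.exp (-1 / 2 * u q), fun q => Real.exp (1 * u q), ?_, fun h0 => ?_⟩
  · filter_upwards [hu.eventually_nhds, hWn] with q h1 h2
    have hs := h.lsr.smoothVec h2
    have h3 := h1.self_of_nhds
    refine ⟨⟨(hexp _ q h3.1).1, (hexp _ q h3.1).1⟩, ⟨Real.exp_pos _, Real.exp_pos _⟩, ?_, ?_, ?_⟩
    · rw [← Real.exp_nat_mul, ← Real.exp_add]
      convert Real.exp_zero using 2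
      push_cast
      ring
    · rw [bracket_smul_right (hexp _ q h3.1).1 (hs _), bracket_smul_left (hexp _ q h3.1).1 (hs _),
        dirD_smul_field, (hexp _ q h3.1).2, (hexp _ q h3.1).2, hbr q h2, h3.2.1, h3.2.2]
      simp only [smul_eq_mul]
      module
    · intro A B
      have h4 : (fun r => Real.exp (1 * u r) *
          dirD (fun r => e r (A, 0)) (fun r => Real.exp (-1 / 2 * u r)) r) =ᶠ[𝓝 q]
          fun r => -1 / 2 * (![N, P] A r * Real.exp (1 / 2 * u r)) := by
        filter_upwards [h1] with r hr
        exact hκ r hr A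
      have h5 : SmoothFun (![N, P] A) q :=
        (Fin.forall_fin_two (p := fun A => SmoothFun (![N, P] A) q)).2 ⟨hNs q h2, hPs q h2⟩ A
      obtain ⟨h6, h7⟩ := hexp (1 / 2) q h3.1
      rw [dirD_congr h4, dirD_mul (f := fun _ => (-1 / 2 : ℝ))
        (g := fun r => ![N, P] A r * Real.exp (1 / 2 * u r)) contMDiffAt_const (h5.mul h6),
        dirD_const, dirD_mul h5 h6, h7]
      obtain ⟨e1, e2, e3, e4⟩ := heq q h2
      clear h4 h5
      revert A B
      simp only [Fin.forall_fin_two]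
      refine ⟨⟨?_, ?_⟩, ?_, ?_⟩ <;>
      · simp [e1, e2, e3, e4, h3.2.1, h3.2.2]
        ring
  · have h1 : ∀ A : Fin 2, ![N, P] A p = 0 := by
      intro A
      have h2 := hκ p hu.self_of_nhds A
      rw [h0 A] at h2
      have := Real.exp_pos (1 / 2 * u p)
      have h3 : ![N, P] A p * Real.exp (1 / 2 * u p) = 0 := by linarith
      exact (mul_eq_zero.1 h3).resolve_right this.ne'
    have hN0 : N p = 0 := h1 0
    have hP0 : P p = 0 := h1 1
    rw [hbr p hp, hN0, hP0, neg_zero, zero_smul, zero_smul, add_zero]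

end SpinData

/-! ### Existence of the coordinates -/

variable {M : Type*} [TopologicalSpace M] [ChartedSpace E4 M] [IsManifold (𝓡 4) ∞ M]

/-- Two commuting fields still commute after a linear change with coefficients constant along them. -/
lemma bracket_leafwise_comb {α β : VField M} {q : M} (hα : SmoothVec α q) (hβ : SmoothVec β q)
    (hαβ : bracket α β q = 0) {a b c d : M → ℝ}
    (ha : SmoothFun a q ∧ dirD α a q = 0 ∧ dirD β a q = 0)
    (hb : SmoothFun b q ∧ dirD α b q = 0 ∧ dirD β b q = 0)
    (hc : SmoothFun c q ∧ dirD α c q = 0 ∧ dirD β c q = 0)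
    (hd : SmoothFun d q ∧ dirD α d q = 0 ∧ dirD β d q = 0) :
    bracket (fun r => a r • α r + b r • β r) (fun r => c r • α r + d r • β r) q = 0 := by
  rw [bracket_comb_right hc.1 hd.1 hα hβ, bracket_comb_left ha.1 hb.1 hα hβ,
    bracket_comb_left ha.1 hb.1 hα hβ, dirD_comb, dirD_comb, ha.2.1, ha.2.2, hb.2.1, hb.2.2, hc.2.1,
    hc.2.2, hd.2.1, hd.2.2, hαβ, bracket_swap β α, hαβ, bracket_self, bracket_self]
  simp

namespace SpinData

variable {G : SpinData M} {U W : Set M}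

/-- Near a point where the α-distribution is not parallel there are an inverse conformal factor `w` and
commuting α-vector fields `Γ_0, Γ_1` which are the gradients of functions `X_0, X_1` for the metric
`w² h`, and along which `w` has derivatives `1` and `0`. -/
theorem exists_commuting_gradients (hG : G.IsASAlphaGeometryOn Set.univ) (hR : G.IsRPSOn Set.univ)
    {p : M} (hp : ¬ G.IsParallelAt p) :
    ∃ (W : Set M) (e : ∀ q : M, Tetrad q) (w : M → ℝ) (X : Fin 2 → M → ℝ) (Γ : Fin 2 → VField M),
      p ∈ W ∧ G.IsLSROn W e (fun _ => ![1, 0]) ∧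
      (∀ c d : ℝ, ∃ Z : VField M, dirD Z (X 0) p = c ∧ dirD Z (X 1) p = d) ∧
      LinearIndependent ℝ ![Γ 0 p, Γ 1 p] ∧
      ∀ᶠ q in 𝓝 p, (SmoothFun w q ∧ 0 < w q) ∧
        (∀ A, SmoothFun (X A) q ∧ ∀ B : Fin 2, dirD (fun r => e r (B, 0)) (X A) q = 0) ∧
        (∀ A, SmoothVec (Γ A) q) ∧ bracket (Γ 0) (Γ 1) q = 0 ∧
        (∀ A : Fin 2, dirD (Γ A) w q = if A = 0 then 1 else 0) ∧
        ∀ (A : Fin 2) (Z : VField M), (G.rescale w).metric q (Γ A q) (Z q) = dirD Z (X A) q := by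
  have hGs := hG.toIsSpinGeometryOn
  obtain ⟨y, σ, W, e, hy, hσ, hWU, hpW, h, α₀, β₀, hαβ₀, hcomb⟩ :=
    hG.integrable.exists_adapted hGs (Set.mem_univ p)
  obtain ⟨w, f, hwf, hnp⟩ :=
    h.exists_conformalFactor hGs hG.integrable hG.multipleWPS hR hWU hpW
  have hWn : ∀ᶠ q in 𝓝 p, q ∈ W := h.lsr.isOpen.mem_nhds hpW
  have hσ2 : σ * σ = 1 := by rcases hσ with rfl | rfl <;> norm_num
  have hσ0 : σ ≠ 0 := by rcases hσ with rfl | rfl <;> norm_num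
  set κ : Fin 2 → M → ℝ := fun A q => f q * dirD (fun r => e r (A, 0)) w q with hκ
  have hκs : ∀ᶠ q in 𝓝 p, ∀ A, SmoothFun (κ A) q := by
    filter_upwards [hwf, hWn] with q h1 h2 A
    exact h1.1.2.mul (h1.1.1.dirD (h.lsr.smoothVec h2 _))
  have hκ0 : ∀ᶠ q in 𝓝 p, ∀ A B, dirD (fun r => e r (B, 0)) (κ A) q = 0 :=
    hwf.mono fun q h1 => h1.2.2.2.2
  -- rectification of the field `(κ₀, σ κ₁)` on the leaf space
  set ν : M → ℝ × ℝ := fun q => (κ 0 q, σ * κ 1 q) with hν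
  have hνd : ∀ᶠ q in 𝓝 p, SmoothFun ν q ∧ ∀ B, dirD (fun r => e r (B, 0)) ν q = 0 := by
    filter_upwards [hκs, hκ0] with q h1 h2
    have h3 : SmoothFun (fun r => σ * κ 1 r) q := contMDiffAt_const.mul (h1 1)
    refine ⟨(h1 0).prodMk h3, fun B => ?_⟩
    rw [hν, dirD_prodMk (h1 0) h3, dirD_mul (f := fun _ => σ) contMDiffAt_const (h1 1), dirD_const,
      h2, h2]
    simp
  have hνc : ∀ γ : VField M, (∀ q ∈ W, ∃ a b : ℝ, γ q = a • e q (0, 0) + b • e q (1, 0)) →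
      ∀ᶠ q in 𝓝 p, dirD γ ν q = 0 := by
    intro γ hγ
    filter_upwards [hνd, hWn] with q h1 h2
    obtain ⟨a, b, hab⟩ := hγ q h2
    rw [dirD_congr_field (Y := fun r => a • e r (0, 0) + b • e r (1, 0)) hab,
      dirD_comb _ _ (fun _ => a) (fun _ => b), h1.2, h1.2, smul_zero, smul_zero, add_zero]
  have hν0 : ν p ≠ 0 := by
    intro h0
    have h1 : κ 0 p = 0 := congrArg Prod.fst h0
    have h2 : σ * κ 1 p = 0 := congrArg Prod.snd h0
    refine hp (h.isParallelAt hGs hWU hpW (hnp (Fin.forall_fin_two.2 ⟨h1, ?_⟩)))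
    exact (mul_eq_zero.1 h2).resolve_left hσ0
  obtain ⟨ξ, hξ, A, hA⟩ := exists_leafSpace_rectification hy hαβ₀ (hνd.mono fun q h1 => h1.1)
    (hνc α₀ fun q hq => (hcomb q hq).1) (hνc β₀ fun q hq => (hcomb q hq).2) hν0
  -- the leaf coordinates, and functions of them
  set x : M → ℝ × ℝ := fun q => (y q).2.2 with hx
  have hxs : ∀ᶠ q in 𝓝 p, SmoothFun x q := by
    filter_upwards [hy.1] with q h1
    exact smoothFun_comp (h := fun v : ℝ × ℝ × ℝ × ℝ => v.2.2) (by fun_prop) h1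
  have hxm : ∀ᶠ q in 𝓝 p, ∀ X : VField M, dirD X x q =
      (G.metric q (e q (0, 0)) (X q), σ * G.metric q (e q (1, 0)) (X q)) := by
    filter_upwards [hxs, hWn] with q h1 h2 X
    have h3 := dirD_clm (X := X) (ContinuousLinearMap.fst ℝ ℝ ℝ) h1
    have h4 := dirD_clm (X := X) (ContinuousLinearMap.snd ℝ ℝ ℝ) h1
    have h5 := h.metric_eq q h2 0 X
    have h6 := h.metric_eq q h2 1 X
    have h7 : dirD X (fun q => σ * (y q).2.2.2) q = σ * dirD X (fun q => (y q).2.2.2) q := by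
      rw [dirD_mul (f := fun _ => σ) (g := fun q => (y q).2.2.2) contMDiffAt_const
        (smoothFun_comp (h := fun v : ℝ × ℝ => v.2) (by fun_prop) h1), dirD_const]
      ring
    refine Prod.ext (h3.symm.trans h5.symm) (h4.symm.trans ?_)
    have h8 : G.metric q (e q (1, 0)) (X q) = σ * dirD X (fun q => (y q).2.2.2) q := h6.trans h7
    rw [h8, ← mul_assoc, hσ2, one_mul]
    rfl
  have hxe : ∀ᶠ q in 𝓝 p, ∀ B : Fin 2, dirD (fun r => e r (B, 0)) x q = 0 := by
    filter_upwards [hxm, hWn] with q h1 h2 B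
    have hn := hGs.null q (hWU h2) _ (h.lsr.mem_frames h2)
    rw [h1, hn, hn]
    simp [eta]
  -- coefficients `ξ_i^j`: the partial derivatives of the new leaf coordinates
  set X : Fin 2 → M → ℝ := ![fun q => (ξ (x q)).1, fun q => (ξ (x q)).2] with hX
  set a : Fin 2 → M → ℝ := ![fun q => (fderiv ℝ ξ (x q) (1, 0)).1, fun q => (fderiv ℝ ξ (x q) (1, 0)).2]
    with ha
  set b : Fin 2 → M → ℝ := ![fun q => σ * (fderiv ℝ ξ (x q) (0, 1)).1,
    fun q => σ * (fderiv ℝ ξ (x q) (0, 1)).2] with hb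
  have hleaf : ∀ᶠ q in 𝓝 p, ∀ θ : ℝ × ℝ → ℝ, ContDiffAt ℝ ∞ θ (x q) →
      SmoothFun (fun r => θ (x r)) q ∧ ∀ B : Fin 2, dirD (fun r => e r (B, 0)) (fun r => θ (x r)) q = 0 := by
    filter_upwards [hxs, hxe] with q h1 h2 θ hθ
    refine ⟨smoothFun_comp hθ h1, fun B => ?_⟩
    rw [dirD_comp (hθ.differentiableAt (by simp)) h1, h2, map_zero]
  have hξd : ∀ᶠ q in 𝓝 p, ∀ v : ℝ × ℝ, ContDiffAt ℝ ∞ (fun z => fderiv ℝ ξ z v) (x q) := by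
    filter_upwards [hξ] with q h1 v
    exact (h1.1.fderiv_right (m := ∞) (by simp)).clm_apply contDiffAt_const
  have hXs : ∀ᶠ q in 𝓝 p, ∀ A, SmoothFun (X A) q ∧ ∀ B : Fin 2, dirD (fun r => e r (B, 0)) (X A) q = 0 := by
    filter_upwards [hleaf, hξ] with q h1 h2
    exact Fin.forall_fin_two.2 ⟨h1 (fun z => (ξ z).1) h2.1.fst, h1 (fun z => (ξ z).2) h2.1.snd⟩
  have has : ∀ᶠ q in 𝓝 p, ∀ A, SmoothFun (a A) q ∧ ∀ B : Fin 2, dirD (fun r => e r (B, 0)) (a A) q = 0 := by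
    filter_upwards [hleaf, hξd] with q h1 h2
    exact Fin.forall_fin_two.2 ⟨h1 (fun z => (fderiv ℝ ξ z (1, 0)).1) (h2 _).fst,
      h1 (fun z => (fderiv ℝ ξ z (1, 0)).2) (h2 _).snd⟩
  have hbs : ∀ᶠ q in 𝓝 p, ∀ A, SmoothFun (b A) q ∧ ∀ B : Fin 2, dirD (fun r => e r (B, 0)) (b A) q = 0 := by
    filter_upwards [hleaf, hξd] with q h1 h2
    exact Fin.forall_fin_two.2
      ⟨h1 (fun z => σ * (fderiv ℝ ξ z (0, 1)).1) (contDiffAt_const.mul (h2 _).fst),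
      h1 (fun z => σ * (fderiv ℝ ξ z (0, 1)).2) (contDiffAt_const.mul (h2 _).snd)⟩
  have hXd : ∀ᶠ q in 𝓝 p, ∀ (A : Fin 2) (Z : VField M), dirD Z (X A) q =
      a A q * G.metric q (e q (0, 0)) (Z q) + b A q * G.metric q (e q (1, 0)) (Z q) := by
    filter_upwards [hxs, hxm, hξ] with q h1 h2 h3
    have h4 : ∀ Z : VField M, dirD Z (fun r => ξ (x r)) q =
        G.metric q (e q (0, 0)) (Z q) • fderiv ℝ ξ (x q) (1, 0)
          + (σ * G.metric q (e q (1, 0)) (Z q)) • fderiv ℝ ξ (x q) (0, 1) := by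
      intro Z
      rw [dirD_comp (f := x) (h3.1.differentiableAt (by simp)) h1, h2, ← map_smul, ← map_smul, ← map_add]
      congr 1
      simp
    have h5 : SmoothFun (fun r => ξ (x r)) q := smoothFun_comp h3.1 h1
    refine Fin.forall_fin_two.2 ⟨fun Z => ?_, fun Z => ?_⟩
    · have h6 := dirD_clm (X := Z) (ContinuousLinearMap.fst ℝ ℝ ℝ) h5
      rw [h4 Z] at h6
      refine h6.trans ?_
      simp [ha, hb]
      ring
    · have h6 := dirD_clm (X := Z) (ContinuousLinearMap.snd ℝ ℝ ℝ) h5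
      rw [h4 Z] at h6
      refine h6.trans ?_
      simp [ha, hb]
      ring
  have hrel : ∀ᶠ q in 𝓝 p, ∀ A : Fin 2, a A q * κ 0 q + b A q * κ 1 q = if A = 0 then 1 else 0 := by
    filter_upwards [hξ] with q h1
    have h2 : fderiv ℝ ξ (x q) (ν q) = κ 0 q • fderiv ℝ ξ (x q) (1, 0)
        + (σ * κ 1 q) • fderiv ℝ ξ (x q) (0, 1) := by
      rw [← map_smul, ← map_smul, ← map_add]
      congr 1
      simp [hν]
    have h3 := h2.symm.trans h1.2
    have h4 := congrArg Prod.fst h3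
    have h5 := congrArg Prod.snd h3
    simp at h4 h5
    refine Fin.forall_fin_two.2 ⟨?_, ?_⟩
    · simp [ha, hb]
      linarith
    · simp [ha, hb]
      linarith
  -- the new α-vector fields
  set Γ : Fin 2 → VField M :=
    fun A r => a A r • (f r • e r (0, 0)) + b A r • (f r • e r (1, 0)) with hΓ
  have hfe : ∀ᶠ q in 𝓝 p, ∀ B : Fin 2, SmoothVec (fun r => f r • e r (B, 0)) q := by
    filter_upwards [hwf, hWn] with q h1 h2 B
    exact (h.lsr.smoothVec h2 _).smul h1.1.2
  have hΓs : ∀ᶠ q in 𝓝 p, ∀ A, SmoothVec (Γ A) q := by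
    filter_upwards [hfe, has, hbs] with q h1 h2 h3 A
    exact SmoothVec.comb (h2 A).1 (h3 A).1 (h1 0) (h1 1)
  have hΓb : ∀ᶠ q in 𝓝 p, bracket (Γ 0) (Γ 1) q = 0 := by
    filter_upwards [hwf, hfe, has, hbs] with q h1 h2 h3 h4
    have h5 : ∀ g : M → ℝ, (SmoothFun g q ∧ ∀ B : Fin 2, dirD (fun r => e r (B, 0)) g q = 0) →
        SmoothFun g q ∧ dirD (fun r => f r • e r (0, 0)) g q = 0 ∧
          dirD (fun r => f r • e r (1, 0)) g q = 0 := by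
      intro g hg
      rw [dirD_smul_field, dirD_smul_field, hg.2, hg.2, smul_zero]
      exact ⟨hg.1, rfl, rfl⟩
    exact bracket_leafwise_comb (h2 0) (h2 1) h1.2.2.2.1 (h5 _ (h3 0)) (h5 _ (h4 0)) (h5 _ (h3 1))
      (h5 _ (h4 1))
  have hΓw : ∀ᶠ q in 𝓝 p, ∀ A : Fin 2, dirD (Γ A) w q = if A = 0 then 1 else 0 := by
    filter_upwards [hrel] with q h1 A
    rw [← h1 A]
    refine (dirD_comb (fun r => f r • e r (0, 0)) (fun r => f r • e r (1, 0)) _ _ _ _).trans ?_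
    rw [dirD_smul_field, dirD_smul_field]
    rfl
  have hΓm : ∀ᶠ q in 𝓝 p, ∀ (A : Fin 2) (Z : VField M),
      G.metric q (Γ A q) (Z q) = f q * dirD Z (X A) q := by
    filter_upwards [hXd] with q h1 A Z
    rw [h1]
    simp only [hΓ, map_add, map_smul]
    change a A q * (f q * G.metric q (e q (0, 0)) (Z q))
      + b A q * (f q * G.metric q (e q (1, 0)) (Z q)) = _
    ring
  have hξp : fderiv ℝ ξ (x p) = A := hA.fderiv
  have hΓi : LinearIndependent ℝ ![Γ 0 p, Γ 1 p] := by
    rw [LinearIndependent.pair_iff]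
    intro s t hst
    have hf := hwf.self_of_nhds.2.1.2
    have h1 := (LinearIndependent.pair_iff.1 (linearIndependent_pair
      (hGs.null p (hWU hpW) _ (h.lsr.mem_frames hpW)))) (f p * (s * a 0 p + t * a 1 p))
      (f p * (s * b 0 p + t * b 1 p)) (by rw [← hst]; simp only [hΓ]; module)
    have h2 := (mul_eq_zero.1 h1.1).resolve_left hf.ne'
    have h3 := (mul_eq_zero.1 h1.2).resolve_left hf.ne'
    have h4 : s * (A (1, 0)).1 + t * (A (1, 0)).2 = 0 := by
      simpa [ha, hξp] using h2
    have h5 : s * (A (0, 1)).1 + t * (A (0, 1)).2 = 0 := by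
      have h6 : σ * (s * (A (0, 1)).1 + t * (A (0, 1)).2) = 0 := by
        have h7 : s * b 0 p + t * b 1 p = σ * (s * (A (0, 1)).1 + t * (A (0, 1)).2) := by
          simp [hb, hξp]
          ring
        rw [← h7, h3]
      exact (mul_eq_zero.1 h6).resolve_left hσ0
    obtain ⟨v, hv⟩ := A.surjective (s, t)
    have h6 : A v = v.1 • A (1, 0) + v.2 • A (0, 1) := by
      rw [← map_smul, ← map_smul, ← map_add]
      congr 1
      simp
    rw [h6] at hv
    have h7 := congrArg Prod.fst hv
    have h8 := congrArg Prod.snd hv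
    simp at h7 h8
    have h9 : s * s + t * t = 0 := by
      linear_combination v.1 * h4 + v.2 * h5 - s * h7 - t * h8
    constructor <;> nlinarith [mul_self_nonneg s, mul_self_nonneg t]
  have hsurj : ∀ c d : ℝ, ∃ Z : VField M, dirD Z (X 0) p = c ∧ dirD Z (X 1) p = d := by
    intro c d
    obtain ⟨u, hu⟩ := A.surjective (c, d)
    obtain ⟨Z, hZ⟩ := hy.exists_dirD_eq finrank_prod_four (0, 0, u.1, u.2)
    have hxp := hxs.self_of_nhds
    have h1 : dirD Z x p = u := by
      have h2 := dirD_clm (X := Z) ((ContinuousLinearMap.snd ℝ ℝ (ℝ × ℝ)).comp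
        (ContinuousLinearMap.snd ℝ ℝ (ℝ × ℝ × ℝ))) hy.1.self_of_nhds
      rw [hZ] at h2
      exact h2
    have h3 : dirD Z (fun r => ξ (x r)) p = (c, d) := by
      rw [dirD_comp (f := x) hA.differentiableAt hxp, h1, hξp]
      exact hu
    have h4 : SmoothFun (fun r => ξ (x r)) p := smoothFun_comp hξ.self_of_nhds.1 hxp
    refine ⟨Z, ?_, ?_⟩
    · refine (dirD_clm (X := Z) (ContinuousLinearMap.fst ℝ ℝ ℝ) h4).trans ?_
      rw [h3]
      rfl
    · refine (dirD_clm (X := Z) (ContinuousLinearMap.snd ℝ ℝ ℝ) h4).trans ?_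
      rw [h3]
      rfl
  refine ⟨W, e, w, X, Γ, hpW, h.lsr, hsurj, hΓi, ?_⟩
  filter_upwards [hwf, hXs, hΓs, hΓb, hΓw, hΓm] with q h1 h2 h3 h4 h5 h6
  refine ⟨⟨h1.1.1, h1.2.1.1⟩, h2, h3, h4, h5, fun A Z => ?_⟩
  change w q ^ 2 * G.metric q (Γ A q) (Z q) = _
  rw [h6, ← mul_assoc, h1.2.2.1, one_mul]

/-- Walker coordinates in which the inverse conformal factor is the first coordinate. -/
theorem exists_conformalOrientedWalkerChart (hG : G.IsASAlphaGeometryOn Set.univ)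
    (hR : G.IsRPSOn Set.univ) {p : M} (hp : ¬ G.IsParallelAt p) :
    ∃ φ : OpenPartialHomeomorph M E4, p ∈ φ.source ∧ ∃ Ω : M → ℝ,
      G.IsConformalOrientedWalkerChart φ Ω ∧
        ∃ m n : ℝ, ∀ q ∈ φ.source, Ω q = (m * φ q 0 + n * φ q 1)⁻¹ := by
  have hGs := hG.toIsSpinGeometryOn
  obtain ⟨W, e, w, X, Γ, hpW, h, hsurj, hΓi, hev⟩ := exists_commuting_gradients hG hR hp
  obtain ⟨v, hv⟩ := exists_leafwise_primitive (hev.mono fun q h1 => h1.2.2.1 0)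
    (hev.mono fun q h1 => h1.2.2.1 1)
    hΓi (f := fun _ => 0) (g := fun _ => 1) (Eventually.of_forall fun q => contMDiffAt_const)
    (Eventually.of_forall fun q => contMDiffAt_const)
    (hev.mono fun q h1 => ⟨0, 0, by rw [h1.2.2.2.1]; simp, by simp⟩)
  -- `v` is the second coordinate along the leaves: `Γ_0 v = 0` and `Γ_1 v = 1`
  -- the sign `τ` below makes the tetrad adapted to `X_0, τ X_1` agree with the spinor structure; its
  -- α-vector fields are then `Γ_0` and `τ Γ_1`
  obtain ⟨W₁, hW₁, hW₁o, hpW₁⟩ := eventually_nhds_iff.1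
    (Eventually.and (h.isOpen.mem_nhds hpW) (hv.and hev))
  have hws : ∀ q ∈ W₁, SmoothFun w q := fun q hq => (hW₁ q hq).2.2.1.1
  have hw0 : ∀ q ∈ W₁, 0 < w q := fun q hq => (hW₁ q hq).2.2.1.2
  have hG' : (G.rescale w).IsSpinGeometryOn W₁ := hGs.rescale hW₁o (Set.subset_univ _) hws hw0
  have hlsr := (h.mono hW₁o fun q hq => (hW₁ q hq).1).rescale hws hw0
  have hXe : ∀ A, ∀ᶠ q in 𝓝 p, SmoothFun (X A) q ∧
      ∀ B : Fin 2, dirD (fun r => (w r)⁻¹ • e r (B, 0)) (X A) q = 0 := by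
    intro A
    filter_upwards [hev] with q h1
    refine ⟨(h1.2.1 A).1, fun B => ?_⟩
    rw [dirD_smul_field (fun r => e r (B, 0)) (fun r => (w r)⁻¹), (h1.2.1 A).2, smul_zero]
  obtain ⟨τ, hτ, W₂, hW₂, hpW₂, e', h'⟩ := exists_adapted hG' hlsr le_rfl hpW₁ (hXe 0) (hXe 1)
    hsurj
  have hτ2 : τ * τ = 1 := by rcases hτ with rfl | rfl <;> norm_num
  have he' : ∀ q ∈ W₂, e' q (0, 0) = Γ 0 q ∧ e' q (1, 0) = τ • Γ 1 q := by
    intro q hq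
    obtain ⟨-, -, -, h3, -, -, -, h4⟩ := hW₁ q (hW₂ hq)
    have hn := hG'.null q (hW₂ hq) _ (h'.lsr.mem_frames hq)
    have h5 : ∀ Z : VField M, dirD Z (fun r => τ * X 1 r) q = τ * dirD Z (X 1) q := by
      intro Z
      rw [dirD_mul (f := fun _ => τ) contMDiffAt_const (h3 1).1, dirD_const]
      ring
    constructor
    · refine metric_ext _ hn fun c => ?_
      exact (h'.metric_eq q hq 0 fun r => e' r c).trans (h4 0 _).symm
    · refine metric_ext _ hn fun c => ?_
      refine (h'.metric_eq q hq 1 fun r => e' r c).trans ((h5 _).trans ?_)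
      rw [← h4 1, map_smul]
      rfl
  have hpar : ∀ q ∈ W₂, (G.rescale w).IsParallelAt q := by
    intro q hq
    refine h'.isParallelAt hG' hW₂ hq ?_
    have h1 : (fun r => e' r (0, 0)) =ᶠ[𝓝 q] Γ 0 := by
      filter_upwards [h'.lsr.isOpen.mem_nhds hq] with r hr using (he' r hr).1
    have h2 : (fun r => e' r (1, 0)) =ᶠ[𝓝 q] fun r => τ • Γ 1 r := by
      filter_upwards [h'.lsr.isOpen.mem_nhds hq] with r hr using (he' r hr).2
    obtain ⟨-, -, -, -, h4, h3, -⟩ := hW₁ q (hW₂ hq)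
    rw [bracket_congr h1 h2, bracket_smul_right (f := fun _ => τ) contMDiffAt_const (h4 1), dirD_const,
      h3, zero_smul, smul_zero, add_zero]
  obtain ⟨φ, hpφ, hφW, hφu, hφ⟩ := h'.exists_orientedWalkerChart hG' hW₂ hpW₂
    (u := ![w, fun q => τ * v q]) (by
      filter_upwards [h'.lsr.isOpen.mem_nhds hpW₂] with q hq
      obtain ⟨-, h3, h1, -, -, -, h2, -⟩ := hW₁ q (hW₂ hq)
      obtain ⟨h4, h5⟩ := he' q hq
      have h6 : ∀ Z : VField M, dirD Z (fun r => τ * v r) q = τ * dirD Z v q := by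
        intro Z
        rw [dirD_mul (f := fun _ => τ) contMDiffAt_const h3.1, dirD_const]
        ring
      have h7 : ∀ g : M → ℝ, dirD (fun r => e' r (1, 0)) g q = τ * dirD (Γ 1) g q := by
        intro g
        rw [dirD_congr_field (Y := fun r => τ • Γ 1 r) h5, dirD_smul_field (Γ 1) fun _ => τ]
        rfl
      have h8 : ∀ g : M → ℝ, dirD (fun r => e' r (0, 0)) g q = dirD (Γ 0) g q :=
        fun g => dirD_congr_field h4
      rw [Fin.forall_fin_two]
      refine ⟨⟨h1.1, ?_⟩, contMDiffAt_const.mul h3.1, ?_⟩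
      · rw [Fin.forall_fin_two]
        simp [h7, h8, h2]
      · rw [Fin.forall_fin_two]
        simp [h6, h7, h8, h3.2.1, h3.2.2, hτ2]) (h'.lsr.isOpen.mem_nhds hpW₂)
  have hφ₁ : φ.source ⊆ W₁ := hφW.trans hW₂
  have hinv : (G.rescale fun q => ((w q)⁻¹)⁻¹) = G.rescale w := by simp only [inv_inv]
  refine ⟨φ, hpφ, fun q => (w q)⁻¹, ⟨fun q hq => inv_pos.2 (hw0 q (hφ₁ hq)), fun q hq => ?_, ?_, ?_⟩,
    1, 0, fun q hq => ?_⟩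
  · exact (smoothFun_comp (f := w) (h := fun t => t⁻¹) (contDiffAt_inv ℝ (hw0 q (hφ₁ hq)).ne')
      (hws q (hφ₁ hq))).contMDiffWithinAt
  · rw [hinv]
    exact ⟨hGs.rescale φ.open_source (Set.subset_univ _) (fun q hq => hws q (hφ₁ hq))
      fun q hq => hw0 q (hφ₁ hq), fun q hq => hpar q (hφW hq)⟩
  · rw [hinv]
    exact hφ
  · rw [(hφu q hq).1, one_mul, zero_mul, add_zero]
    rfl

end SpinData

end NeutralSpin

end

theorem mainTheorem5 {M : Type*} [TopologicalSpace M] [ChartedSpace NeutralSpin.E4 M]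
    [IsManifold (𝓡 4) ∞ M] (G : NeutralSpin.SpinData M)
    (hG : G.IsASAlphaGeometryOn Set.univ) (hRPS : G.IsRPSOn Set.univ)
    (p : M) (hp : ¬ G.IsParallelAt p) :
    ∃ φ : OpenPartialHomeomorph M NeutralSpin.E4, p ∈ φ.source ∧
      ∃ Ω : M → ℝ, G.IsConformalOrientedWalkerChart φ Ω ∧
        ∃ m n : ℝ, ∀ q ∈ φ.source, Ω q = (m * φ q 0 + n * φ q 1)⁻¹ :=
  NeutralSpin.SpinData.exists_conformalOrientedWalkerChart hG hRPS hp
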